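/- Let $\mathbb X$ be a non-empty locally compact separable metric space with its Borel $\sigma$-algebra, and let $X=\{X_t,\ t\ge 0\}$ be a time-homogeneous strong Markov process in $\mathbb X$ with càdlàg trajectories. Let $P_x$ be its distribution when $X_0=x$, $E_x$ the expectation under $P_x$, and $P_t(x,dy)$ its transition function. For closed $K\subset\mathbb X$ and $t\ge 0$ put $\tau_K=\inf\{s\ge 0: X_s\in K\}$ and $\tau_K^t=\inf\{s\ge 0: X_{t+s}\in K\}$ (with $\inf\emptyset=+\infty$, $e^{+\infty}=+\infty$). Let $\|\cdot\|_{var}$ be the total variation norm $\|\varkappa\|_{var}=|\varkappa|(\mathbb X)$ of a signed measure. Assume that $X$ satisfies the local Doeblin condition: for every compact $A\subset\mathbb X$ there is $T>0$ with $$\sup_{x,y\in A}\tfrac12\|P_T(x,\cdot)-P_T(y,\cdot)\|_{var}<1 .$$ Let there exist a compact set $K\subset\mathbb X$ and $S,\alpha>0$ such that 1) $\displaystyle\lim_{c\to+\infty}\liminf_{x\to\infty}P_x(\tau_K>c)>0$ (here $x\to\infty$ means that $x$ leaves every compact set; if $\mathbb X$ is compact the condition holds vacuously); 2) $E_xe^{\alpha\tau_K}<+\infty$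 for all $x\in\mathbb X$; 3) $\displaystyle\sup_{x\in K,\ t\in[0,S]}E_xe^{\alpha\tau_K^t}<+\infty$. Then for every $\alpha'\in(0,\alpha)$ the process $X$ admits an exponential $\phi$-coupling with $\phi(x)=E_xe^{\alpha'\tau_K}$. That is: $\phi$ takes values in $[1,+\infty)$ and is measurable with respect to the completion of every Borel probability measure on $\mathbb X$, and there exist an invariant probability measure $\pi$ for $X$ and constants $C_\phi>0$, $\beta>0$ such that for every $x\in\mathbb X$ there is a two-component process $Z=(Z^1,Z^2)$, in which $Z^1$ is distributed as $X$ started at $x$ and $Z^2$ is distributed as $X$ with initial distribution $\pi$, satisfying $$E\big[\phi(Z^1_t)+\phi(Z^2_t)\big]\mathbf 1_{Z^1_t\ne Z^2_t}\le C_\phi e^{-\beta t}\phi(x),\qquad t\ge 0 .$$ In addition, condition 1) is not required if $X$ satisfies the extended Doeblin condition on $K$: there are $0<T_1<T_2$ with $$\sup_{x,y\in K,\ s,t\in[T_1,T_2]}\tfrac12\|P_s(x,\cdot)-P_t(y,\cdot)\|_{var}<1 .$$ -/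

import Mathlib

open Set Filter Topology MeasureTheory ProbabilityTheory
open scoped NNReal ENNReal

/-- Càdlàg paths in `E`, indexed by `[0, ∞)`: right-continuous with left limits in `E`. -/
structure CadlagPath (E : Type*) [TopologicalSpace E] where
  toFun : ℝ≥0 → E
  rightCts : ∀ t, ContinuousWithinAt toFun (Ici t) t
  leftLim : ∀ t, ∃ l, Tendsto toFun (𝓝[<] t) (𝓝 l)

namespace CadlagPath

variable {E : Type*} [TopologicalSpace E]

instance : CoeFun (CadlagPath E) (fun _ => ℝ≥0 → E) := ⟨CadlagPath.toFun⟩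

/-- The σ-algebra generated by the coordinate maps `ω ↦ ω t`. -/
instance [MeasurableSpace E] : MeasurableSpace (CadlagPath E) :=
  ⨆ t : ℝ≥0, MeasurableSpace.comap (fun ω : CadlagPath E => ω t) inferInstance

theorem measurable_eval [MeasurableSpace E] (t : ℝ≥0) :
    Measurable (fun ω : CadlagPath E => ω t) :=
  measurable_iff_comap_le.2
    (le_iSup (fun t : ℝ≥0 => MeasurableSpace.comap (fun ω : CadlagPath E => ω t) inferInstance) t)

/-- The natural filtration `F_t = σ(X_s, s ≤ t)` of the coordinate process. -/
def natFiltration (E : Type*) [TopologicalSpace E] [MeasurableSpace E] :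
    Filtration ℝ≥0 (inferInstance : MeasurableSpace (CadlagPath E)) where
  seq t := ⨆ s ∈ Iic t, MeasurableSpace.comap (fun ω : CadlagPath E => ω s) inferInstance
  mono' _ _ hst := biSup_mono fun _ hr => le_trans hr hst
  le' _ := iSup₂_le fun s _ => measurable_iff_comap_le.1 (measurable_eval s)

/-- `τ_K^t = inf {s ≥ 0 : X_{t+s} ∈ K}`, with `inf ∅ = ∞`. -/
noncomputable def hitAfter (K : Set E) (t : ℝ≥0) (ω : CadlagPath E) : ℝ≥0∞ :=
  ⨅ (s : ℝ≥0) (_ : ω (t + s) ∈ K), (s : ℝ≥0∞)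

/-- The hitting time `τ_K = inf {t ≥ 0 : X_t ∈ K}`, with `inf ∅ = ∞`. -/
noncomputable def hit (K : Set E) (ω : CadlagPath E) : ℝ≥0∞ :=
  ⨅ (s : ℝ≥0) (_ : ω s ∈ K), (s : ℝ≥0∞)

end CadlagPath

/-- A time-homogeneous strong Markov process with càdlàg trajectories in `E`, in its canonical
realization: `law x` is the distribution `P_x`, on path space, of the process started at `x`.
The strong Markov property is required at the stopping times of the natural filtration (the
smallest filtration for which it can be asked). The simple Markov property is the case of
constant stopping times. -/
structure CadlagStrongMarkov (E : Type*) [TopologicalSpace E] [MeasurableSpace E] where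
  law : Kernel E (CadlagPath E)
  isMarkov : IsMarkovKernel law
  law_zero : ∀ x, (law x).map (fun ω => ω 0) = Measure.dirac x
  strongMarkov : ∀ (x : E) (τ : CadlagPath E → WithTop ℝ≥0)
    (hτ : IsStoppingTime (CadlagPath.natFiltration E) τ) (B : Set (CadlagPath E)),
    MeasurableSet[hτ.measurableSpace] B → ∀ (s : ℝ≥0) (A : Set E), MeasurableSet A →
      law x (B ∩ {ω | τ ω ≠ ⊤ ∧ ω ((τ ω).untopD 0 + s) ∈ A}) =
        ∫⁻ ω in B ∩ {ω | τ ω ≠ ⊤},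
          (law (ω ((τ ω).untopD 0))).map (fun ω' => ω' s) A ∂(law x)

namespace CadlagStrongMarkov

section

variable {E : Type*} [TopologicalSpace E] [MeasurableSpace E] (X : CadlagStrongMarkov E)

instance : IsMarkovKernel X.law := X.isMarkov

/-- The transition function `P_t(x, dy)`: the distribution of `X_t` under `P_x`. -/
noncomputable def trans (t : ℝ≥0) : Kernel E E := X.law.map (fun ω => ω t)

instance (t : ℝ≥0) : IsMarkovKernel (X.trans t) :=
  Kernel.IsMarkovKernel.map _ (CadlagPath.measurable_eval t)

/-- The distribution on path space of the process with initial distribution `μ`. -/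
noncomputable def lawFrom (μ : Measure E) : Measure (CadlagPath E) := μ.bind X.law

/-- Half of the (full) total variation norm `‖P_s(x, ·) - P_t(y, ·)‖_var`. -/
noncomputable def halfVar (s t : ℝ≥0) (x y : E) : ℝ≥0∞ :=
  2⁻¹ * ((X.trans s x).toSignedMeasure - (X.trans t y).toSignedMeasure).totalVariation univ

/-- The Doeblin condition on a set `A`: for some `T > 0`,
`sup_{x, y ∈ A} (1/2) ‖P_T(x, ·) - P_T(y, ·)‖_var < 1`. -/
def DoeblinOn (A : Set E) : Prop :=
  ∃ T : ℝ≥0, 0 < T ∧ (⨆ x ∈ A, ⨆ y ∈ A, X.halfVar T T x y) < 1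

/-- The local Doeblin condition: the Doeblin condition on every compact set. -/
def LocalDoeblin : Prop := ∀ K : Set E, IsCompact K → X.DoeblinOn K

/-- The extended Doeblin condition on a set `A`: for some `0 < T₁ < T₂`,
`sup_{x, y ∈ A, s, t ∈ [T₁, T₂]} (1/2) ‖P_s(x, ·) - P_t(y, ·)‖_var < 1`. -/
def ExtendedDoeblinOn (A : Set E) : Prop :=
  ∃ T₁ T₂ : ℝ≥0, 0 < T₁ ∧ T₁ < T₂ ∧
    (⨆ x ∈ A, ⨆ y ∈ A, ⨆ s ∈ Icc T₁ T₂, ⨆ t ∈ Icc T₁ T₂, X.halfVar s t x y) < 1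

/-- `E_x exp(a τ_K)`, where `exp(∞) = ∞`. -/
noncomputable def expHit (K : Set E) (a : ℝ) (x : E) : ℝ≥0∞ :=
  ∫⁻ ω, EReal.exp ((a : EReal) * (CadlagPath.hit K ω : EReal)) ∂(X.law x)

/-- `E_x exp(a τ_K^t)`, where `exp(∞) = ∞`. -/
noncomputable def expHitAfter (K : Set E) (a : ℝ) (t : ℝ≥0) (x : E) : ℝ≥0∞ :=
  ∫⁻ ω, EReal.exp ((a : EReal) * (CadlagPath.hitAfter K t ω : EReal)) ∂(X.law x)

end

/-- A `(μ, ν)`-coupling for `X`: a two-component process `(Z¹, Z²)` on a probability space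
whose components are distributed as `X` with initial distributions `μ` and `ν`. -/
structure IsCoupling {E : Type*} [TopologicalSpace E] [MeasurableSpace E]
    (X : CadlagStrongMarkov E) (μ ν : Measure E) {Ω : Type*} [MeasurableSpace Ω]
    (Q : Measure Ω) (Z₁ Z₂ : Ω → CadlagPath E) : Prop where
  prob : IsProbabilityMeasure Q
  meas₁ : Measurable Z₁
  meas₂ : Measurable Z₂
  law₁ : Q.map Z₁ = X.lawFrom μ
  law₂ : Q.map Z₂ = X.lawFrom ν

/-- `X` admits an exponential `φ`-coupling. Here `φ : E → [1, ∞)` is measurable with respect to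
the completion of every Borel probability measure (in particular `φ` may be any Borel function
with values in `[1, ∞)`), so that the expectations below are meaningful. -/
def AdmitsExpCoupling.{u} {E : Type u} [TopologicalSpace E] [MeasurableSpace E]
    (X : CadlagStrongMarkov E) (φ : E → ℝ≥0∞) : Prop :=
  (∀ x, 1 ≤ φ x ∧ φ x < ∞) ∧
  (∀ μ : Measure E, IsProbabilityMeasure μ → AEMeasurable φ μ) ∧
  ∃ π : Measure E, IsProbabilityMeasure π ∧ (∀ t, Kernel.Invariant (X.trans t) π) ∧
    ∃ C β : ℝ, 0 < C ∧ 0 < β ∧ ∀ x : E,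
      ∃ (Ω : Type u) (_ : MeasurableSpace Ω) (Q : Measure Ω) (Z₁ Z₂ : Ω → CadlagPath E),
        X.IsCoupling (Measure.dirac x) π Q Z₁ Z₂ ∧
        ∀ t : ℝ≥0,
          ∫⁻ w, {w | Z₁ w t ≠ Z₂ w t}.indicator (fun w => φ (Z₁ w t) + φ (Z₂ w t)) w ∂Q
            ≤ ENNReal.ofReal (C * Real.exp (-β * t)) * φ x

end CadlagStrongMarkov

/-! The argument is Harris' theorem, carried out first for measures on the state space and then
lifted to paths. Write `φ(x) = E_x exp(α' τ_K)`. This function is its own Lyapunov function. While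
`K` has not been hit, the Markov property makes `φ(X_t)` lose the factor `exp(-α' t)`. Once `K` has
been hit, the process restarts in `K` and condition 3) bounds the expectation. Iterating over steps
of length `S` gives `P_t φ ≤ exp(-α' t) φ + L` for all `t` (`exists_lyapunov`).

The sublevel sets of `φ` are small: the laws at large times from any two of their points share a
mass bounded below. Under condition 1) the Markov inequality places a sublevel set inside a compact
set, where the local Doeblin condition applies (`exists_overlap_of_localDoeblin`). Under the
extended condition both copies reach `K` by a fixed time with probability at least 1/2. Their
hitting times differ, but the freedom of choosing times in `[T₁, T₂]` absorbs the difference in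
finitely many steps (`exists_overlap_of_extendedDoeblin`).

Fix a step `h` with `exp(-α' h) < 1/2`, and at each step of the `h`-skeleton remove the common part
of two evolving measures. Drift and smallness together make mass plus a multiple of the integral of
`φ` contract (`exists_uncoupled_decay`). Applied to `δ` and `δ P_h`, this produces an invariant
measure by telescoping. Applied to two invariant measures, it gives uniqueness, hence invariance
under every `P_t`.

To couple paths, the removals at the times `n h` are realized as densities on path space. This
splits both path laws into pieces. The `n`-th pieces have the same state distribution at time `(n +
1) h`, so they can be given the same continuation (`exists_coupling_after`). This step uses
conditional distributions, hence the standard Borel structure of path space.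

One technical point runs through everything. A path may have its left limit in `K` without visiting
`K`, so `τ_K` is not visibly a stopping time of the natural filtration. For each law it agrees
almost surely with one that is (`exists_isStopping_ae_eq_hit`), which is enough for the strong
Markov property and for the measurability of `φ`. -/

set_option linter.unusedSectionVars false

/-! ### Path space: shifting, gluing, measurability -/

namespace CadlagPath

section Basic

variable {E : Type*} [TopologicalSpace E]

@[ext]
theorem ext {ω ω' : CadlagPath E} (h : ∀ t, ω t = ω' t) : ω = ω' := by
  cases ω; cases ω'; congr; exact funext h

/-- The path `s ↦ ω (t + s)`. -/
def shift (t : ℝ≥0) (ω : CadlagPath E) : CadlagPath E where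
  toFun s := ω (t + s)
  rightCts s := by
    refine (ω.rightCts (t + s)).comp (f := fun s => t + s) (by fun_prop) fun u hu => ?_
    exact add_le_add_right (mem_Ici.1 hu) t
  leftLim s := by
    obtain ⟨l, hl⟩ := ω.leftLim (t + s)
    refine ⟨l, hl.comp (tendsto_nhdsWithin_iff.2 ⟨?_, ?_⟩)⟩
    · exact (Continuous.tendsto (by fun_prop) s).mono_left nhdsWithin_le_nhds
    · filter_upwards [self_mem_nhdsWithin] with u hu
      exact add_lt_add_right (mem_Iio.1 hu) t

@[simp] theorem shift_apply (t s : ℝ≥0) (ω : CadlagPath E) : shift t ω s = ω (t + s) := rfl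

/-- The path that follows `ω` before time `t` and the path `ω'`, started afresh, from time `t` on. -/
noncomputable def glue (t : ℝ≥0) (ω ω' : CadlagPath E) : CadlagPath E where
  toFun s := if s < t then ω s else ω' (s - t)
  rightCts s := by
    rcases lt_or_ge s t with h | h
    · have : (fun s => if s < t then ω s else ω' (s - t)) =ᶠ[𝓝[≥] s] ω := by
        filter_upwards [mem_nhdsWithin_of_mem_nhds (Iio_mem_nhds h)] with u hu
        exact if_pos hu
      exact (ω.rightCts s).congr_of_eventuallyEq this (if_pos h)
    · have : (fun s => if s < t then ω s else ω' (s - t)) =ᶠ[𝓝[≥] s] fun s => ω' (s - t) := by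
        filter_upwards [self_mem_nhdsWithin] with u hu
        exact if_neg (not_lt.2 (h.trans hu))
      refine ContinuousWithinAt.congr_of_eventuallyEq ?_ this (if_neg (not_lt.2 h))
      refine (ω'.rightCts (s - t)).comp (f := fun s => s - t) (by fun_prop) fun u hu => ?_
      exact tsub_le_tsub_right (mem_Ici.1 hu) t
  leftLim s := by
    rcases le_or_gt s t with h | h
    · obtain ⟨l, hl⟩ := ω.leftLim s
      refine ⟨l, hl.congr' ?_⟩
      filter_upwards [self_mem_nhdsWithin] with u hu
      exact (if_pos ((mem_Iio.1 hu).trans_le h)).symm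
    · obtain ⟨l, hl⟩ := ω'.leftLim (s - t)
      have : Tendsto (fun u => ω' (u - t)) (𝓝[<] s) (𝓝 l) := by
        refine hl.comp (tendsto_nhdsWithin_iff.2 ⟨?_, ?_⟩)
        · exact (Continuous.tendsto (by fun_prop) s).mono_left nhdsWithin_le_nhds
        · filter_upwards [self_mem_nhdsWithin, mem_nhdsWithin_of_mem_nhds (Ioi_mem_nhds h)]
            with u hu hu'
          exact tsub_lt_tsub_right_of_le (le_of_lt hu') (mem_Iio.1 hu)
      refine ⟨l, this.congr' ?_⟩
      filter_upwards [mem_nhdsWithin_of_mem_nhds (Ioi_mem_nhds h)] with u hu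
      exact (if_neg (not_lt.2 (le_of_lt hu))).symm

theorem glue_of_lt {t s : ℝ≥0} (h : s < t) (ω ω' : CadlagPath E) : glue t ω ω' s = ω s := if_pos h

theorem glue_of_le {t s : ℝ≥0} (h : t ≤ s) (ω ω' : CadlagPath E) :
    glue t ω ω' s = ω' (s - t) := if_neg (not_lt.2 h)

theorem tendsto_right (ω : CadlagPath E) {t : ℝ≥0} {u : ℕ → ℝ≥0} (hu : ∀ n, t ≤ u n)
    (hlim : Tendsto u atTop (𝓝 t)) : Tendsto (fun n => ω (u n)) atTop (𝓝 (ω t)) :=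
  (ω.rightCts t).tendsto.comp
    (tendsto_nhdsWithin_iff.2 ⟨hlim, Eventually.of_forall hu⟩)

/-- The first point of the grid `{k / (n + 1)}` strictly to the right of `t`. -/
noncomputable def gridUp (n : ℕ) (t : ℝ≥0) : ℝ≥0 := (⌊t * (n + 1)⌋₊ + 1 : ℕ) / (n + 1 : ℝ≥0)

theorem lt_gridUp (n : ℕ) (t : ℝ≥0) : t < gridUp n t := by
  rw [gridUp, lt_div_iff₀ (by positivity)]
  exact_mod_cast Nat.lt_floor_add_one (t * (n + 1 : ℝ≥0))

theorem gridUp_le (n : ℕ) (t : ℝ≥0) : gridUp n t ≤ t + 1 / (n + 1 : ℝ≥0) := by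
  rw [gridUp, div_le_iff₀ (by positivity), add_mul, one_div, inv_mul_cancel₀ (by positivity)]
  push_cast
  gcongr
  exact Nat.floor_le zero_le

theorem tendsto_gridUp (t : ℝ≥0) : Tendsto (fun n => gridUp n t) atTop (𝓝 t) := by
  refine tendsto_of_tendsto_of_tendsto_of_le_of_le tendsto_const_nhds ?_
    (fun n => (lt_gridUp n t).le) (fun n => gridUp_le n t)
  have : Tendsto (fun n : ℕ => 1 / (n + 1 : ℝ≥0)) atTop (𝓝 0) :=
    tendsto_one_div_add_atTop_nhds_zero_nat
  simpa using tendsto_const_nhds.add this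

theorem measurable_gridUp (n : ℕ) : Measurable (gridUp n) := by
  have : Measurable fun k : ℕ => ((k + 1 : ℕ) : ℝ≥0) / (n + 1 : ℝ≥0) := measurable_from_top
  exact this.comp (Nat.measurable_floor.comp (by fun_prop))

theorem countable_range_gridUp (n : ℕ) : (range (gridUp n)).Countable := by
  refine (countable_range fun k : ℕ => ((k + 1 : ℕ) : ℝ≥0) / (n + 1 : ℝ≥0)).mono ?_
  rintro _ ⟨t, rfl⟩
  exact ⟨⌊t * (n + 1)⌋₊, rfl⟩

variable [MeasurableSpace E]

theorem measurable_of_eval {α : Type*} [MeasurableSpace α] {f : α → CadlagPath E}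
    (h : ∀ t, Measurable fun a => f a t) : Measurable f := by
  rw [measurable_iff_comap_le]
  change MeasurableSpace.comap f (⨆ t : ℝ≥0, _) ≤ _
  rw [MeasurableSpace.comap_iSup]
  refine iSup_le fun t => ?_
  rw [MeasurableSpace.comap_comp]
  exact (h t).comap_le

theorem measurable_shift (t : ℝ≥0) : Measurable (shift (E := E) t) :=
  measurable_of_eval fun s => measurable_eval (t + s)

theorem measurable_glue (t : ℝ≥0) :
    Measurable fun p : CadlagPath E × CadlagPath E => glue t p.1 p.2 := by
  refine measurable_of_eval fun s => ?_
  rcases lt_or_ge s t with h | h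
  · simp only [glue_of_lt h]
    exact (measurable_eval s).comp measurable_fst
  · simp only [glue_of_le h]
    exact (measurable_eval (s - t)).comp measurable_snd

theorem measurable_eval_natFiltration {s t : ℝ≥0} (h : s ≤ t) :
    Measurable[natFiltration E t] fun ω : CadlagPath E => ω s :=
  measurable_iff_comap_le.2 (le_biSup
    (fun s : ℝ≥0 => MeasurableSpace.comap (fun ω : CadlagPath E => ω s) inferInstance) h)

end Basic

section Joint

variable {E : Type*} [TopologicalSpace E] [TopologicalSpace.PseudoMetrizableSpace E]
  [MeasurableSpace E] [BorelSpace E]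

/-- After rounding up to a grid the time takes countably many values, so evaluation is jointly
measurable; right-continuity lets the mesh tend to zero. -/
theorem measurable_eval_uncurry : Measurable fun p : CadlagPath E × ℝ≥0 => p.1 p.2 := by
  refine measurable_of_tendsto_metrizable (f := fun n p => p.1 (gridUp n p.2)) (fun n => ?_) ?_
  · have h : Measurable fun p : CadlagPath E × ℕ => p.1 ((p.2 + 1 : ℕ) / (n + 1 : ℝ≥0)) :=
      measurable_from_prod_countable_left fun k =>
        measurable_eval (((k + 1 : ℕ) : ℝ≥0) / (n + 1 : ℝ≥0))
    exact h.comp (measurable_fst.prodMk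
      (Nat.measurable_floor.comp (by fun_prop : Measurable fun p : CadlagPath E × ℝ≥0 =>
        p.2 * (n + 1 : ℝ≥0))))
  · rw [tendsto_pi_nhds]
    exact fun p => p.1.tendsto_right (fun n => (lt_gridUp n p.2).le) (tendsto_gridUp p.2)

end Joint

end CadlagPath

/-! ### The Markov property for functions of the state and for whole paths -/

namespace CadlagStrongMarkov

open CadlagPath

section Markov

variable {E : Type*} [MetricSpace E] [MeasurableSpace E] [BorelSpace E] (X : CadlagStrongMarkov E)

theorem trans_apply' (t : ℝ≥0) (x : E) {A : Set E} (hA : MeasurableSet A) :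
    X.trans t x A = X.law x {ω | ω t ∈ A} := by
  rw [trans, Kernel.map_apply' _ (measurable_eval t) _ hA]
  rfl

theorem trans_apply (t : ℝ≥0) (x : E) : X.trans t x = (X.law x).map fun ω => ω t := by
  rw [trans, Kernel.map_apply _ (measurable_eval t)]

theorem lintegral_trans (t : ℝ≥0) (x : E) {f : E → ℝ≥0∞} (hf : Measurable f) :
    ∫⁻ y, f y ∂X.trans t x = ∫⁻ ω, f (ω t) ∂X.law x := by
  rw [trans_apply, lintegral_map hf (measurable_eval t)]

theorem trans_zero (x : E) : X.trans 0 x = Measure.dirac x := by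
  rw [trans_apply, X.law_zero]

theorem ae_eval_zero [MeasurableSingletonClass E] (x : E) : ∀ᵐ ω ∂X.law x, ω 0 = x := by
  have h : ∀ᵐ y ∂(X.law x).map (fun ω => ω 0), y = x := by
    rw [X.law_zero, ae_dirac_eq]
    rfl
  exact ae_of_ae_map (measurable_eval 0).aemeasurable h

theorem measurable_trans_uncurry {A : Set E} (hA : MeasurableSet A) :
    Measurable fun p : ℝ≥0 × E => X.trans p.1 p.2 A := by
  have h : MeasurableSet {q : (ℝ≥0 × E) × CadlagPath E | q.2 q.1.1 ∈ A} :=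
    (measurable_eval_uncurry.comp
      (measurable_snd.prodMk (measurable_fst.comp measurable_fst))) hA
  convert! Kernel.measurable_kernel_prodMk_left
    (κ := X.law.comap (Prod.snd : ℝ≥0 × E → E) measurable_snd) h using 2 with p
  rw [X.trans_apply' _ _ hA]
  rfl

/-- Membership in the σ-algebra of a stopping time includes measurability with respect to the
supremum of the filtration, which this reduces to measurability on path space. -/
theorem le_iSup_natFiltration :
    (inferInstance : MeasurableSpace (CadlagPath E)) ≤ ⨆ t, (natFiltration E t : MeasurableSpace _) :=
  iSup_le fun t => (measurable_iff_comap_le.1 (measurable_eval_natFiltration le_rfl)).trans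
    (le_iSup (fun t => (natFiltration E t : MeasurableSpace _)) t)

/-- The strong Markov property at a stopping time `τ` for functions of the state at time
`τ + s`. -/
theorem setLIntegral_eval_add (x : E) {τ : CadlagPath E → ℝ≥0∞}
    (hτ : ∀ t : ℝ≥0, MeasurableSet[natFiltration E t] {ω | τ ω ≤ t})
    {B : Set (CadlagPath E)} (hB : MeasurableSet B)
    (hBτ : ∀ t : ℝ≥0, MeasurableSet[natFiltration E t] (B ∩ {ω | τ ω ≤ t}))
    (htop : ∀ ω ∈ B, τ ω ≠ ∞) (s : ℝ≥0) {f : E → ℝ≥0∞} (hf : Measurable f) :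
    ∫⁻ ω in B, f (ω ((τ ω).toNNReal + s)) ∂X.law x =
      ∫⁻ ω in B, ∫⁻ y, f y ∂X.trans s (ω (τ ω).toNNReal) ∂X.law x := by
  have hst : IsStoppingTime (natFiltration E) (τ : CadlagPath E → WithTop ℝ≥0) := hτ
  have hm : Measurable τ := hst.measurable'
  have hX : ∀ s, Measurable fun ω : CadlagPath E => ω ((τ ω).toNNReal + s) := fun s =>
    measurable_eval_uncurry.comp
      (measurable_id.prodMk ((ENNReal.measurable_toNNReal.comp hm).add_const s))
  have hX0 : Measurable fun ω : CadlagPath E => ω (τ ω).toNNReal := by simpa using hX 0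
  have key : ((X.law x).restrict B).map (fun ω => ω ((τ ω).toNNReal + s)) =
      (((X.law x).restrict B).map fun ω => ω (τ ω).toNNReal).bind (X.trans s) := by
    ext A hA
    rw [Measure.map_apply (hX s) hA, Measure.restrict_apply (hX s hA),
      Measure.bind_apply hA (X.trans s).aemeasurable,
      lintegral_map ((X.trans s).measurable_coe hA) hX0]
    have := X.strongMarkov x τ hst B ⟨le_iSup_natFiltration _ hB, hBτ⟩ s A hA
    have e1 : B ∩ {ω | τ ω ≠ ∞ ∧ ω ((τ ω).toNNReal + s) ∈ A} =
        (fun ω : CadlagPath E => ω ((τ ω).toNNReal + s)) ⁻¹' A ∩ B := by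
      ext ω
      exact ⟨fun h => ⟨h.2.2, h.1⟩, fun h => ⟨h.2, htop ω h.2, h.1⟩⟩
    have e2 : B ∩ {ω | τ ω ≠ ∞} = B := inter_eq_left.2 htop
    rw [← e1]
    refine this.trans ?_
    change ∫⁻ ω in B ∩ {ω | τ ω ≠ ∞}, _ ∂_ = _
    rw [e2]
    refine lintegral_congr fun ω => ?_
    rw [trans_apply]
    rfl
  rw [← lintegral_map hf (hX s), key, Measure.lintegral_bind (X.trans s).aemeasurable
    hf.aemeasurable, lintegral_map hf.lintegral_kernel hX0]

theorem setLIntegral_eval_add_const (x : E) (t : ℝ≥0) {B : Set (CadlagPath E)}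
    (hB : MeasurableSet[natFiltration E t] B) (s : ℝ≥0) {f : E → ℝ≥0∞} (hf : Measurable f) :
    ∫⁻ ω in B, f (ω (t + s)) ∂X.law x = ∫⁻ ω in B, ∫⁻ y, f y ∂X.trans s (ω t) ∂X.law x := by
  have hB' : MeasurableSet B := (natFiltration E).le t _ hB
  refine X.setLIntegral_eval_add x (τ := fun _ => t) (fun u => @MeasurableSet.const _ (natFiltration E u) _) hB'
    (fun u => ?_) (fun _ _ => ENNReal.coe_ne_top) s hf
  by_cases h : t ≤ u
  · have : B ∩ {ω : CadlagPath E | (t : ℝ≥0∞) ≤ u} = B := by simp [h]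
    rw [this]
    exact (natFiltration E).mono h _ hB
  · have : B ∩ {ω : CadlagPath E | (t : ℝ≥0∞) ≤ u} = ∅ := by simp [h]
    rw [this]
    exact @MeasurableSet.empty _ (natFiltration E u)

/-- The Chapman-Kolmogorov equations. -/
theorem trans_add (s t : ℝ≥0) : X.trans (s + t) = X.trans t ∘ₖ X.trans s := by
  ext x A hA
  rw [Kernel.comp_apply' _ _ _ hA, X.lintegral_trans s x ((X.trans t).measurable_coe hA),
    X.trans_apply' _ _ hA]
  have := X.setLIntegral_eval_add_const x s MeasurableSet.univ t
    (measurable_one.indicator hA : Measurable (A.indicator (1 : E → ℝ≥0∞)))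
  simp only [Measure.restrict_univ, lintegral_indicator_one hA] at this
  rw [← this]
  exact (lintegral_indicator_one (measurable_eval _ hA)).symm

theorem trans_bind_add (μ : Measure E) (s t : ℝ≥0) :
    (μ.bind (X.trans s)).bind (X.trans t) = μ.bind (X.trans (s + t)) := by
  rw [trans_add, Measure.comp_assoc]

/-- The cylinder set of the paths that are in `A i` at the times `i ∈ I`. -/
def cyl (I : Finset ℝ≥0) (A : ℝ≥0 → Set E) : Set (CadlagPath E) := {ω | ∀ i ∈ I, ω i ∈ A i}

theorem measurableSet_cyl (I : Finset ℝ≥0) {A : ℝ≥0 → Set E} (hA : ∀ i, MeasurableSet (A i))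
    {t : ℝ≥0} (hI : ∀ i ∈ I, i ≤ t) : MeasurableSet[natFiltration E t] (cyl I A) := by
  have : cyl I A = ⋂ i ∈ I, (fun ω : CadlagPath E => ω i) ⁻¹' A i := by ext; simp [cyl]
  rw [this]
  exact Finset.measurableSet_biInter _ fun i hi => measurable_eval_natFiltration (hI i hi) (hA i)

theorem measurableSet_cyl' (I : Finset ℝ≥0) {A : ℝ≥0 → Set E} (hA : ∀ i, MeasurableSet (A i)) :
    MeasurableSet (cyl I A) :=
  (natFiltration E).le _ _ (measurableSet_cyl I hA fun _ hi => Finset.le_sup (f := id) hi)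

/-- Two finite measures on the path space with the same finite-dimensional distributions are
equal. -/
theorem measure_ext_cyl {μ ν : Measure (CadlagPath E)} [IsFiniteMeasure μ]
    (h : ∀ I : Finset ℝ≥0, ∀ A : ℝ≥0 → Set E, (∀ i, MeasurableSet (A i)) →
      μ (cyl I A) = ν (cyl I A)) : μ = ν := by
  refine ext_of_generate_finite
    {C | ∃ I : Finset ℝ≥0, ∃ A : ℝ≥0 → Set E, (∀ i, MeasurableSet (A i)) ∧ cyl I A = C} ?_ ?_ ?_ ?_
  · refine le_antisymm (iSup_le fun t => ?_) ?_
    · rintro _ ⟨A, hA, rfl⟩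
      refine MeasurableSpace.measurableSet_generateFrom ⟨{t}, fun _ => A, fun _ => hA, ?_⟩
      ext
      simp [cyl]
    · refine MeasurableSpace.generateFrom_le ?_
      rintro _ ⟨I, A, hA, rfl⟩
      exact measurableSet_cyl' I hA
  · classical
    rintro _ ⟨I, A, hA, rfl⟩ _ ⟨J, B, hB, rfl⟩ -
    refine ⟨I ∪ J, fun i => (if i ∈ I then A i else univ) ∩ if i ∈ J then B i else univ,
      fun i => ?_, ?_⟩
    · refine MeasurableSet.inter ?_ ?_ <;> split_ifs <;> simp [hA, hB]
    · ext ω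
      simp only [cyl, Finset.mem_union, mem_inter_iff, mem_ofPred_eq, mem_ite_univ_right]
      grind
  · rintro _ ⟨I, A, hA, rfl⟩
    exact h I A hA
  · have := h ∅ (fun _ => univ) fun _ => MeasurableSet.univ
    simpa [cyl] using this

/-- Induction on the largest time `a` of the cylinder. The Markov property at `a` absorbs the last
constraint and `f` into a function `g` of the state at `a`; carrying an arbitrary `f` is what closes
the induction. -/
theorem setLIntegral_cyl (x : E) (t : ℝ≥0) {B : Set (CadlagPath E)}
    (hB : MeasurableSet[natFiltration E t] B) (I : Finset ℝ≥0) {A : ℝ≥0 → Set E}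
    (hA : ∀ i, MeasurableSet (A i)) : ∀ {v : ℝ≥0}, (∀ i ∈ I, i ≤ v) → ∀ {f : E → ℝ≥0∞},
    Measurable f → ∫⁻ ω in B ∩ shift t ⁻¹' cyl I A, f (ω (t + v)) ∂X.law x =
      ∫⁻ ω in B, ∫⁻ ω' in cyl I A, f (ω' v) ∂X.law (ω t) ∂X.law x := by
  classical
  induction I using Finset.induction_on_max with
  | empty =>
    intro v _ f hf
    have : cyl (E := E) ∅ A = univ := by ext; simp [cyl]
    simp only [this, preimage_univ, inter_univ, Measure.restrict_univ]
    rw [X.setLIntegral_eval_add_const x t hB v hf]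
    simp_rw [X.lintegral_trans v _ hf]
  | insert a I ha ih =>
    intro v hv f hf
    set g : E → ℝ≥0∞ := (A a).indicator fun y => ∫⁻ z, f z ∂X.trans (v - a) y with hg
    have hgm : Measurable g := hf.lintegral_kernel.indicator (hA a)
    have hav : a ≤ v := hv a (Finset.mem_insert_self _ _)
    -- Used twice: with `r = t` for the original process, and with `r = 0` for the process restarted
    -- at `ω t`.
    have key : ∀ (y : E) (r : ℝ≥0) (D : Set (CadlagPath E)), MeasurableSet[natFiltration E (r + a)] D →
        ∫⁻ ω in D ∩ {ω | ω (r + a) ∈ A a}, f (ω (r + v)) ∂X.law y =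
          ∫⁻ ω in D, g (ω (r + a)) ∂X.law y := by
      intro y r D hD
      have hAm : MeasurableSet[natFiltration E (r + a)] {ω : CadlagPath E | ω (r + a) ∈ A a} :=
        measurable_eval_natFiltration le_rfl (hA a)
      have e : r + v = r + a + (v - a) := by rw [add_assoc, add_tsub_cancel_of_le hav]
      rw [e, X.setLIntegral_eval_add_const y _ (hD.inter hAm) _ hf, inter_comm,
        ← Measure.restrict_restrict ((natFiltration E).le _ _ hAm),
        ← lintegral_indicator ((natFiltration E).le _ _ hAm)]
      rfl
    have hI : ∀ i ∈ I, i ≤ a := fun i hi => (ha i hi).le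
    have e1 : B ∩ shift t ⁻¹' cyl (insert a I) A =
        (B ∩ shift t ⁻¹' cyl I A) ∩ {ω | ω (t + a) ∈ A a} := by
      ext ω; simp [cyl]; tauto
    have e2 : cyl (insert a I) A = cyl I A ∩ {ω | ω (0 + a) ∈ A a} := by
      ext ω; simp [cyl]; tauto
    have hD : MeasurableSet[natFiltration E (t + a)] (shift t ⁻¹' cyl I A) := by
      have : shift t ⁻¹' cyl I A = ⋂ i ∈ I, (fun ω : CadlagPath E => ω (t + i)) ⁻¹' A i := by
        ext; simp [cyl]
      rw [this]
      exact Finset.measurableSet_biInter _ fun i hi =>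
        measurable_eval_natFiltration (add_le_add_right (hI i hi) t) (hA i)
    rw [e1, key x t _ (((natFiltration E).mono (by simp) _ hB).inter hD), ih hI hgm]
    refine lintegral_congr fun ω => ?_
    have := key (ω t) 0 (cyl I A) (measurableSet_cyl I hA fun i hi => (hI i hi).trans (zero_add a).ge)
    simp only [zero_add] at this e2
    rw [e2, this]

/-- The Markov property at time `t`: given the past, the path after `t` is distributed as the
process started at the present state. -/
theorem map_shift_restrict (x : E) (t : ℝ≥0) {B : Set (CadlagPath E)}
    (hB : MeasurableSet[natFiltration E t] B) :
    ((X.law x).restrict B).map (shift t) =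
      (((X.law x).restrict B).map fun ω => ω t).bind X.law := by
  refine measure_ext_cyl fun I A hA => ?_
  have hC := measurableSet_cyl' I hA
  rw [Measure.map_apply (measurable_shift t) hC, Measure.restrict_apply (measurable_shift t hC),
    Measure.bind_apply hC X.law.aemeasurable,
    lintegral_map (X.law.measurable_coe hC) (measurable_eval t), inter_comm]
  have := X.setLIntegral_cyl x t hB I hA (v := I.sup id) (fun i hi => Finset.le_sup (f := id) hi)
    (f := 1) measurable_one
  simpa using this

end Markov

end CadlagStrongMarkov

/-! ### Hitting times of closed sets and stopping times -/

namespace CadlagPath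

section HittingTime

variable {E : Type*} [MetricSpace E] [MeasurableSpace E] [BorelSpace E]

/-- The path comes arbitrarily close to `K` between the times `r` and `t`. -/
def Approaches (K : Set E) (ω : CadlagPath E) (r : ℝ≥0∞) (t : ℝ≥0) : Prop :=
  r ≤ t ∧ ∀ n : ℕ, ∃ s : ℝ≥0, r ≤ s ∧ s ≤ t ∧ Metric.infEDist (ω s) K < (n + 1 : ℝ≥0∞)⁻¹

theorem Approaches.mono {K : Set E} {ω : CadlagPath E} {r : ℝ≥0∞} {t t' : ℝ≥0}
    (h : Approaches K ω r t) (ht : t ≤ t') : Approaches K ω r t' := by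
  refine ⟨h.1.trans (by exact_mod_cast ht), fun n => ?_⟩
  obtain ⟨s, h1, h2, h3⟩ := h.2 n
  exact ⟨s, h1, h2.trans ht, h3⟩

theorem eventually_infEDist_lt (K : Set E) (ω : CadlagPath E) {t : ℝ≥0} {ε : ℝ≥0∞}
    (h : Metric.infEDist (ω t) K < ε) : ∃ u, t < u ∧ ∀ s, t ≤ s → s < u →
      Metric.infEDist (ω s) K < ε := by
  have h1 : ∀ᶠ s in 𝓝[≥] t, Metric.infEDist (ω s) K < ε :=
    (Metric.continuous_infEDist.continuousAt.tendsto.comp (ω.rightCts t)).eventually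
      (gt_mem_nhds h)
  obtain ⟨u, hu, h2⟩ := mem_nhdsGE_iff_exists_Ico_subset.1 h1
  exact ⟨u, hu, fun s h3 h4 => h2 ⟨h3, h4⟩⟩

theorem eventually_lt_infEDist (K : Set E) (ω : CadlagPath E) {t : ℝ≥0} {ε : ℝ≥0∞}
    (h : ε < Metric.infEDist (ω t) K) : ∃ u, t < u ∧ ∀ s, t ≤ s → s < u →
      ε < Metric.infEDist (ω s) K := by
  have h1 : ∀ᶠ s in 𝓝[≥] t, ε < Metric.infEDist (ω s) K :=
    (Metric.continuous_infEDist.continuousAt.tendsto.comp (ω.rightCts t)).eventually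
      (lt_mem_nhds h)
  obtain ⟨u, hu, h2⟩ := mem_nhdsGE_iff_exists_Ico_subset.1 h1
  exact ⟨u, hu, fun s h3 h4 => h2 ⟨h3, h4⟩⟩

/-- A path staying at distance at least `1 / (n + 1)` from `K` up to `t` stays, by right-continuity,
farther than `1 / (n + 2)` slightly beyond `t`. Hence the infimum defining `approachTime` is
attained when finite. -/
theorem Approaches.of_forall_lt {K : Set E} {ω : CadlagPath E} {r : ℝ≥0∞} {t : ℝ≥0}
    (h : ∀ t', t < t' → Approaches K ω r t') : Approaches K ω r t := by
  refine ⟨le_of_forall_gt fun c hc => ?_, fun n => ?_⟩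
  · obtain ⟨c', h1, h2⟩ := ENNReal.lt_iff_exists_nnreal_btwn.1 hc
    exact (h c' (by exact_mod_cast h1)).1.trans_lt h2
  · by_contra! hc
    have hlt : ((n + 1 : ℕ) + 1 : ℝ≥0∞)⁻¹ < (n + 1 : ℝ≥0∞)⁻¹ := by
      rw [ENNReal.inv_lt_inv]
      exact_mod_cast Nat.lt_succ_self (n + 1)
    have hrt : r ≤ t := by
      refine le_of_forall_gt fun c hc => ?_
      obtain ⟨c', h1, h2⟩ := ENNReal.lt_iff_exists_nnreal_btwn.1 hc
      exact (h c' (by exact_mod_cast h1)).1.trans_lt h2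
    obtain ⟨u, hu, h1⟩ := eventually_lt_infEDist K ω (hlt.trans_le (hc t hrt le_rfl))
    obtain ⟨v, hv, hvu⟩ := exists_between hu
    obtain ⟨s, h2, h3, h4⟩ := (h v hv).2 (n + 1)
    rcases le_or_gt s t with h5 | h5
    · exact (hc s h2 h5).not_gt (h4.trans hlt)
    · exact (h1 s h5.le (h3.trans_lt hvu)).not_gt h4

/-- The first time after `r` at which the path or its left limit is in `K`. -/
noncomputable def approachTime (K : Set E) (ω : CadlagPath E) (r : ℝ≥0∞) : ℝ≥0∞ :=
  ⨅ (t : ℝ≥0) (_ : Approaches K ω r t), (t : ℝ≥0∞)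

theorem approachTime_le_iff {K : Set E} {ω : CadlagPath E} {r : ℝ≥0∞} {t : ℝ≥0} :
    approachTime K ω r ≤ t ↔ Approaches K ω r t := by
  refine ⟨fun h => Approaches.of_forall_lt fun t' ht => ?_, fun h => iInf₂_le t h⟩
  have h1 : approachTime K ω r < t' := h.trans_lt (by exact_mod_cast ht)
  simp only [approachTime, iInf_lt_iff] at h1
  obtain ⟨u, hu, h2⟩ := h1
  exact hu.mono (by exact_mod_cast h2.le)

theorem le_approachTime (K : Set E) (ω : CadlagPath E) (r : ℝ≥0∞) : r ≤ approachTime K ω r :=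
  le_iInf₂ fun _ h => h.1

theorem hit_le {K : Set E} {ω : CadlagPath E} {t : ℝ≥0} (h : ω t ∈ K) : hit K ω ≤ t :=
  iInf₂_le t h

theorem approachTime_le_hit {K : Set E} {ω : CadlagPath E} {r : ℝ≥0∞} (h : r ≤ hit K ω) :
    approachTime K ω r ≤ hit K ω := by
  refine le_iInf₂ fun t ht => approachTime_le_iff.2 ⟨h.trans (hit_le ht), fun n =>
    ⟨t, h.trans (hit_le ht), le_rfl, ?_⟩⟩
  rw [Metric.infEDist_zero_of_mem ht]
  exact ENNReal.inv_pos.2 (by finiteness)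

theorem mem_of_approachTime_eq {K : Set E} (hK : IsClosed K) {ω : CadlagPath E} {r : ℝ≥0}
    (h : approachTime K ω r = r) : ω r ∈ K := by
  have h1 := (approachTime_le_iff.1 h.le).2
  rw [Metric.mem_iff_infEDist_zero_of_closed hK]
  by_contra h0
  obtain ⟨n, hn⟩ := ENNReal.exists_inv_nat_lt h0
  obtain ⟨s, h2, h3, h4⟩ := h1 n
  rw [le_antisymm h3 (by exact_mod_cast h2)] at h4
  refine (h4.trans_le (ENNReal.inv_le_inv.2 ?_)).not_gt hn
  exact le_self_add

/-- Stopping times of the natural filtration with values in `[0, ∞]`. -/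
def IsStopping (τ : CadlagPath E → ℝ≥0∞) : Prop :=
  ∀ t : ℝ≥0, MeasurableSet[natFiltration E t] {ω | τ ω ≤ t}

theorem IsStopping.mono_le {τ : CadlagPath E → ℝ≥0∞} (h : IsStopping τ) {s t : ℝ≥0} (hst : s ≤ t) :
    MeasurableSet[natFiltration E t] {ω | τ ω ≤ s} := (natFiltration E).mono hst _ (h s)

theorem IsStopping.measurable {τ : CadlagPath E → ℝ≥0∞} (h : IsStopping τ) : Measurable τ :=
  (show IsStoppingTime (natFiltration E) (τ : CadlagPath E → WithTop ℝ≥0) from h).measurable'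

theorem IsStopping.iSup {τ : ℕ → CadlagPath E → ℝ≥0∞} (h : ∀ n, IsStopping (τ n)) :
    IsStopping fun ω => ⨆ n, τ n ω := fun t => by
  have : {ω | ⨆ n, τ n ω ≤ (t : ℝ≥0∞)} = ⋂ n, {ω | τ n ω ≤ t} := by ext; simp
  rw [this]
  exact MeasurableSet.iInter fun n => h n t

theorem IsStopping.approachTime (K : Set E) {τ : CadlagPath E → ℝ≥0∞} (h : IsStopping τ) :
    IsStopping fun ω => approachTime K ω (τ ω) := fun t => by
  obtain ⟨D, hDc, hD⟩ := TopologicalSpace.exists_countable_dense ℝ≥0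
  -- By right-continuity the approaching times may be taken in a countable dense set. The endpoint
  -- `t` is added separately, since looking to its right would leave the σ-algebra at time `t`.
  have e : {ω | CadlagPath.approachTime K ω (τ ω) ≤ t} = {ω | τ ω ≤ t} ∩ ⋂ n : ℕ,
      ⋃ s ∈ (D ∩ Iic t) ∪ {t}, {ω | τ ω ≤ s} ∩
        {ω | Metric.infEDist (ω s) K < (n + 1 : ℝ≥0∞)⁻¹} := by
    ext ω
    simp only [mem_ofPred_eq, approachTime_le_iff, mem_inter_iff, mem_iInter, mem_iUnion,
      exists_prop]
    refine ⟨fun h1 => ⟨h1.1, fun n => ?_⟩, fun h1 => ⟨h1.1, fun n => ?_⟩⟩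
    · obtain ⟨s, h2, h3, h4⟩ := h1.2 n
      rcases h3.eq_or_lt with rfl | h3
      · exact ⟨s, Or.inr rfl, h2, h4⟩
      · obtain ⟨u, hu, h5⟩ := eventually_infEDist_lt K ω h4
        obtain ⟨v, hvD, hv⟩ := hD.exists_between (lt_min h3 hu)
        refine ⟨v, Or.inl ⟨hvD, (hv.2.trans_le (min_le_left _ _)).le⟩,
          h2.trans (by exact_mod_cast hv.1.le), h5 v hv.1.le (hv.2.trans_le (min_le_right _ _))⟩
    · obtain ⟨s, h2, h3, h4⟩ := h1.2 n
      refine ⟨s, h3, ?_, h4⟩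
      rcases h2 with h2 | rfl
      · exact h2.2
      · exact le_rfl
  rw [e]
  refine (h t).inter (MeasurableSet.iInter fun n => MeasurableSet.biUnion
    ((hDc.mono inter_subset_left).union (countable_singleton t)) fun s hs => ?_)
  have hst : s ≤ t := by
    rcases hs with hs | rfl
    · exact hs.2
    · exact le_rfl
  refine (h.mono_le hst).inter ?_
  exact measurable_eval_natFiltration hst
    (measurableSet_lt Metric.continuous_infEDist.measurable measurable_const)

/-- For every law on the path space the hitting time of a closed set is almost surely equal to a
stopping time of the natural filtration. -/
theorem exists_isStopping_ae_eq_hit {K : Set E} (hK : IsClosed K) (P : Measure (CadlagPath E))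
    [IsFiniteMeasure P] : ∃ τ : CadlagPath E → ℝ≥0∞, IsStopping τ ∧
      ∀ᵐ ω ∂P, hit K ω = τ ω ∧ (τ ω ≠ ∞ → ω (τ ω).toNNReal ∈ K) := by
  -- The essential supremum of the stopping times below the hitting time is sought. Minimizing `J`,
  -- the integral of a bounded strictly decreasing function of `τ`, finds it even when infinite
  -- values occur.
  set S : Set (CadlagPath E → ℝ≥0∞) := {τ | IsStopping τ ∧ ∀ ω, τ ω ≤ hit K ω} with hS
  set J : (CadlagPath E → ℝ≥0∞) → ℝ≥0∞ := fun τ => ∫⁻ ω, (1 + τ ω)⁻¹ ∂P with hJ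
  have h0 : (fun _ => 0 : CadlagPath E → ℝ≥0∞) ∈ S :=
    ⟨fun t => by simp, fun _ => zero_le⟩
  obtain ⟨u, -, hu, huS⟩ := exists_seq_tendsto_sInf (S := J '' S) ⟨_, mem_image_of_mem J h0⟩
    (OrderBot.bddBelow _)
  choose τ hτS hτ using huS
  set σ : CadlagPath E → ℝ≥0∞ := fun ω => ⨆ n, τ n ω with hσ
  have hσS : σ ∈ S := ⟨IsStopping.iSup fun n => (hτS n).1, fun ω => iSup_le fun n => (hτS n).2 ω⟩
  have hmin : ∀ ρ ∈ S, J σ ≤ J ρ := by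
    intro ρ hρ
    refine le_trans (ge_of_tendsto' hu fun n => ?_) (sInf_le (mem_image_of_mem J hρ))
    rw [← hτ n]
    refine lintegral_mono fun ω => ENNReal.inv_le_inv.2 ?_
    gcongr
    exact le_iSup (fun n => τ n ω) n
  -- Waiting after `σ` until the next approach stays in `S` and cannot lower `σ`. By minimality
  -- nothing changes almost surely, and a finite time fixed by `approachTime` is a time at which the
  -- path is in `K`.
  have hGS : (fun ω => approachTime K ω (σ ω)) ∈ S :=
    ⟨hσS.1.approachTime K, fun ω => approachTime_le_hit (hσS.2 ω)⟩
  have hmeas : ∀ ρ ∈ S, Measurable fun ω => (1 + ρ ω)⁻¹ := fun ρ hρ =>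
    (measurable_const.add hρ.1.measurable).inv
  have hfin : J (fun ω => approachTime K ω (σ ω)) ≠ ∞ := by
    refine ((lintegral_mono (g := fun _ => 1) fun ω => ?_).trans_lt ?_).ne
    · exact ENNReal.inv_le_one.2 le_self_add
    · simp
  have hae := ae_eq_of_ae_le_of_lintegral_le (μ := P)
    (Eventually.of_forall fun ω => ENNReal.inv_le_inv.2
      (add_le_add_right (le_approachTime K ω (σ ω)) 1)) hfin (hmeas σ hσS).aemeasurable
      (hmin _ hGS)
  refine ⟨σ, hσS.1, ?_⟩
  filter_upwards [hae] with ω hω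
  have hω' : approachTime K ω (σ ω) = σ ω :=
    (ENNReal.add_right_inj ENNReal.one_ne_top).1 (inv_injective hω)
  have hmem : σ ω ≠ ∞ → ω (σ ω).toNNReal ∈ K := fun htop => by
    refine mem_of_approachTime_eq hK ?_
    rwa [ENNReal.coe_toNNReal htop]
  refine ⟨le_antisymm ?_ (hσS.2 ω), hmem⟩
  by_cases htop : σ ω = ∞
  · simp [htop]
  · exact (hit_le (hmem htop)).trans (ENNReal.coe_toNNReal htop).le

end HittingTime

end CadlagPath

/-! ### Exponential hitting moments and the Lyapunov inequality -/

/-- `exp (a t)` for `t ∈ [0, ∞]`. -/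
noncomputable def expTime (a : ℝ) (t : ℝ≥0∞) : ℝ≥0∞ := EReal.exp ((a : EReal) * (t : EReal))

theorem measurable_expTime (a : ℝ) : Measurable (expTime a) := by
  unfold expTime
  have h : Measurable fun t : ℝ≥0∞ => (a : EReal) * (t : EReal) :=
    measurable_const.mul measurable_coe_ennreal_ereal
  exact EReal.measurable_exp.comp h

theorem expTime_mono {a : ℝ} (ha : 0 < a) : Monotone (expTime a) := fun s t h => by
  unfold expTime
  refine EReal.exp_monotone ?_
  exact mul_le_mul_of_nonneg_left (by exact_mod_cast h) (by exact_mod_cast ha.le)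

theorem expTime_coe (a : ℝ) (t : ℝ≥0) : expTime a t = ENNReal.ofReal (Real.exp (a * t)) := by
  unfold expTime
  have : (a : EReal) * ((t : ℝ≥0∞) : EReal) = ((a * t : ℝ) : EReal) := by
    rw [EReal.coe_mul]; rfl
  rw [this, EReal.exp_coe]

theorem expTime_zero (a : ℝ) : expTime a 0 = 1 := by
  simpa using expTime_coe a 0

theorem expTime_top {a : ℝ} (ha : 0 < a) : expTime a ∞ = ∞ := by
  unfold expTime
  rw [EReal.coe_ennreal_top, EReal.coe_mul_top_of_pos ha, EReal.exp_top]

theorem one_le_expTime {a : ℝ} (ha : 0 < a) (t : ℝ≥0∞) : 1 ≤ expTime a t :=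
  (expTime_zero a).ge.trans (expTime_mono ha zero_le)

theorem expTime_mono_left {a b : ℝ} (ha : 0 < a) (hab : a ≤ b) (t : ℝ≥0∞) :
    expTime a t ≤ expTime b t := by
  induction t with
  | top => rw [expTime_top (ha.trans_le hab)]; exact le_top
  | coe t =>
    rw [expTime_coe, expTime_coe]
    exact ENNReal.ofReal_le_ofReal (Real.exp_le_exp.2 (by gcongr))

theorem expTime_add {a : ℝ} (ha : 0 < a) (s : ℝ≥0) (t : ℝ≥0∞) :
    expTime a (s + t) = expTime a s * expTime a t := by
  induction t with
  | top =>
    rw [add_top, expTime_top ha, ENNReal.mul_top]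
    exact (zero_lt_one.trans_le (one_le_expTime ha _)).ne'
  | coe t =>
    rw [← ENNReal.coe_add, expTime_coe, expTime_coe, expTime_coe,
      ← ENNReal.ofReal_mul (Real.exp_nonneg _), ← Real.exp_add]
    push_cast
    ring_nf

/-- Measurability with respect to the completion of every finite measure. -/
def UnivMeasurable {E : Type*} [MeasurableSpace E] (f : E → ℝ≥0∞) : Prop :=
  ∀ μ : Measure E, IsFiniteMeasure μ → AEMeasurable f μ

namespace CadlagStrongMarkov

open CadlagPath

section Lyapunov

variable {E : Type*} [MetricSpace E] [MeasurableSpace E] [BorelSpace E] (X : CadlagStrongMarkov E)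

theorem aemeasurable_hit {K : Set E} (hK : IsClosed K) (P : Measure (CadlagPath E))
    [IsFiniteMeasure P] : AEMeasurable (hit K) P := by
  obtain ⟨τ, hτ, h⟩ := exists_isStopping_ae_eq_hit hK P
  exact ⟨τ, hτ.measurable, h.mono fun ω hω => hω.1⟩

theorem expHit_eq (K : Set E) (a : ℝ) (x : E) :
    X.expHit K a x = ∫⁻ ω, expTime a (hit K ω) ∂X.law x := rfl

/-- A stopping time chosen for the mixed law `μ.bind X.law` agrees with the hitting time under
`X.law x` for `μ`-almost every `x`, and its exponential moment is a Borel version of the function.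
-/
theorem univMeasurable_expHit {K : Set E} (hK : IsClosed K) (a : ℝ) :
    UnivMeasurable (X.expHit K a) := fun μ _ => by
  obtain ⟨τ, hτ, h⟩ := exists_isStopping_ae_eq_hit hK (μ.bind X.law)
  refine ⟨fun x => ∫⁻ ω, expTime a (τ ω) ∂X.law x,
    ((measurable_expTime a).comp hτ.measurable).lintegral_kernel, ?_⟩
  filter_upwards [Measure.ae_ae_of_ae_comp h] with x hx
  exact lintegral_congr_ae (hx.mono fun ω hω => congrArg (expTime a) hω.1)

theorem one_le_expHit (K : Set E) {a : ℝ} (ha : 0 < a) (x : E) : 1 ≤ X.expHit K a x := by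
  calc (1 : ℝ≥0∞) = ∫⁻ _, 1 ∂X.law x := by simp
    _ ≤ _ := lintegral_mono fun ω => one_le_expTime ha _

theorem expHit_of_mem {K : Set E} (a : ℝ) {x : E} (hx : x ∈ K) : X.expHit K a x = 1 := by
  rw [expHit_eq]
  have : ∀ᵐ ω ∂X.law x, expTime a (hit K ω) = 1 := by
    filter_upwards [X.ae_eval_zero x] with ω hω
    have : hit K ω = 0 := le_antisymm (by exact_mod_cast hit_le (t := 0) (hω ▸ hx)) zero_le
    rw [this, expTime_zero]
  rw [lintegral_congr_ae this]
  simp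

theorem expHit_mono (K : Set E) {a b : ℝ} (ha : 0 < a) (hab : a ≤ b) (x : E) :
    X.expHit K a x ≤ X.expHit K b x :=
  lintegral_mono fun _ => expTime_mono_left ha hab _

theorem lintegral_trans' (t : ℝ≥0) (x : E) {f : E → ℝ≥0∞} (hf : UnivMeasurable f) :
    ∫⁻ y, f y ∂X.trans t x = ∫⁻ ω, f (ω t) ∂X.law x := by
  rw [trans_apply, lintegral_map' (hf _ inferInstance) (measurable_eval t).aemeasurable]

theorem setLIntegral_expHit_eval {K : Set E} (hK : IsClosed K) (a : ℝ) (x : E) (t : ℝ≥0)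
    {B : Set (CadlagPath E)} (hB : MeasurableSet[natFiltration E t] B) :
    ∫⁻ ω in B, X.expHit K a (ω t) ∂X.law x =
      ∫⁻ ω in B, expTime a (hit K (shift t ω)) ∂X.law x := by
  have h := X.map_shift_restrict x t hB
  set μ : Measure E := ((X.law x).restrict B).map fun ω => ω t
  have hm : AEMeasurable (fun ω => expTime a (hit K ω)) (μ.bind X.law) :=
    (measurable_expTime a).comp_aemeasurable (aemeasurable_hit hK _)
  rw [← lintegral_map' (f := X.expHit K a) (X.univMeasurable_expHit hK a _ inferInstance)
    (measurable_eval t).aemeasurable, ← lintegral_map' (f := fun ω => expTime a (hit K ω))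
    (h ▸ hm) (measurable_shift t).aemeasurable, h,
    Measure.lintegral_bind X.law.aemeasurable hm]
  rfl

/-- The Markov property at `t`; it turns condition 3) into a bound on the transition operator
applied to `φ` at points of `K`. -/
theorem expHitAfter_eq {K : Set E} (hK : IsClosed K) (a : ℝ) (t : ℝ≥0) (x : E) :
    X.expHitAfter K a t x = ∫⁻ y, X.expHit K a y ∂X.trans t x := by
  rw [X.lintegral_trans' t x (X.univMeasurable_expHit hK a)]
  have := X.setLIntegral_expHit_eval hK a x t (B := univ) MeasurableSet.univ
  simp only [Measure.restrict_univ] at this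
  rw [this]
  rfl

theorem tendsto_lintegral_trans (f : BoundedContinuousFunction E ℝ≥0) (y : E) {r : ℝ≥0} {u : ℕ → ℝ≥0}
    (hu : ∀ n, r ≤ u n) (hlim : Tendsto u atTop (𝓝 r)) :
    Tendsto (fun n => ∫⁻ z, f z ∂X.trans (u n) y) atTop (𝓝 (∫⁻ z, f z ∂X.trans r y)) := by
  have hf : Measurable fun z => (f z : ℝ≥0∞) := by fun_prop
  simp_rw [X.lintegral_trans _ y hf]
  refine tendsto_lintegral_of_dominated_convergence (fun _ => (nndist f 0 : ℝ≥0∞))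
    (fun n => hf.comp (measurable_eval _)) (fun n => Eventually.of_forall fun ω => ?_) (by simp)
    (Eventually.of_forall fun ω => ?_)
  · exact ENNReal.coe_le_coe.2 (BoundedContinuousFunction.NNReal.upper_bound f _)
  · exact ((ENNReal.continuous_coe.comp f.continuous).tendsto _).comp (ω.tendsto_right hu hlim)

theorem measurable_trans_stopping {τ : CadlagPath E → ℝ≥0∞} (hτ : IsStopping τ) (t : ℝ≥0) :
    Measurable fun ω : CadlagPath E => X.trans (t - (τ ω).toNNReal) (ω (τ ω).toNNReal) := by
  refine Measure.measurable_of_measurable_coe _ fun A hA => ?_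
  have h1 : Measurable fun ω => (τ ω).toNNReal := hτ.measurable.ennreal_toNNReal
  exact (X.measurable_trans_uncurry hA).comp ((measurable_const.sub h1).prodMk
    (measurable_eval_uncurry.comp (measurable_id.prodMk h1)))

/-- The strong Markov property is available for deterministic delays, whereas the delay `t - τ` is
random. Rounded up to a grid it takes countably many values, each on an event known at time `τ`; the
mesh then tends to zero against bounded continuous functions. -/
theorem map_eval_restrict_stopping (x : E) {τ : CadlagPath E → ℝ≥0∞} (hτ : IsStopping τ)
    {c t : ℝ≥0} (hct : c ≤ t) :
    ((X.law x).restrict {ω | τ ω ≤ c}).map (fun ω => ω t) =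
      ((X.law x).restrict {ω | τ ω ≤ c}).bind
        fun ω => X.trans (t - (τ ω).toNNReal) (ω (τ ω).toNNReal) := by
  have hB : MeasurableSet {ω | τ ω ≤ c} := hτ.measurable measurableSet_Iic
  have h1 : Measurable fun ω => (τ ω).toNNReal := hτ.measurable.ennreal_toNNReal
  have h2 : Measurable fun ω : CadlagPath E => ω (τ ω).toNNReal :=
    measurable_eval_uncurry.comp (measurable_id.prodMk h1)
  have hst : IsStoppingTime (natFiltration E) (τ : CadlagPath E → WithTop ℝ≥0) := hτ
  refine ext_of_forall_lintegral_eq_of_IsFiniteMeasure fun f => ?_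
  have hf : Measurable fun z => (f z : ℝ≥0∞) := by fun_prop
  rw [lintegral_map hf (measurable_eval t),
    Measure.lintegral_bind (X.measurable_trans_stopping hτ t).aemeasurable hf.aemeasurable]
  have hbd : ∀ z, (f z : ℝ≥0∞) ≤ (nndist f 0 : ℝ≥0∞) := fun z =>
    ENNReal.coe_le_coe.2 (BoundedContinuousFunction.NNReal.upper_bound f z)
  set U : ℕ → CadlagPath E → ℝ≥0 := fun n ω => gridUp n (t - (τ ω).toNNReal) with hU
  have hUm : ∀ n, Measurable (U n) := fun n =>
    (measurable_gridUp n).comp (measurable_const.sub h1)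
  have hker : ∀ n, Measurable fun ω : CadlagPath E => X.trans (U n ω) (ω (τ ω).toNNReal) :=
    fun n => Measure.measurable_of_measurable_coe _ fun A hA =>
      (X.measurable_trans_uncurry hA).comp ((hUm n).prodMk h2)
  have key : ∀ n, ∫⁻ ω in {ω | τ ω ≤ c}, f (ω ((τ ω).toNNReal + U n ω)) ∂X.law x =
      ∫⁻ ω in {ω | τ ω ≤ c}, ∫⁻ z, f z ∂X.trans (U n ω) (ω (τ ω).toNNReal) ∂X.law x := by
    intro n
    have := (countable_range_gridUp n).to_subtype
    set D : range (gridUp n) → Set (CadlagPath E) := fun u => {ω | τ ω ≤ c} ∩ {ω | U n ω = u}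
      with hD
    have hDm : ∀ u, MeasurableSet (D u) := fun u => hB.inter (hUm n (measurableSet_singleton _))
    have hDeq : {ω | τ ω ≤ c} = ⋃ u, D u := by
      ext ω
      simp [hD, hU]
    have hDd : Pairwise (Function.onFun Disjoint D) := fun u v huv =>
      Set.disjoint_left.2 fun ω h3 h4 => huv (Subtype.ext (h3.2.symm.trans h4.2))
    rw [hDeq, lintegral_iUnion hDm hDd, lintegral_iUnion hDm hDd]
    refine tsum_congr fun u => ?_
    have hDτ : MeasurableSet[hst.measurableSpace] (D u) := by
      have h3 : MeasurableSet {r : ℝ≥0∞ | r ≤ c ∧ gridUp n (t - r.toNNReal) = u} :=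
        measurableSet_Iic.inter (((measurable_gridUp n).comp
          (measurable_const.sub measurable_id.ennreal_toNNReal)) (measurableSet_singleton _))
      exact hst.measurable h3
    have h4 := X.setLIntegral_eval_add x hτ (hDm u) hDτ.2
      (fun ω hω => (lt_of_le_of_lt hω.1 ENNReal.coe_lt_top).ne) u hf
    refine Eq.trans (setLIntegral_congr_fun (hDm u) fun ω hω => ?_)
      (h4.trans (setLIntegral_congr_fun (hDm u) fun ω hω => ?_))
    · simp only [hω.2.symm]
    · simp only [hω.2.symm]
  have hlimU : ∀ ω, Tendsto (fun n => U n ω) atTop (𝓝 (t - (τ ω).toNNReal)) := fun ω =>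
    tendsto_gridUp _
  have lim1 : Tendsto (fun n => ∫⁻ ω in {ω | τ ω ≤ c}, f (ω ((τ ω).toNNReal + U n ω)) ∂X.law x)
      atTop (𝓝 (∫⁻ ω in {ω | τ ω ≤ c}, f (ω t) ∂X.law x)) := by
    refine tendsto_lintegral_of_dominated_convergence (fun _ => (nndist f 0 : ℝ≥0∞))
      (fun n => hf.comp (measurable_eval_uncurry.comp (measurable_id.prodMk (h1.add (hUm n)))))
      (fun n => Eventually.of_forall fun ω => hbd _) (by simp [ENNReal.mul_eq_top]) ?_
    filter_upwards [ae_restrict_mem hB] with ω hω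
    have hωt : (τ ω).toNNReal ≤ t :=
      (ENNReal.toNNReal_mono ENNReal.coe_ne_top hω).trans (by simpa using hct)
    refine ((ENNReal.continuous_coe.comp f.continuous).tendsto _).comp
      (ω.tendsto_right (fun n => ?_) ?_)
    · rw [← tsub_le_iff_left]
      exact (lt_gridUp _ _).le
    · simpa [add_tsub_cancel_of_le hωt] using (hlimU ω).const_add (τ ω).toNNReal
  have lim2 : Tendsto (fun n => ∫⁻ ω in {ω | τ ω ≤ c},
      ∫⁻ z, f z ∂X.trans (U n ω) (ω (τ ω).toNNReal) ∂X.law x) atTop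
      (𝓝 (∫⁻ ω in {ω | τ ω ≤ c},
        ∫⁻ z, f z ∂X.trans (t - (τ ω).toNNReal) (ω (τ ω).toNNReal) ∂X.law x)) := by
    refine tendsto_lintegral_of_dominated_convergence (fun _ => (nndist f 0 : ℝ≥0∞))
      (fun n => (Measure.measurable_lintegral hf).comp (hker n))
      (fun n => Eventually.of_forall fun ω => ?_) (by simp [ENNReal.mul_eq_top])
      (Eventually.of_forall fun ω => ?_)
    · exact (lintegral_mono hbd).trans (by simp)
    · exact X.tendsto_lintegral_trans f _ (fun n => (lt_gridUp _ _).le) (hlimU ω)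
  simp_rw [key] at lim1
  exact tendsto_nhds_unique lim1 lim2

/-- The strong Markov property at a stopping time `τ ≤ t` for functions of the state at time `t`. -/
theorem setLIntegral_eval_stopping (x : E) {τ : CadlagPath E → ℝ≥0∞} (hτ : IsStopping τ)
    {c t : ℝ≥0} (hct : c ≤ t) {f : E → ℝ≥0∞} (hf : UnivMeasurable f) :
    ∫⁻ ω in {ω | τ ω ≤ c}, f (ω t) ∂X.law x =
      ∫⁻ ω in {ω | τ ω ≤ c}, ∫⁻ y, f y ∂X.trans (t - (τ ω).toNNReal) (ω (τ ω).toNNReal)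
        ∂X.law x := by
  have h := X.map_eval_restrict_stopping x hτ hct
  rw [← lintegral_map' (hf _ inferInstance) (measurable_eval t).aemeasurable, h,
    Measure.lintegral_bind (X.measurable_trans_stopping hτ t).aemeasurable]
  rw [← h]
  exact hf _ inferInstance

theorem add_hit_shift_le {K : Set E} {ω : CadlagPath E} {t : ℝ≥0} (h : t ≤ hit K ω) :
    t + hit K (shift t ω) ≤ hit K ω := by
  refine le_iInf₂ fun s hs => ?_
  have hts : t ≤ s := by exact_mod_cast h.trans (hit_le hs)
  have : hit K (shift t ω) ≤ (s - t : ℝ≥0) := hit_le (by simpa [add_tsub_cancel_of_le hts] using hs)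
  calc (t : ℝ≥0∞) + hit K (shift t ω) ≤ t + (s - t : ℝ≥0) := by gcongr
    _ = s := by rw [← ENNReal.coe_add, add_tsub_cancel_of_le hts]

/-- Split according to whether `K` is hit by time `t`. If not, the hitting time is at least `t` plus
that of the shifted path, which yields the factor `exp(-a t)`. If so, the strong Markov property
restarts the process in `K` with at most `t` to run, where `hC` applies. -/
theorem lintegral_trans_expHit_le {K : Set E} (hK : IsClosed K) {a : ℝ} (ha : 0 < a) {t : ℝ≥0}
    {C : ℝ≥0∞} (hC : ∀ u ≤ t, ∀ y ∈ K, ∫⁻ z, X.expHit K a z ∂X.trans u y ≤ C) (x : E) :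
    ∫⁻ y, X.expHit K a y ∂X.trans t x ≤
      ENNReal.ofReal (Real.exp (-a * t)) * X.expHit K a x + C := by
  obtain ⟨τ, hτ, h⟩ := exists_isStopping_ae_eq_hit hK (X.law x)
  have hφ := X.univMeasurable_expHit hK a
  have hB : MeasurableSet {ω | τ ω ≤ t} := hτ.measurable measurableSet_Iic
  rw [X.lintegral_trans' t x hφ, ← lintegral_add_compl _ hB, add_comm]
  refine add_le_add ?_ ?_
  · rw [X.setLIntegral_expHit_eval hK a x t (hτ t).compl, expHit_eq, ← lintegral_const_mul' _ _
      ENNReal.ofReal_ne_top, ← lintegral_indicator hB.compl]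
    refine lintegral_mono_ae ?_
    filter_upwards [h] with ω hω
    by_cases hω' : ω ∈ {ω | τ ω ≤ t}ᶜ
    · rw [indicator_of_mem hω']
      have h1 : t ≤ hit K ω := by
        rw [hω.1]
        exact le_of_not_ge fun h2 => hω' h2
      calc expTime a (hit K (shift t ω))
          = ENNReal.ofReal (Real.exp (-a * t)) * (expTime a t * expTime a (hit K (shift t ω))) := by
            rw [← mul_assoc, expTime_coe, ← ENNReal.ofReal_mul (Real.exp_nonneg _), ← Real.exp_add]
            simp
        _ ≤ _ := by
            rw [← expTime_add ha]
            gcongr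
            exact expTime_mono ha (add_hit_shift_le h1)
    · rw [indicator_of_notMem hω']
      exact zero_le
  · rw [X.setLIntegral_eval_stopping x hτ le_rfl hφ]
    calc _ ≤ ∫⁻ ω in {ω | τ ω ≤ t}, C ∂X.law x := by
          refine setLIntegral_mono_ae' hB ?_
          filter_upwards [h] with ω hω hωt
          exact hC _ tsub_le_self _ (hω.2 (lt_of_le_of_lt hωt ENNReal.coe_lt_top).ne)
      _ ≤ ∫⁻ _, C ∂X.law x := setLIntegral_le_lintegral _ _
      _ = C := by simp

theorem lintegral_trans_add (s t : ℝ≥0) (x : E) {f : E → ℝ≥0∞} (hf : UnivMeasurable f) :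
    ∫⁻ y, f y ∂X.trans (s + t) x = ∫⁻ y, ∫⁻ z, f z ∂X.trans t y ∂X.trans s x := by
  rw [trans_add, Kernel.comp_apply, Measure.lintegral_bind (X.trans t).aemeasurable]
  exact hf _ (inferInstanceAs (IsFiniteMeasure ((X.trans t ∘ₖ X.trans s) x)))

/-- The exponential moments of the hitting time of `K` form a Lyapunov function. -/
theorem exists_lyapunov {K : Set E} (hK : IsClosed K) {a : ℝ} (ha : 0 < a) {S : ℝ≥0} (hS : 0 < S)
    {C : ℝ≥0∞} (hCtop : C ≠ ∞)
    (hC : ∀ u ≤ S, ∀ y ∈ K, ∫⁻ z, X.expHit K a z ∂X.trans u y ≤ C) :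
    ∃ L : ℝ≥0∞, L ≠ ∞ ∧ ∀ t x, ∫⁻ y, X.expHit K a y ∂X.trans t x ≤
      ENNReal.ofReal (Real.exp (-a * t)) * X.expHit K a x + L := by
  set φ := X.expHit K a with hφ
  have hφm : UnivMeasurable φ := X.univMeasurable_expHit hK a
  have hloc : ∀ u ≤ S, ∀ x, ∫⁻ y, φ y ∂X.trans u x ≤
      ENNReal.ofReal (Real.exp (-a * u)) * φ x + C := fun u hu x =>
    X.lintegral_trans_expHit_le hK ha (fun v hv => hC v (hv.trans hu)) x
  set q : ℝ≥0∞ := ENNReal.ofReal (Real.exp (-a * S)) with hq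
  have hq1 : q < 1 := by
    rw [hq, ENNReal.ofReal_lt_one, Real.exp_lt_one_iff]
    have : (0 : ℝ) < S := hS
    nlinarith
  have hmul : ∀ u v : ℝ≥0, ENNReal.ofReal (Real.exp (-a * u)) * ENNReal.ofReal (Real.exp (-a * v)) =
      ENNReal.ofReal (Real.exp (-a * (u + v : ℝ≥0))) := fun u v => by
    rw [← ENNReal.ofReal_mul (Real.exp_nonneg _), ← Real.exp_add]
    push_cast
    ring_nf
  -- Steps of length `S` contract by `q < 1`, so the additive errors form a geometric series.
  have hiter : ∀ (n : ℕ) (x : E), ∫⁻ y, φ y ∂X.trans (n * S) x ≤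
      ENNReal.ofReal (Real.exp (-a * (n * S : ℝ≥0))) * φ x + C * ∑ i ∈ Finset.range n, q ^ i := by
    intro n
    induction n with
    | zero =>
      intro x
      simp [trans_zero]
    | succ n ih =>
      intro x
      have e : ((n + 1 : ℕ) : ℝ≥0) * S = S + n * S := by push_cast; ring
      rw [e, X.lintegral_trans_add S (n * S) x hφm]
      have hm : AEMeasurable φ (X.trans S x) := hφm _ inferInstance
      calc _ ≤ ∫⁻ y, (ENNReal.ofReal (Real.exp (-a * (n * S : ℝ≥0))) * φ y +
              C * ∑ i ∈ Finset.range n, q ^ i) ∂X.trans S x := lintegral_mono ih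
        _ = ENNReal.ofReal (Real.exp (-a * (n * S : ℝ≥0))) * ∫⁻ y, φ y ∂X.trans S x +
              C * ∑ i ∈ Finset.range n, q ^ i := by
            rw [lintegral_add_right _ measurable_const, lintegral_const_mul'' _ hm]
            simp
        _ ≤ ENNReal.ofReal (Real.exp (-a * (n * S : ℝ≥0))) *
              (ENNReal.ofReal (Real.exp (-a * S)) * φ x + C) +
              C * ∑ i ∈ Finset.range n, q ^ i := by
            gcongr
            exact hloc S le_rfl x
        _ = _ := by
            have e2 : ENNReal.ofReal (Real.exp (-a * (n * S : ℝ≥0))) = q ^ n := by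
              rw [hq, ← ENNReal.ofReal_pow (Real.exp_nonneg _), ← Real.exp_nat_mul]
              push_cast
              ring_nf
            rw [mul_add, ← mul_assoc, hmul, Finset.sum_range_succ, e2, mul_add,
              add_comm (n * S) S]
            ring
  -- The full geometric series, plus one `C` for the last incomplete step.
  refine ⟨C * (1 - q)⁻¹ + C, ?_, fun t x => ?_⟩
  · have : (1 - q)⁻¹ ≠ ∞ := ENNReal.inv_ne_top.2 (tsub_pos_of_lt hq1).ne'
    finiteness
  · set n := ⌊t / S⌋₊ with hn
    have hnt : n * S ≤ t := by
      rw [← le_div_iff₀ hS]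
      exact Nat.floor_le zero_le
    have htn : t - n * S ≤ S := by
      rw [tsub_le_iff_left]
      have : t / S < n + 1 := Nat.lt_floor_add_one _
      rw [div_lt_iff₀ hS] at this
      exact this.le.trans (by ring_nf; rfl)
    have e : t = n * S + (t - n * S) := (add_tsub_cancel_of_le hnt).symm
    set u := t - n * S with hu
    rw [e, X.lintegral_trans_add _ _ x hφm]
    have hm : AEMeasurable φ (X.trans (n * S) x) := hφm _ inferInstance
    calc _ ≤ ∫⁻ y, (ENNReal.ofReal (Real.exp (-a * u)) * φ y + C) ∂X.trans (n * S) x :=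
          lintegral_mono (hloc u htn)
      _ = ENNReal.ofReal (Real.exp (-a * u)) * ∫⁻ y, φ y ∂X.trans (n * S) x + C := by
          rw [lintegral_add_right _ measurable_const, lintegral_const_mul'' _ hm]
          simp
      _ ≤ ENNReal.ofReal (Real.exp (-a * u)) * (ENNReal.ofReal (Real.exp (-a * (n * S : ℝ≥0))) * φ x
            + C * ∑ i ∈ Finset.range n, q ^ i) + C := by
          gcongr
          exact hiter n x
      _ = ENNReal.ofReal (Real.exp (-a * (n * S + u : ℝ≥0))) * φ x +
            ENNReal.ofReal (Real.exp (-a * u)) * (C * ∑ i ∈ Finset.range n, q ^ i) + C := by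
          rw [mul_add, ← mul_assoc, hmul, add_comm u]
      _ ≤ ENNReal.ofReal (Real.exp (-a * (n * S + u : ℝ≥0))) * φ x + 1 * (C * (1 - q)⁻¹) + C := by
          gcongr
          · rw [ENNReal.ofReal_le_one, Real.exp_le_one_iff]
            have : (0 : ℝ) ≤ u := u.2
            nlinarith
          · rw [← ENNReal.tsum_geometric]
            exact ENNReal.sum_le_tsum _
      _ = _ := by rw [one_mul, add_assoc]

end Lyapunov

end CadlagStrongMarkov

/-! ### Common parts of measures -/

section Overlap

variable {E : Type*} [MeasurableSpace E]

/-- The common part `μ ⊓ ν` of two measures has mass at least `ε`. -/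
def Overlap (μ ν : Measure E) (ε : ℝ≥0∞) : Prop := ∀ A, MeasurableSet A → ε ≤ μ A + ν Aᶜ

theorem Overlap.symm {μ ν : Measure E} {ε : ℝ≥0∞} (h : Overlap μ ν ε) : Overlap ν μ ε :=
  fun A hA => by simpa [add_comm] using h Aᶜ hA.compl

/-- The mass of an infimum of measures is an infimum over arbitrary sets. Passing to a measurable
hull keeps the `μ`-mass and only shrinks the complement. -/
theorem Overlap.le_inf {μ ν : Measure E} {ε : ℝ≥0∞} (h : Overlap μ ν ε) : ε ≤ (μ ⊓ ν) univ := by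
  rw [Measure.inf_apply MeasurableSet.univ]
  refine le_sInf ?_
  rintro _ ⟨t, rfl⟩
  rw [inter_univ, inter_univ]
  refine (h _ (measurableSet_toMeasurable μ t)).trans (add_le_add (measure_toMeasurable t).le ?_)
  exact measure_mono (compl_subset_compl.2 (subset_toMeasurable μ t))

theorem lintegral_inf_le {μ ν : Measure E} {f g : E → ℝ≥0∞} (hf : Measurable f) :
    ∫⁻ z, f z + g z ∂(μ ⊓ ν) ≤ ∫⁻ z, f z ∂μ + ∫⁻ z, g z ∂ν := by
  rw [lintegral_add_left hf]
  exact add_le_add (lintegral_mono' inf_le_left le_rfl) (lintegral_mono' inf_le_right le_rfl)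

theorem Overlap.bind {μ ν : Measure E} {ε : ℝ≥0∞} (h : Overlap μ ν ε) (κ : Kernel E E)
    [IsMarkovKernel κ] : Overlap (μ.bind κ) (ν.bind κ) ε := fun A hA => by
  rw [Measure.bind_apply hA κ.aemeasurable, Measure.bind_apply hA.compl κ.aemeasurable]
  refine le_trans ?_ (lintegral_inf_le (κ.measurable_coe hA))
  simp_rw [prob_add_prob_compl hA]
  simpa using h.le_inf

/-- Both measures have mass one, so the two Jordan parts of their difference have equal mass. Half
the total variation is therefore the mass of the negative part, which bounds `ν A - μ A`. -/
theorem overlap_totalVariation (μ ν : Measure E) [IsProbabilityMeasure μ] [IsProbabilityMeasure ν]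
    {A : Set E} (hA : MeasurableSet A) :
    1 ≤ μ A + ν Aᶜ + 2⁻¹ * (μ.toSignedMeasure - ν.toSignedMeasure).totalVariation univ := by
  set σ := μ.toSignedMeasure - ν.toSignedMeasure with hσ
  set j := σ.toJordanDecomposition with hj
  have hσj : σ = j.posPart.toSignedMeasure - j.negPart.toSignedMeasure :=
    σ.toSignedMeasure_toJordanDecomposition.symm
  have happ : ∀ B, MeasurableSet B → μ.real B - ν.real B = j.posPart.real B - j.negPart.real B := by
    intro B hB
    have h1 : σ B = μ.real B - ν.real B := by simp [hσ, hB]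
    have h2 : σ B = j.posPart.real B - j.negPart.real B := by rw [hσj]; simp [hB]
    rw [← h1, h2]
  have hu : j.posPart.real univ = j.negPart.real univ := by
    have := happ univ MeasurableSet.univ
    simp only [probReal_univ, sub_self] at this
    linarith
  have hA' : ν.real A ≤ μ.real A + j.negPart.real univ := by
    have h1 := happ A hA
    have h2 : j.negPart.real A ≤ j.negPart.real univ := measureReal_mono (subset_univ _)
    have h3 : 0 ≤ j.posPart.real A := measureReal_nonneg
    linarith
  have hu' : j.posPart univ = j.negPart univ := by
    rwa [measureReal_def, measureReal_def, ENNReal.toReal_eq_toReal_iff' (by finiteness)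
      (by finiteness)] at hu
  have hT : 2⁻¹ * σ.totalVariation univ = j.negPart univ := by
    rw [SignedMeasure.totalVariation, Measure.add_apply, ← hj, hu', ← two_mul, ← mul_assoc,
      ENNReal.inv_mul_cancel two_ne_zero (by finiteness), one_mul]
  have hA2 : ν A ≤ μ A + j.negPart univ := by
    rw [← ENNReal.toReal_le_toReal (by finiteness) (by finiteness),
      ENNReal.toReal_add (by finiteness) (by finiteness)]
    exact hA'
  rw [hT, ← prob_add_prob_compl (μ := ν) hA]
  calc ν A + ν Aᶜ ≤ μ A + j.negPart univ + ν Aᶜ := by gcongr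
    _ = _ := by ring

theorem eventually_exp_mul_lt {a : ℝ} (ha : 0 < a) {M ε : ℝ≥0∞} (hM : M ≠ ∞) (hε : 0 < ε) :
    ∀ᶠ c : ℝ≥0 in atTop, ENNReal.ofReal (Real.exp (-a * c)) * M < ε := by
  have h1 : Tendsto (fun c : ℝ≥0 => Real.exp (-a * c)) atTop (𝓝 0) := by
    refine Real.tendsto_exp_atBot.comp ?_
    exact (NNReal.tendsto_coe_atTop.2 tendsto_id).const_mul_atTop_of_neg (by linarith)
  have h2 : Tendsto (fun c : ℝ≥0 => ENNReal.ofReal (Real.exp (-a * c)) * M) atTop (𝓝 0) := by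
    have := ENNReal.Tendsto.mul_const (ENNReal.tendsto_ofReal h1) (Or.inr hM)
    simpa using this
  exact h2.eventually (gt_mem_nhds hε)

theorem exists_exp_mul_le {a : ℝ} (ha : 0 < a) {M ε : ℝ≥0∞} (hM : M ≠ ∞) (hε : 0 < ε) :
    ∃ c : ℝ≥0, ENNReal.ofReal (Real.exp (-a * c)) * M ≤ ε :=
  ((eventually_exp_mul_lt ha hM hε).exists).imp fun _ hc => hc.le

end Overlap

/-! ### Smallness of the sublevel sets -/

namespace CadlagStrongMarkov

open CadlagPath

section SmallSets

variable {E : Type*} [MetricSpace E] [MeasurableSpace E] [BorelSpace E] (X : CadlagStrongMarkov E)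

theorem Overlap.trans_add {X : CadlagStrongMarkov E} {s t : ℝ≥0} {x y : E} {ε : ℝ≥0∞}
    (h : Overlap (X.trans s x) (X.trans t y) ε) (u : ℝ≥0) :
    Overlap (X.trans (s + u) x) (X.trans (t + u) y) ε := by
  have := h.bind (X.trans u)
  rwa [← Kernel.comp_apply, ← Kernel.comp_apply, ← X.trans_add, ← X.trans_add] at this

theorem overlap_of_halfVar {s t : ℝ≥0} {x y : E} {q : ℝ≥0∞} (h : X.halfVar s t x y ≤ q) :
    Overlap (X.trans s x) (X.trans t y) (1 - q) := fun A hA => by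
  rw [tsub_le_iff_right]
  exact (overlap_totalVariation _ _ hA).trans (by gcongr; exact h)

theorem overlap_of_doeblinOn {A : Set E} (h : X.DoeblinOn A) :
    ∃ T : ℝ≥0, ∃ ε : ℝ≥0∞, 0 < ε ∧ ∀ t, T ≤ t → ∀ x ∈ A, ∀ y ∈ A,
      Overlap (X.trans t x) (X.trans t y) ε := by
  obtain ⟨T, -, hT⟩ := h
  refine ⟨T, _, tsub_pos_of_lt hT, fun t ht x hx y hy => ?_⟩
  have h1 : X.halfVar T T x y ≤ ⨆ x ∈ A, ⨆ y ∈ A, X.halfVar T T x y :=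
    le_trans (le_iSup₂_of_le y hy le_rfl) (le_iSup₂ (f := fun x (_ : x ∈ A) =>
      ⨆ y ∈ A, X.halfVar T T x y) x hx)
  have := Overlap.trans_add (X.overlap_of_halfVar h1) (t - T)
  rwa [add_tsub_cancel_of_le ht] at this

/-- The process hits `K` by time `c` with probability at least `1 - exp (-a c) E_x exp (a τ_K)`. -/
theorem exists_hitting {K : Set E} (hK : IsClosed K) {a : ℝ} (ha : 0 < a) (x : E) :
    ∃ τ : CadlagPath E → ℝ≥0∞, IsStopping τ ∧
      (∀ᵐ ω ∂X.law x, τ ω ≠ ∞ → ω (τ ω).toNNReal ∈ K) ∧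
      ∀ c : ℝ≥0, 1 ≤ X.law x {ω | τ ω ≤ c} +
        ENNReal.ofReal (Real.exp (-a * c)) * X.expHit K a x := by
  obtain ⟨τ, hτ, h⟩ := exists_isStopping_ae_eq_hit hK (X.law x)
  refine ⟨τ, hτ, h.mono fun ω hω => hω.2, fun c => ?_⟩
  have hB : MeasurableSet {ω | τ ω ≤ c} := hτ.measurable measurableSet_Iic
  rw [← prob_add_prob_compl (μ := X.law x) hB]
  gcongr
  have h1 : X.expHit K a x = ∫⁻ ω, expTime a (τ ω) ∂X.law x :=
    lintegral_congr_ae (h.mono fun ω hω => congrArg (expTime a) hω.1)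
  have h2 := mul_meas_ge_le_lintegral (μ := X.law x)
    ((measurable_expTime a).comp hτ.measurable) (expTime a c)
  have h3 : {ω | τ ω ≤ c}ᶜ ⊆ {ω | expTime a c ≤ (expTime a ∘ τ) ω} := fun ω hω =>
    expTime_mono ha (le_of_not_ge fun h => hω h)
  calc X.law x {ω | τ ω ≤ c}ᶜ
      = ENNReal.ofReal (Real.exp (-a * c)) * (expTime a c * X.law x {ω | τ ω ≤ c}ᶜ) := by
        rw [← mul_assoc, expTime_coe, ← ENNReal.ofReal_mul (Real.exp_nonneg _), ← Real.exp_add]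
        simp
    _ ≤ _ := by
        rw [h1]
        gcongr
        exact le_trans (by gcongr) h2

theorem setLIntegral_trans_le {τ : CadlagPath E → ℝ≥0∞} (hτ : IsStopping τ) {c s : ℝ≥0}
    (hcs : c ≤ s) (x : E) {A : Set E} (hA : MeasurableSet A) :
    ∫⁻ ω in {ω | τ ω ≤ c}, X.trans (s - (τ ω).toNNReal) (ω (τ ω).toNNReal) A ∂X.law x ≤
      X.trans s x A := by
  have hf : Measurable (A.indicator (1 : E → ℝ≥0∞)) := measurable_one.indicator hA
  have h1 := X.setLIntegral_eval_stopping x hτ hcs (f := A.indicator 1)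
    fun μ _ => hf.aemeasurable
  simp only [lintegral_indicator_one hA] at h1
  rw [← h1, ← lintegral_indicator_one hA, X.lintegral_trans s x hf]
  exact setLIntegral_le_lintegral _ _

/-- Both evolutions start at the same point, so one hitting time of `K` serves both, and `h` applies
with the same elapsed time `u` and the same point `k`. The last term pays for not hitting `K` by
time `c`. -/
theorem overlap_of_hitting {K : Set E} (hK : IsClosed K) {a : ℝ} (ha : 0 < a) {c s t : ℝ≥0}
    (hcs : c ≤ s) (hct : c ≤ t) {ε : ℝ≥0∞} {A : Set E} (hA : MeasurableSet A)
    (h : ∀ u ≤ c, ∀ k ∈ K, ε ≤ X.trans (s - u) k A + X.trans (t - u) k Aᶜ) (x : E) :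
    ε ≤ X.trans s x A + X.trans t x Aᶜ +
      ε * (ENNReal.ofReal (Real.exp (-a * c)) * X.expHit K a x) := by
  obtain ⟨τ, hτ, hτK, hc⟩ := X.exists_hitting hK ha x
  have hB : MeasurableSet {ω | τ ω ≤ c} := hτ.measurable measurableSet_Iic
  calc ε = ε * 1 := (mul_one ε).symm
    _ ≤ ε * X.law x {ω | τ ω ≤ c} +
        ε * (ENNReal.ofReal (Real.exp (-a * c)) * X.expHit K a x) := by
      rw [← mul_add]; gcongr; exact hc c
    _ ≤ _ := by
      gcongr
      refine le_trans ?_ (add_le_add (X.setLIntegral_trans_le hτ hcs x hA)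
        (X.setLIntegral_trans_le hτ hct x hA.compl))
      have hm : Measurable fun ω => X.trans (s - (τ ω).toNNReal) (ω (τ ω).toNNReal) A :=
        (Measure.measurable_coe hA).comp (X.measurable_trans_stopping hτ s)
      rw [← lintegral_add_left hm, ← setLIntegral_const]
      refine setLIntegral_mono_ae' hB ?_
      filter_upwards [hτK] with ω hω hωc
      have hτt : τ ω ≠ ∞ := (lt_of_le_of_lt hωc ENNReal.coe_lt_top).ne
      refine h _ ?_ _ (hω hτt)
      exact ENNReal.toNNReal_mono ENNReal.coe_ne_top hωc

theorem mul_le_trans_of_hitting {K : Set E} (hK : IsClosed K) {a : ℝ} (ha : 0 < a) {c s : ℝ≥0}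
    (hcs : c ≤ s) {b : ℝ≥0∞} {A : Set E} (hA : MeasurableSet A)
    (h : ∀ u ≤ c, ∀ k ∈ K, b ≤ X.trans (s - u) k A) {x : E}
    (hx : ENNReal.ofReal (Real.exp (-a * c)) * X.expHit K a x ≤ 2⁻¹) :
    b * 2⁻¹ ≤ X.trans s x A := by
  obtain ⟨τ, hτ, hτK, hc⟩ := X.exists_hitting hK ha x
  have hB : MeasurableSet {ω | τ ω ≤ c} := hτ.measurable measurableSet_Iic
  have h2 : 2⁻¹ ≤ X.law x {ω | τ ω ≤ c} := by
    have h3 : (2⁻¹ : ℝ≥0∞) + 2⁻¹ ≤ X.law x {ω | τ ω ≤ c} + 2⁻¹ := by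
      rw [ENNReal.inv_two_add_inv_two]
      exact (hc c).trans (by gcongr)
    exact (ENNReal.add_le_add_iff_right (by finiteness)).1 h3
  refine le_trans ?_ (X.setLIntegral_trans_le hτ hcs x hA)
  calc b * 2⁻¹ ≤ b * X.law x {ω | τ ω ≤ c} := by gcongr
    _ = ∫⁻ ω in {ω | τ ω ≤ c}, b ∂X.law x := (setLIntegral_const _ _).symm
    _ ≤ _ := by
      refine setLIntegral_mono_ae' hB ?_
      filter_upwards [hτK] with ω hω hωc
      have hτt : τ ω ≠ ∞ := (lt_of_le_of_lt hωc ENNReal.coe_lt_top).ne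
      exact h _ (ENNReal.toNNReal_mono ENNReal.coe_ne_top hωc) _ (hω hτt)

/-- Under the extended Doeblin condition on `K`, the distributions of the process started in `K`
overlap at large times with a bounded discrepancy. -/
theorem exists_overlap_of_discrepancy {K : Set E} (hK : IsClosed K) {a : ℝ} (ha : 0 < a)
    {L : ℝ≥0∞} (hL : L ≠ ∞) (hlyap : ∀ t, ∀ x ∈ K, ∫⁻ y, X.expHit K a y ∂X.trans t x ≤ L)
    {T₁ T₂ : ℝ≥0} {ε₀ : ℝ≥0∞} (hε₀ : 0 < ε₀)
    (hov : ∀ x ∈ K, ∀ y ∈ K, ∀ s ∈ Icc T₁ T₂, ∀ t ∈ Icc T₁ T₂,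
      Overlap (X.trans s x) (X.trans t y) ε₀) (hT : T₁ ≤ T₂) (J : ℕ) :
    ∃ M : ℝ≥0, ∃ ε : ℝ≥0∞, 0 < ε ∧ ∀ x ∈ K, ∀ y ∈ K, ∀ s t, M ≤ s → M ≤ t →
      s ≤ t + J * (T₂ - T₁) → t ≤ s + J * (T₂ - T₁) → Overlap (X.trans s x) (X.trans t y) ε := by
  induction J with
  | zero =>
    refine ⟨T₁, ε₀, hε₀, fun x hx y hy s t hs ht hst hts => ?_⟩
    have e : t = s := le_antisymm (by simpa using hts) (by simpa using hst)
    subst e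
    have := Overlap.trans_add (hov x hx y hy T₁ ⟨le_rfl, hT⟩ T₁ ⟨le_rfl, hT⟩) (t - T₁)
    rwa [add_tsub_cancel_of_le hs] at this
  | succ J ih =>
    obtain ⟨M, ε, hε, ih⟩ := ih
    -- With this `c`, the average cost of missing `K` is at most half of the mass `ε₀` coupled in
    -- the first stage.
    obtain ⟨c, hc⟩ := exists_exp_mul_le ha hL (ENNReal.half_pos hε₀.ne')
    -- A point of `K` is needed to see that `ε` and `ε₀` are finite, which the final cancellation
    -- requires.
    rcases K.eq_empty_or_nonempty with rfl | ⟨k₀, hk₀⟩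
    · exact ⟨0, 1, one_pos, fun x hx => hx.elim⟩
    have hε1 : ε ≠ ∞ := by
      have h1 := ih k₀ hk₀ k₀ hk₀ M M le_rfl le_rfl (by simp) (by simp) univ MeasurableSet.univ
      exact (h1.trans_lt (by finiteness)).ne
    have hε01 : ε₀ ≠ ∞ := by
      have h1 := hov k₀ hk₀ k₀ hk₀ T₁ ⟨le_rfl, hT⟩ T₁ ⟨le_rfl, hT⟩ univ MeasurableSet.univ
      exact (h1.trans_lt (by finiteness)).ne
    refine ⟨M + c + T₂, ε * (ε₀ / 2), ENNReal.mul_pos hε.ne' (ENNReal.half_pos hε₀.ne').ne', ?_⟩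
    have main : ∀ x ∈ K, ∀ y ∈ K, ∀ s t, M + c + T₂ ≤ t → t ≤ s → s ≤ t + (J + 1 : ℕ) * (T₂ - T₁) →
        Overlap (X.trans s x) (X.trans t y) (ε * (ε₀ / 2)) := by
      intro x hx y hy s t hMt hts hst A hA
      -- The copy from `x` first runs for `T₁ + d`, the copy from `y` for `T₁`; mass `ε₀` meets at a
      -- common point. The discrepancy drops by `d`, so at most `J * (T₂ - T₁)` remains. From the
      -- meeting point the process returns to `K`, where the induction hypothesis takes over.
      set d := min (s - t) (T₂ - T₁) with hd
      obtain ⟨s', hs'⟩ : ∃ s', s = T₁ + d + s' := by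
        refine ⟨s - (T₁ + d), (add_tsub_cancel_of_le ?_).symm⟩
        calc T₁ + d ≤ T₁ + (T₂ - T₁) := by gcongr; exact min_le_right _ _
          _ = T₂ := add_tsub_cancel_of_le hT
          _ ≤ s := le_trans le_add_self (hMt.trans hts)
      obtain ⟨t', ht'⟩ : ∃ t', t = T₁ + t' := by
        refine ⟨t - T₁, (add_tsub_cancel_of_le ?_).symm⟩
        exact hT.trans (le_trans le_add_self hMt)
      have hdst : d ≤ s - t := min_le_left _ _
      have hdT : d ≤ T₂ - T₁ := min_le_right _ _
      have htd : t + d ≤ s := by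
        calc t + d ≤ t + (s - t) := by gcongr
          _ = s := add_tsub_cancel_of_le hts
      have hts' : t' ≤ s' := by
        have : T₁ + d + t' ≤ T₁ + d + s' := by rw [← hs', add_right_comm, ← ht']; exact htd
        exact le_of_add_le_add_left this
      have hst' : s' ≤ t' + J * (T₂ - T₁) := by
        rcases min_cases (s - t) (T₂ - T₁) with h | h
        · have h1 : T₁ + d + s' = T₁ + d + t' := by
            rw [← hs', add_right_comm, ← ht', hd, h.1, add_tsub_cancel_of_le hts]
          exact (add_left_cancel h1).le.trans le_self_add
        · have h1 : T₁ + d + s' ≤ T₁ + d + (t' + J * (T₂ - T₁)) := by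
            rw [← hs']
            refine hst.trans (le_of_eq ?_)
            rw [ht', hd, h.1]
            push_cast
            ring
          exact le_of_add_le_add_left h1
      have hMc : M + c ≤ t' := by
        have : T₁ + (M + c) ≤ T₁ + t' := by
          rw [← ht', add_comm]
          exact le_trans (by gcongr) hMt
        exact le_of_add_le_add_left this
      have hct' : c ≤ t' := le_add_self.trans hMc
      have hTd : T₁ + d ∈ Icc T₁ T₂ := ⟨le_self_add, by
        calc T₁ + d ≤ T₁ + (T₂ - T₁) := by gcongr
          _ = T₂ := add_tsub_cancel_of_le hT⟩
      set μ := X.trans (T₁ + d) x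
      set ν := X.trans T₁ y
      have hmass : ε₀ ≤ (μ ⊓ ν) univ := (hov x hx y hy _ hTd T₁ ⟨le_rfl, hT⟩).le_inf
      have hz : ∀ z, ε ≤ X.trans s' z A + X.trans t' z Aᶜ +
          ε * (ENNReal.ofReal (Real.exp (-a * c)) * X.expHit K a z) := fun z => by
        refine X.overlap_of_hitting hK ha (hct'.trans hts') hct' hA (fun u hu k hk => ?_) z
        have hMu : M ≤ t' - u := by
          refine le_tsub_of_add_le_right (le_trans ?_ hMc)
          gcongr
        refine ih k hk k hk _ _ (hMu.trans (by gcongr)) hMu ?_ ?_ A hA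
        · rw [tsub_add_eq_add_tsub (hu.trans hct')]
          gcongr
        · exact le_trans (by gcongr) le_self_add
      have hX : X.trans s x A + X.trans t y Aᶜ =
          ∫⁻ z, X.trans s' z A ∂μ + ∫⁻ z, X.trans t' z Aᶜ ∂ν := by
        rw [hs', ht', X.trans_add (T₁ + d) s', X.trans_add T₁ t', Kernel.comp_apply' _ _ _ hA,
          Kernel.comp_apply' _ _ _ hA.compl]
      have hφ : AEMeasurable (X.expHit K a) (μ ⊓ ν) :=
        (X.univMeasurable_expHit hK a μ inferInstance).mono_measure inf_le_left
      have hm : Measurable fun z => X.trans s' z A + X.trans t' z Aᶜ :=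
        ((X.trans s').measurable_coe hA).add ((X.trans t').measurable_coe hA.compl)
      have hint : ε * ε₀ ≤ X.trans s x A + X.trans t y Aᶜ + ε * (ε₀ / 2) := by
        calc ε * ε₀ ≤ ∫⁻ _, ε ∂(μ ⊓ ν) := by rw [lintegral_const]; gcongr
          _ ≤ ∫⁻ z, (X.trans s' z A + X.trans t' z Aᶜ +
                ε * (ENNReal.ofReal (Real.exp (-a * c)) * X.expHit K a z)) ∂(μ ⊓ ν) :=
              lintegral_mono hz
          _ = ∫⁻ z, (X.trans s' z A + X.trans t' z Aᶜ) ∂(μ ⊓ ν) +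
                ε * (ENNReal.ofReal (Real.exp (-a * c)) * ∫⁻ z, X.expHit K a z ∂(μ ⊓ ν)) := by
              rw [lintegral_add_left hm, lintegral_const_mul'' _
                (hφ.const_mul _), lintegral_const_mul'' _ hφ]
          _ ≤ _ := by
              rw [hX]
              gcongr
              · exact lintegral_inf_le ((X.trans s').measurable_coe hA)
              · refine le_trans ?_ hc
                gcongr
                exact (lintegral_mono' inf_le_left le_rfl).trans (hlyap _ x hx)
      have hhalf : ε * ε₀ = ε * (ε₀ / 2) + ε * (ε₀ / 2) := by
        rw [← mul_add, ENNReal.add_halves]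
      rw [hhalf] at hint
      refine (ENNReal.add_le_add_iff_right (ENNReal.mul_ne_top hε1 ?_)).1 hint
      exact ENNReal.div_ne_top hε01 two_ne_zero
    intro x hx y hy s t hs ht hst hts
    rcases le_total t s with h | h
    · exact main x hx y hy s t ht h hst
    · exact (main y hy x hx t s hs h hts).symm

/-- Each copy reaches `K` by a time `c` with probability at least 1/2. The two hitting times differ
by at most `c`, a discrepancy that the overlap from `K` tolerates once `J` is large. -/
theorem exists_overlap_of_extendedDoeblin {K : Set E} (hK : IsClosed K) (hE : X.ExtendedDoeblinOn K)
    {a : ℝ} (ha : 0 < a) {L : ℝ≥0∞} (hL : L ≠ ∞)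
    (hlyap : ∀ t, ∀ x ∈ K, ∫⁻ y, X.expHit K a y ∂X.trans t x ≤ L) {R : ℝ≥0∞} (hR : R ≠ ∞) :
    ∃ T : ℝ≥0, ∃ ε : ℝ≥0∞, 0 < ε ∧ ∀ t, T ≤ t → ∀ x y, X.expHit K a x ≤ R → X.expHit K a y ≤ R →
      Overlap (X.trans t x) (X.trans t y) ε := by
  obtain ⟨T₁, T₂, -, hT, hlt⟩ := hE
  set q := ⨆ x ∈ K, ⨆ y ∈ K, ⨆ s ∈ Icc T₁ T₂, ⨆ t ∈ Icc T₁ T₂, X.halfVar s t x y with hq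
  have hov : ∀ x ∈ K, ∀ y ∈ K, ∀ s ∈ Icc T₁ T₂, ∀ t ∈ Icc T₁ T₂,
      Overlap (X.trans s x) (X.trans t y) (1 - q) := fun x hx y hy s hs t ht =>
    X.overlap_of_halfVar (le_iSup₂_of_le x hx (le_iSup₂_of_le y hy
      (le_iSup₂_of_le s hs (le_iSup₂_of_le t ht le_rfl))))
  obtain ⟨c, hc⟩ := exists_exp_mul_le ha hR (show (0 : ℝ≥0∞) < 2⁻¹ by simp)
  obtain ⟨J, hJ⟩ := exists_nat_ge (c / (T₂ - T₁))
  have hJc : c ≤ J * (T₂ - T₁) := (div_le_iff₀ (tsub_pos_of_lt hT)).1 hJ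
  obtain ⟨M, ε, hε, h⟩ := X.exists_overlap_of_discrepancy hK ha hL hlyap (tsub_pos_of_lt hlt) hov
    hT.le J
  refine ⟨M + c, ε * 2⁻¹, ENNReal.mul_pos hε.ne' (by simp), fun t ht x y hx hy A hA => ?_⟩
  have hct : c ≤ t := le_add_self.trans ht
  -- Separate infima over hitting times and points let the two copies be treated independently, with
  -- no joint law.
  set b₁ := ⨅ p : {p : ℝ≥0 × E // p.1 ≤ c ∧ p.2 ∈ K}, X.trans (t - p.1.1) p.1.2 A
  set b₂ := ⨅ p : {p : ℝ≥0 × E // p.1 ≤ c ∧ p.2 ∈ K}, X.trans (t - p.1.1) p.1.2 Aᶜ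
  have hb : ε ≤ b₁ + b₂ := by
    refine ENNReal.le_iInf_add_iInf ?_
    rintro ⟨⟨u, k⟩, hu, hk⟩ ⟨⟨v, k'⟩, hv, hk'⟩
    have hM : ∀ w ≤ c, M ≤ t - w := fun w hw =>
      le_tsub_of_add_le_right (le_trans (by gcongr) ht)
    have hd : ∀ w ≤ c, ∀ w' ≤ c, t - w ≤ t - w' + J * (T₂ - T₁) := fun w hw w' hw' => by
      calc t - w ≤ t := tsub_le_self
        _ = t - w' + w' := (tsub_add_cancel_of_le (hw'.trans hct)).symm
        _ ≤ _ := by gcongr; exact hw'.trans hJc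
    exact h k hk k' hk' _ _ (hM u hu) (hM v hv) (hd u hu v hv) (hd v hv u hu) A hA
  calc ε * 2⁻¹ ≤ b₁ * 2⁻¹ + b₂ * 2⁻¹ := by rw [← add_mul]; gcongr
    _ ≤ _ := by
      refine add_le_add ?_ ?_
      · exact X.mul_le_trans_of_hitting hK ha hct hA (fun u hu k hk =>
          iInf_le (fun p : {p : ℝ≥0 × E // p.1 ≤ c ∧ p.2 ∈ K} => X.trans (t - p.1.1) p.1.2 A)
            ⟨(u, k), hu, hk⟩) (le_trans (by gcongr) hc)
      · exact X.mul_le_trans_of_hitting hK ha hct hA.compl (fun u hu k hk =>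
          iInf_le (fun p : {p : ℝ≥0 × E // p.1 ≤ c ∧ p.2 ∈ K} => X.trans (t - p.1.1) p.1.2 Aᶜ)
            ⟨(u, k), hu, hk⟩) (le_trans (by gcongr) hc)

/-- Outside some compact set the event `τ_K > c` has probability above `m`, which forces the
exponential moment to be at least `m exp(a c)`. For large `c` this exceeds `R`, so the sublevel set
lies in the compact set. -/
theorem exists_overlap_of_localDoeblin (hD : X.LocalDoeblin) {K : Set E} (hK : IsClosed K)
    {ℓ : ℝ≥0∞} (hℓ : 0 < ℓ)
    (hlim : Tendsto (fun c : ℝ≥0 => liminf (fun x => X.law x {ω | (c : ℝ≥0∞) < hit K ω})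
      (cocompact E)) atTop (𝓝 ℓ)) {a : ℝ} (ha : 0 < a) {R : ℝ≥0∞} (hR : R ≠ ∞) :
    ∃ T : ℝ≥0, ∃ ε : ℝ≥0∞, 0 < ε ∧ ∀ t, T ≤ t → ∀ x y, X.expHit K a x ≤ R → X.expHit K a y ≤ R →
      Overlap (X.trans t x) (X.trans t y) ε := by
  obtain ⟨m, hm, hml⟩ := exists_between hℓ
  have h1 : ∀ᶠ c : ℝ≥0 in atTop, m <
      liminf (fun x => X.law x {ω | (c : ℝ≥0∞) < hit K ω}) (cocompact E) :=
    hlim.eventually (lt_mem_nhds hml)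
  obtain ⟨c, hc1, hc2⟩ := (h1.and (eventually_exp_mul_lt ha hR hm)).exists
  have h3 := eventually_lt_of_lt_liminf hc1
  obtain ⟨A, hA, hAsub⟩ := mem_cocompact.1 h3
  obtain ⟨T, ε, hε, h⟩ := X.overlap_of_doeblinOn (hD A hA)
  have hsub : ∀ x, X.expHit K a x ≤ R → x ∈ A := by
    intro x hx
    by_contra hxA
    have h4 : m < X.law x {ω | (c : ℝ≥0∞) < hit K ω} := hAsub hxA
    have h5 := mul_meas_ge_le_lintegral₀ (μ := X.law x)
      ((measurable_expTime a).comp_aemeasurable (aemeasurable_hit hK (X.law x))) (expTime a c)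
    have h6 : expTime a c * m ≤ X.expHit K a x := by
      refine le_trans ?_ h5
      gcongr
      refine h4.le.trans (measure_mono fun ω hω => expTime_mono ha (le_of_lt hω))
    refine hc2.not_ge ?_
    calc m = ENNReal.ofReal (Real.exp (-a * c)) * (expTime a c * m) := by
          rw [← mul_assoc, expTime_coe, ← ENNReal.ofReal_mul (Real.exp_nonneg _), ← Real.exp_add]
          simp
      _ ≤ _ := by gcongr; exact h6.trans hx
  exact ⟨T, ε, hε, fun t ht x y hx hy => h t ht x (hsub x hx) y (hsub y hy)⟩

end SmallSets

end CadlagStrongMarkov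

/-! ### Harris' theorem through successive removal of common parts -/

section Harris

variable {E : Type*} [MeasurableSpace E]

/-- The uncoupled parts of two evolutions under `κ`: at each step the common part of the two
distributions is removed. -/
noncomputable def uncoupled (κ : Kernel E E) (μ ν : Measure E) : ℕ → Measure E × Measure E
  | 0 => (μ, ν)
  | n + 1 => ((uncoupled κ μ ν n).1.bind κ -
        (uncoupled κ μ ν n).1.bind κ ⊓ (uncoupled κ μ ν n).2.bind κ,
      (uncoupled κ μ ν n).2.bind κ -
        (uncoupled κ μ ν n).1.bind κ ⊓ (uncoupled κ μ ν n).2.bind κ)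

/-- The part of the two distributions that is coupled at step `n + 1`. -/
noncomputable def newlyCoupled (κ : Kernel E E) (μ ν : Measure E) (n : ℕ) : Measure E :=
  (uncoupled κ μ ν n).1.bind κ ⊓ (uncoupled κ μ ν n).2.bind κ

variable (κ : Kernel E E) [IsMarkovKernel κ] (μ ν : Measure E) [IsFiniteMeasure μ]
  [IsFiniteMeasure ν]

theorem isFiniteMeasure_uncoupled (n : ℕ) :
    IsFiniteMeasure (uncoupled κ μ ν n).1 ∧ IsFiniteMeasure (uncoupled κ μ ν n).2 := by
  induction n with
  | zero => exact ⟨‹_›, ‹_›⟩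
  | succ n ih =>
    have := ih.1
    have := ih.2
    exact ⟨isFiniteMeasure_of_le _ Measure.sub_le, isFiniteMeasure_of_le _ Measure.sub_le⟩

instance isFiniteMeasure_uncoupled_fst (n : ℕ) : IsFiniteMeasure (uncoupled κ μ ν n).1 :=
  (isFiniteMeasure_uncoupled κ μ ν n).1

instance isFiniteMeasure_uncoupled_snd (n : ℕ) : IsFiniteMeasure (uncoupled κ μ ν n).2 :=
  (isFiniteMeasure_uncoupled κ μ ν n).2

instance isFiniteMeasure_newlyCoupled (n : ℕ) : IsFiniteMeasure (newlyCoupled κ μ ν n) :=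
  isFiniteMeasure_of_le _ (inf_le_left : _ ≤ (uncoupled κ μ ν n).1.bind κ)

theorem newlyCoupled_le_fst (n : ℕ) : newlyCoupled κ μ ν n ≤ (uncoupled κ μ ν n).1.bind κ :=
  inf_le_left

theorem newlyCoupled_le_snd (n : ℕ) : newlyCoupled κ μ ν n ≤ (uncoupled κ μ ν n).2.bind κ :=
  inf_le_right

theorem uncoupled_succ_fst (n : ℕ) : (uncoupled κ μ ν (n + 1)).1 =
    (uncoupled κ μ ν n).1.bind κ - newlyCoupled κ μ ν n := rfl

theorem uncoupled_succ_snd (n : ℕ) : (uncoupled κ μ ν (n + 1)).2 =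
    (uncoupled κ μ ν n).2.bind κ - newlyCoupled κ μ ν n := rfl

theorem uncoupled_succ_fst_add (n : ℕ) : (uncoupled κ μ ν (n + 1)).1 + newlyCoupled κ μ ν n =
    (uncoupled κ μ ν n).1.bind κ := by
  rw [uncoupled_succ_fst]
  exact Measure.sub_add_cancel_of_le (newlyCoupled_le_fst κ μ ν n)

theorem uncoupled_succ_snd_add (n : ℕ) : (uncoupled κ μ ν (n + 1)).2 + newlyCoupled κ μ ν n =
    (uncoupled κ μ ν n).2.bind κ := by
  rw [uncoupled_succ_snd]
  exact Measure.sub_add_cancel_of_le (newlyCoupled_le_snd κ μ ν n)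

theorem bind_apply_univ (μ : Measure E) : μ.bind κ univ = μ univ := by
  rw [Measure.bind_apply MeasurableSet.univ κ.aemeasurable]
  simp

variable {μ ν} in
theorem uncoupled_univ_eq (h : μ univ = ν univ) (n : ℕ) :
    (uncoupled κ μ ν n).1 univ = (uncoupled κ μ ν n).2 univ := by
  induction n with
  | zero => exact h
  | succ n ih =>
    rw [uncoupled_succ_fst, uncoupled_succ_snd,
      Measure.sub_apply MeasurableSet.univ (newlyCoupled_le_fst κ μ ν n),
      Measure.sub_apply MeasurableSet.univ (newlyCoupled_le_snd κ μ ν n), bind_apply_univ,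
      bind_apply_univ, ih]

variable {κ} in
-- If `φ x` or `φ y` exceeds `R`, the penalty `ε / R * φ` alone is at least `ε`; otherwise the
-- overlap hypothesis applies. So the infima of the penalized functions add up to at least `ε`, and
-- each can be integrated on its own because the masses agree.
theorem overlap_bind_of_small {φ : E → ℝ≥0∞} (hφ : UnivMeasurable φ) {R ε : ℝ≥0∞}
    (hR0 : R ≠ 0) (hR : R ≠ ∞)
    (hov : ∀ x y, φ x ≤ R → φ y ≤ R → Overlap (κ x) (κ y) ε) (η η' : Measure E)
    [IsFiniteMeasure η] [IsFiniteMeasure η'] (h : η univ = η' univ) :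
    Overlap (η.bind κ) (η'.bind κ) (ε * η univ - ε / R * (∫⁻ x, φ x ∂η + ∫⁻ x, φ x ∂η')) := by
  intro A hA
  rw [tsub_le_iff_right, Measure.bind_apply hA κ.aemeasurable,
    Measure.bind_apply hA.compl κ.aemeasurable]
  set f : E → ℝ≥0∞ := fun x => κ x A + ε / R * φ x with hf
  set g : E → ℝ≥0∞ := fun x => κ x Aᶜ + ε / R * φ x with hg
  have hfar : ∀ x, R < φ x → ε ≤ ε / R * φ x := fun x hx => by
    calc ε = ε / R * R := (ENNReal.div_mul_cancel hR0 hR).symm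
      _ ≤ _ := by gcongr
  have hfg : ε ≤ (⨅ x, f x) + ⨅ y, g y := by
    refine ENNReal.le_iInf_add_iInf fun x y => ?_
    rcases lt_or_ge R (φ x) with hx | hx
    · exact (hfar x hx).trans (le_add_self.trans le_self_add)
    rcases lt_or_ge R (φ y) with hy | hy
    · exact (hfar y hy).trans (le_add_self.trans le_add_self)
    · exact (hov x y hx hy A hA).trans (add_le_add le_self_add le_self_add)
  have hfi : (⨅ x, f x) * η univ ≤ ∫⁻ x, f x ∂η := by
    rw [← lintegral_const]
    exact lintegral_mono fun x => iInf_le f x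
  have hgi : (⨅ x, g x) * η univ ≤ ∫⁻ x, g x ∂η' := by
    rw [h, ← lintegral_const]
    exact lintegral_mono fun x => iInf_le g x
  calc ε * η univ ≤ ((⨅ x, f x) + ⨅ y, g y) * η univ := by gcongr
    _ ≤ ∫⁻ x, f x ∂η + ∫⁻ x, g x ∂η' := by rw [add_mul]; exact add_le_add hfi hgi
    _ = _ := by
      rw [hf, hg, lintegral_add_left (κ.measurable_coe hA), lintegral_add_left
        (κ.measurable_coe hA.compl), lintegral_const_mul'' _ (hφ η inferInstance),
        lintegral_const_mul'' _ (hφ η' inferInstance)]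
      ring

/-- With `d = ε / (8 * C)` the weight of `V` is `3 * d`. The two bounds add up to `(1 - ε / 4) * m +
5 / 2 * d * V`, and `5 / 2 ≤ 3 * (1 - ε / 6)` because `ε ≤ 1`. -/
theorem contraction_step {m m' l V V' ε C : ℝ} (hm : 0 ≤ m) (hV : 0 ≤ V) (hε : 0 < ε)
    (hε1 : ε ≤ 1) (hC : 0 < C) (h1 : m' + l = m) (h2 : ε * m ≤ l + ε / (8 * C) * V)
    (h3 : V' ≤ V / 2 + 2 * C * m) :
    m' + 3 * ε / (8 * C) * V' ≤ (1 - ε / 6) * (m + 3 * ε / (8 * C) * V) := by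
  set d := ε / (8 * C) with hd
  have hd0 : 0 < d := by positivity
  have hdC : d * C = ε / 8 := by rw [hd]; field_simp
  have e : 3 * ε / (8 * C) = 3 * d := by rw [hd]; ring
  rw [e]
  have h4 : 3 * d * V' ≤ 3 * d * (V / 2 + 2 * C * m) := by gcongr
  have h5 : 3 * d * (V / 2 + 2 * C * m) = 3 / 2 * (d * V) + 3 * ε / 4 * m := by
    linear_combination 6 * m * hdC
  have h6 : 0 ≤ d * V := by positivity
  have h7 : 0 ≤ ε * m := by positivity
  have h8 : 0 ≤ (1 - ε) * (d * V) := mul_nonneg (by linarith) h6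
  nlinarith

variable {κ} in
/-- Harris' theorem: the uncoupled parts of two evolutions decay exponentially. -/
theorem exists_uncoupled_decay {φ : E → ℝ≥0∞} (hφ : UnivMeasurable φ) (hφ1 : ∀ x, 1 ≤ φ x)
    {C ε : ℝ} (hC : 0 < C) (hε : 0 < ε) (hε1 : ε ≤ 1)
    (hdrift : ∀ x, ∫⁻ y, φ y ∂κ x ≤ 2⁻¹ * φ x + ENNReal.ofReal C)
    (hov : ∀ x y, φ x ≤ ENNReal.ofReal (8 * C) → φ y ≤ ENNReal.ofReal (8 * C) →
      Overlap (κ x) (κ y) (ENNReal.ofReal ε)) :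
    ∃ D ρ : ℝ, 0 < D ∧ 0 < ρ ∧ ρ < 1 ∧ ∀ (μ ν : Measure E) [IsFiniteMeasure μ] [IsFiniteMeasure ν],
      μ univ = ν univ → ∫⁻ x, φ x ∂μ ≠ ∞ → ∫⁻ x, φ x ∂ν ≠ ∞ → ∀ n,
      ∫⁻ x, φ x ∂(uncoupled κ μ ν n).1 + ∫⁻ x, φ x ∂(uncoupled κ μ ν n).2 ≤
        ENNReal.ofReal (D * ρ ^ n) * (∫⁻ x, φ x ∂μ + ∫⁻ x, φ x ∂ν) := by
  set b : ℝ := 3 * ε / (8 * C) with hb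
  have hb0 : 0 < b := by positivity
  -- The factor `(1 + b) / b` converts from the contracting quantity back to integrals of `φ`; since
  -- `1 ≤ φ`, the initial mass is at most the initial integral.
  refine ⟨(1 + b) / b, 1 - ε / 6, by positivity, by linarith, by linarith, ?_⟩
  intro μ ν _ _ hμν hμ hν n
  set I : ℕ → ℝ≥0∞ := fun n => ∫⁻ x, φ x ∂(uncoupled κ μ ν n).1 with hI
  set I' : ℕ → ℝ≥0∞ := fun n => ∫⁻ x, φ x ∂(uncoupled κ μ ν n).2 with hI'
  set m : ℕ → ℝ≥0∞ := fun n => (uncoupled κ μ ν n).1 univ with hm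
  have hbind : ∀ (η : Measure E) [IsFiniteMeasure η],
      ∫⁻ x, φ x ∂(η.bind κ) ≤ 2⁻¹ * ∫⁻ x, φ x ∂η + ENNReal.ofReal C * η univ := by
    intro η _
    rw [Measure.lintegral_bind κ.aemeasurable (hφ _ inferInstance)]
    refine (lintegral_mono hdrift).trans (le_of_eq ?_)
    rw [lintegral_add_right _ measurable_const, lintegral_const_mul'' _ (hφ η inferInstance),
      lintegral_const]
  have hI1 : ∀ n, I (n + 1) ≤ 2⁻¹ * I n + ENNReal.ofReal C * m n := fun n =>
    (lintegral_mono' Measure.sub_le le_rfl).trans (hbind _)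
  have hI1' : ∀ n, I' (n + 1) ≤ 2⁻¹ * I' n + ENNReal.ofReal C * m n := fun n => by
    rw [hm]
    dsimp only
    rw [uncoupled_univ_eq κ hμν n]
    exact (lintegral_mono' Measure.sub_le le_rfl).trans (hbind _)
  have hmfin : ∀ n, m n ≠ ∞ := fun n => by simp only [hm]; finiteness
  have hIfin : ∀ n, I n ≠ ∞ ∧ I' n ≠ ∞ := by
    intro n
    induction n with
    | zero => exact ⟨hμ, hν⟩
    | succ n ih =>
      have h1 := ih.1
      have h2 := ih.2
      have h3 := hmfin n
      exact ⟨((hI1 n).trans_lt (by finiteness)).ne, ((hI1' n).trans_lt (by finiteness)).ne⟩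
  have hmI : m 0 ≤ I 0 := by
    simp only [hm, hI]
    rw [← lintegral_one]
    exact lintegral_mono hφ1
  have hstep : ∀ n, (m n).toReal + b * ((I n).toReal + (I' n).toReal) ≤
      (1 - ε / 6) ^ n * ((m 0).toReal + b * ((I 0).toReal + (I' 0).toReal)) := by
    intro n
    induction n with
    | zero => simp
    | succ n ih =>
      set l := (newlyCoupled κ μ ν n) univ with hl
      have h1 : m (n + 1) + l = m n := by
        have := congrArg (fun η : Measure E => η univ) (uncoupled_succ_fst_add κ μ ν n)
        simpa [bind_apply_univ] using this
      have hlfin : l ≠ ∞ := by rw [hl]; finiteness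
      have h2 : ENNReal.ofReal ε * m n ≤ l +
          ENNReal.ofReal ε / ENNReal.ofReal (8 * C) * (I n + I' n) := by
        have := (overlap_bind_of_small (κ := κ) hφ (R := ENNReal.ofReal (8 * C))
          (ε := ENNReal.ofReal ε) (by simpa using hC) ENNReal.ofReal_ne_top hov
          (uncoupled κ μ ν n).1 (uncoupled κ μ ν n).2 (uncoupled_univ_eq κ hμν n)).le_inf
        rwa [tsub_le_iff_right] at this
      have h3 : I (n + 1) + I' (n + 1) ≤ 2⁻¹ * (I n + I' n) + 2 * (ENNReal.ofReal C * m n) := by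
        refine (add_le_add (hI1 n) (hI1' n)).trans (le_of_eq ?_)
        ring
      have f1 := (hIfin n).1
      have f2 := (hIfin n).2
      have f3 := (hIfin (n + 1)).1
      have f4 := (hIfin (n + 1)).2
      have f5 := hmfin n
      have f6 := hmfin (n + 1)
      have r1 : (m (n + 1)).toReal + l.toReal = (m n).toReal := by
        rw [← ENNReal.toReal_add f6 hlfin, h1]
      have r2 : ε * (m n).toReal ≤ l.toReal + ε / (8 * C) * ((I n).toReal + (I' n).toReal) := by
        rw [← ENNReal.ofReal_div_of_pos (by positivity)] at h2
        have := ENNReal.toReal_mono (by finiteness) h2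
        rwa [ENNReal.toReal_mul, ENNReal.toReal_add hlfin (by finiteness), ENNReal.toReal_mul,
          ENNReal.toReal_ofReal hε.le, ENNReal.toReal_ofReal (by positivity),
          ENNReal.toReal_add f1 f2] at this
      have r3 : (I (n + 1)).toReal + (I' (n + 1)).toReal ≤
          ((I n).toReal + (I' n).toReal) / 2 + 2 * C * (m n).toReal := by
        have := ENNReal.toReal_mono (by finiteness) h3
        rw [ENNReal.toReal_add f3 f4, ENNReal.toReal_add (by finiteness) (by finiteness),
          ENNReal.toReal_mul, ENNReal.toReal_mul, ENNReal.toReal_mul,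
          ENNReal.toReal_ofReal hC.le, ENNReal.toReal_add f1 f2] at this
        simp only [ENNReal.toReal_inv, ENNReal.toReal_ofNat] at this
        linarith
      have := contraction_step ENNReal.toReal_nonneg (by positivity) hε hε1 hC r1 r2 r3
      refine this.trans ?_
      rw [pow_succ', mul_assoc]
      gcongr
      linarith
  have f1 := (hIfin n).1
  have f2 := (hIfin n).2
  have hfinal : (I n).toReal + (I' n).toReal ≤
      (1 + b) / b * (1 - ε / 6) ^ n * ((I 0).toReal + (I' 0).toReal) := by
    have h1 := hstep n
    have h2 : (m 0).toReal ≤ (I 0).toReal := ENNReal.toReal_mono hμ hmI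
    have h3 : (0 : ℝ) ≤ (I' 0).toReal := ENNReal.toReal_nonneg
    have h4 : (0 : ℝ) ≤ (m n).toReal := ENNReal.toReal_nonneg
    have h5 : (0 : ℝ) ≤ (1 - ε / 6) ^ n := pow_nonneg (by linarith) n
    have h6 : b * ((I n).toReal + (I' n).toReal) ≤
        (1 - ε / 6) ^ n * ((1 + b) * ((I 0).toReal + (I' 0).toReal)) := by
      refine le_trans (le_trans (by linarith) h1) ?_
      gcongr
      linarith
    rw [div_mul_eq_mul_div, div_mul_eq_mul_div, le_div_iff₀ hb0]
    linarith
  change I n + I' n ≤ _ * (I 0 + I' 0)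
  rw [← ENNReal.toReal_le_toReal (by finiteness) (ENNReal.mul_ne_top ENNReal.ofReal_ne_top
      (ENNReal.add_ne_top.2 (hIfin 0))), ENNReal.toReal_mul, ENNReal.toReal_add f1 f2,
      ENNReal.toReal_add (hIfin 0).1 (hIfin 0).2, ENNReal.toReal_ofReal]
  · exact hfinal
  · have : (0 : ℝ) ≤ 1 - ε / 6 := by linarith
    positivity

/-- The part of the two distributions at step `n` that has been coupled. -/
noncomputable def coupledPart : ℕ → Measure E
  | 0 => 0
  | n + 1 => (coupledPart n).bind κ + newlyCoupled κ μ ν n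

theorem bind_add_measure (η η' : Measure E) : (η + η').bind κ = η.bind κ + η'.bind κ :=
  Measure.comp_add

theorem uncoupled_fst_add_coupledPart_bind (n : ℕ) :
    ((uncoupled κ μ ν n).1 + coupledPart κ μ ν n).bind κ =
      (uncoupled κ μ ν (n + 1)).1 + coupledPart κ μ ν (n + 1) := by
  rw [bind_add_measure, ← uncoupled_succ_fst_add, coupledPart]
  abel

theorem uncoupled_snd_add_coupledPart_bind (n : ℕ) :
    ((uncoupled κ μ ν n).2 + coupledPart κ μ ν n).bind κ =
      (uncoupled κ μ ν (n + 1)).2 + coupledPart κ μ ν (n + 1) := by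
  rw [bind_add_measure, ← uncoupled_succ_snd_add, coupledPart]
  abel

theorem isFiniteMeasure_sum {μ : ℕ → Measure E} (h : ∑' n, μ n univ ≠ ∞) :
    IsFiniteMeasure (Measure.sum μ) :=
  ⟨by rw [Measure.sum_apply _ MeasurableSet.univ]; exact h.lt_top⟩

theorem tsum_geometric_mul_ne_top {D ρ : ℝ} (hD : 0 < D) (hρ : 0 < ρ) (hρ1 : ρ < 1) {M : ℝ≥0∞}
    (hM : M ≠ ∞) : ∑' n : ℕ, ENNReal.ofReal (D * ρ ^ n) * M ≠ ∞ := by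
  rw [ENNReal.tsum_mul_right]
  refine ENNReal.mul_ne_top ?_ hM
  rw [← ENNReal.ofReal_tsum_of_nonneg (fun n => by positivity)
    ((summable_geometric_of_lt_one hρ.le hρ1).mul_left D)]
  exact ENNReal.ofReal_ne_top

variable {κ} in
-- Start the two evolutions at `δ` and `δ κ`. The uncoupled parts `η n` and `η' n` differ exactly by
-- `δ κ^(n+1) - δ κ^n`, so `δ + ∑ η' - ∑ η` is the limit of `δ κ^n`. Both series converge by the
-- decay, and no completeness of a space of measures is needed.
theorem exists_invariant_of_decay [Nonempty E] [MeasurableSingletonClass E] {φ : E → ℝ≥0∞}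
    (hφ1 : ∀ x, 1 ≤ φ x) (hφtop : ∀ x, φ x ≠ ∞)
    (hκφ : ∀ x, ∫⁻ y, φ y ∂κ x ≠ ∞) {D ρ : ℝ} (hD : 0 < D) (hρ : 0 < ρ) (hρ1 : ρ < 1)
    (hdec : ∀ (μ ν : Measure E) [IsFiniteMeasure μ] [IsFiniteMeasure ν],
      μ univ = ν univ → ∫⁻ x, φ x ∂μ ≠ ∞ → ∫⁻ x, φ x ∂ν ≠ ∞ → ∀ n,
      ∫⁻ x, φ x ∂(uncoupled κ μ ν n).1 + ∫⁻ x, φ x ∂(uncoupled κ μ ν n).2 ≤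
        ENNReal.ofReal (D * ρ ^ n) * (∫⁻ x, φ x ∂μ + ∫⁻ x, φ x ∂ν)) :
    ∃ π : Measure E, IsProbabilityMeasure π ∧ π.bind κ = π ∧ ∫⁻ x, φ x ∂π ≠ ∞ := by
  obtain ⟨x₀⟩ := ‹Nonempty E›
  set δ := Measure.dirac x₀ with hδ
  have hδκ : δ.bind κ = κ x₀ := Measure.dirac_bind κ.measurable x₀
  have hδφ : ∫⁻ x, φ x ∂δ ≠ ∞ := by
    rw [lintegral_dirac]
    exact hφtop x₀
  set M := ∫⁻ x, φ x ∂δ + ∫⁻ x, φ x ∂κ x₀ with hM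
  have hMtop : M ≠ ∞ := ENNReal.add_ne_top.2 ⟨hδφ, hκφ x₀⟩
  have hd := hdec δ (κ x₀) (by simp) hδφ (hκφ x₀)
  set η : ℕ → Measure E := fun n => (uncoupled κ δ (κ x₀) n).1 with hη
  set η' : ℕ → Measure E := fun n => (uncoupled κ δ (κ x₀) n).2 with hη'
  set lam : ℕ → Measure E := fun n => newlyCoupled κ δ (κ x₀) n with hlam
  have hsum : ∑' n, (∫⁻ x, φ x ∂η n + ∫⁻ x, φ x ∂η' n) ≠ ∞ :=
    ne_top_of_le_ne_top (tsum_geometric_mul_ne_top hD hρ hρ1 hMtop) (ENNReal.tsum_le_tsum hd)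
  rw [ENNReal.tsum_add, ENNReal.add_ne_top] at hsum
  have hle : ∀ ξ : Measure E, ξ univ ≤ ∫⁻ x, φ x ∂ξ := fun ξ => by
    rw [← lintegral_one]
    exact lintegral_mono hφ1
  have hηf : ∑' n, η n univ ≠ ∞ :=
    ne_top_of_le_ne_top hsum.1 (ENNReal.tsum_le_tsum fun n => hle _)
  have := isFiniteMeasure_sum hηf
  have := isFiniteMeasure_sum (μ := η')
    (ne_top_of_le_ne_top hsum.2 (ENNReal.tsum_le_tsum fun n => hle _))
  have := isFiniteMeasure_sum (μ := lam) (ne_top_of_le_ne_top hηf (ENNReal.tsum_le_tsum fun n => by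
    rw [← bind_apply_univ κ (η n)]
    exact newlyCoupled_le_fst κ δ (κ x₀) n univ))
  -- Both sides are `δ κ^(n+1)`, read from the second and from the first evolution.
  have hchain : ∀ n, η' n + coupledPart κ δ (κ x₀) n = η (n + 1) + coupledPart κ δ (κ x₀) (n + 1) := by
    intro n
    induction n with
    | zero =>
      rw [hη, ← uncoupled_fst_add_coupledPart_bind]
      simp [hη', uncoupled, coupledPart, hδκ]
    | succ n ih =>
      rw [hη', hη, ← uncoupled_fst_add_coupledPart_bind, ← uncoupled_snd_add_coupledPart_bind, ← ih]
  have hpart : ∀ n, δ + ∑ i ∈ Finset.range n, η' i =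
      (η n + coupledPart κ δ (κ x₀) n) + ∑ i ∈ Finset.range n, η i := by
    intro n
    induction n with
    | zero => simp [hη, uncoupled, coupledPart]
    | succ n ih =>
      rw [Finset.sum_range_succ, ← add_assoc, ih, Finset.sum_range_succ, ← hchain n]
      abel
  have hsub : Measure.sum η ≤ δ + Measure.sum η' := by
    refine Measure.le_iff.2 fun A hA => ?_
    rw [Measure.sum_apply _ hA, Measure.add_apply, Measure.sum_apply _ hA]
    refine ENNReal.tsum_le_of_sum_range_le fun n => ?_
    have h1 := congrArg (fun ξ : Measure E => ξ A) (hpart n)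
    simp only [Measure.add_apply, Measure.finsetSum_apply] at h1
    calc ∑ i ∈ Finset.range n, η i A ≤ δ A + ∑ i ∈ Finset.range n, η' i A := by
          rw [h1]; exact le_add_self
      _ ≤ _ := by gcongr; exact ENNReal.sum_le_tsum _
  set π := δ + Measure.sum η' - Measure.sum η with hπ
  have hπadd : π + Measure.sum η = δ + Measure.sum η' := Measure.sub_add_cancel_of_le hsub
  have hπle : π ≤ δ + Measure.sum η' := Measure.sub_le
  have hπfin : IsFiniteMeasure π := isFiniteMeasure_of_le _ hπle
  refine ⟨π, ⟨?_⟩, ?_, ?_⟩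
  · have h1 := congrArg (fun ξ : Measure E => ξ univ) hπadd
    simp only [Measure.add_apply, Measure.sum_apply _ MeasurableSet.univ] at h1
    have h2 : ∀ n, η n univ = η' n univ := uncoupled_univ_eq κ (by simp)
    simp_rw [← h2] at h1
    rw [ENNReal.add_left_inj hηf] at h1
    simpa using h1
  · have hb : ∀ ξ : ℕ → Measure E, (Measure.sum ξ).bind κ = Measure.sum fun n => (ξ n).bind κ :=
      fun ξ => Measure.bind_sum _ _ κ.aemeasurable
    have e1 : (Measure.sum η).bind κ = Measure.sum (fun n => η (n + 1)) + Measure.sum lam := by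
      rw [hb, Measure.sum_add_sum]
      congr 1
      ext1 n
      exact (uncoupled_succ_fst_add κ δ (κ x₀) n).symm
    have e2 : (Measure.sum η').bind κ = Measure.sum (fun n => η' (n + 1)) + Measure.sum lam := by
      rw [hb, Measure.sum_add_sum]
      congr 1
      ext1 n
      exact (uncoupled_succ_snd_add κ δ (κ x₀) n).symm
    have e3 : ∀ ξ : ℕ → Measure E, Measure.sum ξ = ξ 0 + Measure.sum fun n => ξ (n + 1) := by
      intro ξ
      ext A hA
      rw [Measure.sum_apply _ hA, Measure.add_apply, Measure.sum_apply _ hA]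
      exact tsum_eq_zero_add' ENNReal.summable
    have h1 := congrArg (fun ξ : Measure E => ξ.bind κ) hπadd
    simp only [bind_add_measure, e1, e2, hδκ] at h1
    -- Applying `κ` shifts both series by one and adds to both the same newly coupled mass, which is
    -- finite and cancels.
    have h2 : π.bind κ + (Measure.sum η + Measure.sum lam) =
        π + (Measure.sum η + Measure.sum lam) := by
      calc π.bind κ + (Measure.sum η + Measure.sum lam)
          = δ + (π.bind κ + (Measure.sum (fun n => η (n + 1)) + Measure.sum lam)) := by
            rw [e3 η]
            change _ + (δ + _ + _) = _
            abel
        _ = δ + Measure.sum η' + Measure.sum lam := by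
            rw [h1, e3 η']
            change _ = δ + (κ x₀ + _) + _
            abel
        _ = _ := by rw [← hπadd, add_assoc]
    ext A hA
    have h3 := congrArg (fun ξ : Measure E => ξ A) h2
    simp only [Measure.add_apply] at h3
    exact (ENNReal.add_left_inj (by finiteness)).1 h3
  · refine ne_top_of_le_ne_top ?_ (lintegral_mono' hπle le_rfl)
    rw [lintegral_add_measure, lintegral_sum_measure]
    exact ENNReal.add_ne_top.2 ⟨hδφ, hsum.2⟩

variable {κ} in
-- By invariance each measure is, at every step, its uncoupled part plus the common coupled part.
-- The uncoupled part of `μ` vanishes in the limit, so `μ ≤ ν`, and equal masses give equality.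
theorem eq_of_invariant_of_decay {φ : E → ℝ≥0∞}
    (hφ1 : ∀ x, 1 ≤ φ x) {D ρ : ℝ} (hD : 0 < D) (hρ : 0 < ρ) (hρ1 : ρ < 1)
    (hdec : ∀ (μ ν : Measure E) [IsFiniteMeasure μ] [IsFiniteMeasure ν],
      μ univ = ν univ → ∫⁻ x, φ x ∂μ ≠ ∞ → ∫⁻ x, φ x ∂ν ≠ ∞ → ∀ n,
      ∫⁻ x, φ x ∂(uncoupled κ μ ν n).1 + ∫⁻ x, φ x ∂(uncoupled κ μ ν n).2 ≤
        ENNReal.ofReal (D * ρ ^ n) * (∫⁻ x, φ x ∂μ + ∫⁻ x, φ x ∂ν))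
    {μ ν : Measure E} [IsFiniteMeasure μ] [IsFiniteMeasure ν] (huniv : μ univ = ν univ)
    (hμφ : ∫⁻ x, φ x ∂μ ≠ ∞) (hνφ : ∫⁻ x, φ x ∂ν ≠ ∞) (hμ : μ.bind κ = μ) (hν : ν.bind κ = ν) :
    μ = ν := by
  have h1 : ∀ n, μ = (uncoupled κ μ ν n).1 + coupledPart κ μ ν n := by
    intro n
    induction n with
    | zero => simp [uncoupled, coupledPart]
    | succ n ih => rw [← uncoupled_fst_add_coupledPart_bind, ← ih, hμ]
  have h2 : ∀ n, ν = (uncoupled κ μ ν n).2 + coupledPart κ μ ν n := by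
    intro n
    induction n with
    | zero => simp [uncoupled, coupledPart]
    | succ n ih => rw [← uncoupled_snd_add_coupledPart_bind, ← ih, hν]
  have hlim : Tendsto (fun n => ∫⁻ x, φ x ∂(uncoupled κ μ ν n).1) atTop (𝓝 0) := by
    refine tendsto_of_tendsto_of_tendsto_of_le_of_le tendsto_const_nhds
      (ENNReal.tendsto_atTop_zero_of_tsum_ne_top (tsum_geometric_mul_ne_top hD hρ hρ1
        (ENNReal.add_ne_top.2 ⟨hμφ, hνφ⟩))) (fun _ => zero_le)
      fun n => le_self_add.trans (hdec μ ν huniv hμφ hνφ n)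
  refine Measure.eq_of_le_of_measure_univ_eq (Measure.le_iff.2 fun A hA => ?_) huniv
  have h3 : Tendsto (fun n => ∫⁻ x, φ x ∂(uncoupled κ μ ν n).1 + ν A) atTop (𝓝 (0 + ν A)) :=
    hlim.add tendsto_const_nhds
  rw [zero_add] at h3
  refine ge_of_tendsto' h3 fun n => ?_
  calc μ A = (uncoupled κ μ ν n).1 A + coupledPart κ μ ν n A := by
        conv_lhs => rw [h1 n]
        rfl
    _ ≤ ∫⁻ x, φ x ∂(uncoupled κ μ ν n).1 + ν A := by
        refine add_le_add ?_ ?_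
        · refine (measure_mono (subset_univ A)).trans ?_
          rw [← lintegral_one]
          exact lintegral_mono hφ1
        · conv_rhs => rw [h2 n]
          exact le_add_self

end Harris

/-! ### Path space over a Polish space is standard Borel -/

/-- A locally compact separable metric space is Polish. -/
theorem polishSpace_of_locallyCompactSpace (E : Type*) [MetricSpace E] [LocallyCompactSpace E]
    [TopologicalSpace.SeparableSpace E] : PolishSpace E := by
  set c : E → UniformSpace.Completion E := (↑) with hc
  have hemb : IsEmbedding c := UniformSpace.Completion.isUniformEmbedding_coe E |>.isEmbedding
  -- Near `c x` the completion lies in the closure of the image of a compact neighbourhood, and that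
  -- image is already closed.
  have hopen : IsOpen (range c) := by
    rw [isOpen_iff_mem_nhds]
    rintro _ ⟨x, rfl⟩
    obtain ⟨K, hK, hxK⟩ := exists_compact_mem_nhds x
    have hcK : IsClosed (c '' K) := (hK.image hemb.continuous).isClosed
    obtain ⟨V, hVo, hV⟩ := hemb.isOpen_iff.1 (isOpen_interior (s := K))
    have hxV : c x ∈ V := by
      have : x ∈ c ⁻¹' V := hV ▸ mem_interior_iff_mem_nhds.2 hxK
      exact this
    refine mem_of_superset (hVo.mem_nhds hxV) ?_
    calc V ⊆ closure (V ∩ range c) :=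
          (UniformSpace.Completion.denseRange_coe).open_subset_closure_inter hVo
      _ ⊆ closure (c '' K) := by
          refine closure_mono ?_
          rintro _ ⟨hy, y, rfl⟩
          exact mem_image_of_mem c (interior_subset (show y ∈ interior K from hV ▸ hy))
      _ = c '' K := hcK.closure_eq
      _ ⊆ range c := image_subset_range _ _
  have : PolishSpace (range c) := hopen.polishSpace
  exact (hemb.toHomeomorph).isClosedEmbedding.polishSpace

theorem StandardBorelSpace.of_measurableEquiv {α β : Type*} [MeasurableSpace α] [MeasurableSpace β]
    [hβ : StandardBorelSpace β] (e : α ≃ᵐ β) : StandardBorelSpace α := by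
  obtain ⟨τ, hb, hp⟩ := hβ.polish
  refine ⟨⟨τ.induced e, @BorelSpace.mk _ (τ.induced e) _ ?_,
    @Equiv.polishSpace_induced _ _ τ hp e.toEquiv⟩⟩
  rw [borel_comap, ← hb.measurable_eq]
  exact e.measurableEmbedding.comap_eq.symm

namespace CadlagPath

section Oscillation

variable {E : Type*} [MetricSpace E]

/-- `f` has `m` consecutive oscillations of size more than `ε` on rational points of `[a, b]`. -/
def Osc (f : ℚ≥0 → E) (ε : ℝ) : ℕ → ℝ≥0 → ℝ≥0 → Prop
  | 0, _, _ => True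
  | m + 1, a, b => ∃ p q : ℚ≥0, a ≤ p ∧ p < q ∧ (q : ℝ≥0) ≤ b ∧ ε < dist (f p) (f q) ∧
      Osc f ε m q b

variable {f : ℚ≥0 → E} {ε : ℝ}

theorem Osc.mono {m : ℕ} {a a' b b' : ℝ≥0} (h : Osc f ε m a b) (ha : a' ≤ a) (hb : b ≤ b') :
    Osc f ε m a' b' := by
  induction m generalizing a a' with
  | zero => trivial
  | succ m ih =>
    obtain ⟨p, q, h1, h2, h3, h4, h5⟩ := h
    exact ⟨p, q, ha.trans h1, h2, h3.trans hb, h4, ih h5 le_rfl⟩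

/-- At most one oscillation straddles `c`, which accounts for the extra one. -/
theorem Osc.split {m n : ℕ} {a b : ℝ≥0} (c : ℝ≥0) (h : Osc f ε (m + n + 1) a b) :
    Osc f ε m a c ∨ Osc f ε n c b := by
  induction m generalizing a with
  | zero => exact Or.inl trivial
  | succ m ih =>
    rw [show m + 1 + n + 1 = (m + n + 1) + 1 by ring] at h
    obtain ⟨p, q, h1, h2, h3, h4, h5⟩ := h
    rcases le_or_gt (q : ℝ≥0) c with hq | hq
    · exact (ih h5).imp (fun h6 => ⟨p, q, h1, h2, hq, h4, h6⟩) id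
    · right
      have : ∀ k, Osc f ε (k + n) q b → Osc f ε n q b := by
        intro k
        have : ∀ (j : ℕ) (r : ℝ≥0), Osc f ε (j + 1) r b → Osc f ε j r b := by
          intro j
          induction j with
          | zero => exact fun _ _ => trivial
          | succ j ihj =>
            rintro r ⟨p, q, g1, g2, g3, g4, g5⟩
            exact ⟨p, q, g1, g2, g3, g4, ihj _ g5⟩
        induction k with
        | zero => intro h; rwa [zero_add] at h
        | succ k ihk =>
          intro h
          refine ihk (this _ _ ?_)
          rwa [show k + n + 1 = k + 1 + n by ring]
      refine (this (m + 1) ?_).mono hq.le le_rfl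
      rwa [show m + 1 + n = m + n + 1 by ring]

theorem not_osc_add {m n : ℕ} {a b c : ℝ≥0} (h : ¬Osc f ε m a c) (h' : ¬Osc f ε n c b) :
    ¬Osc f ε (m + n + 1) a b := fun h2 => (h2.split c).elim h h'

/-- The restrictions to the rational times of the càdlàg paths. -/
def IsCadlagRat (f : ℚ≥0 → E) : Prop :=
  (∀ k N : ℕ, ∃ m, ¬Osc f (1 / (k + 1)) m 0 N) ∧
  ∀ (k : ℕ) (r : ℚ≥0), ∃ s, r < s ∧ ∀ q, r ≤ q → q < s → dist (f q) (f r) < 1 / (k + 1)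

/-- A supremum argument over the right ends `b` for which the oscillations on `[0, b]` are bounded
in number: the left limit shows that the supremum belongs to the set, and right-continuity then
pushes past it. -/
theorem exists_not_osc (ω : CadlagPath E) (hε : 0 < ε) (N : ℝ≥0) :
    ∃ m, ¬Osc (fun q : ℚ≥0 => ω q) ε m 0 N := by
  set S : Set ℝ≥0 := {b | ∃ m, ¬Osc (fun q : ℚ≥0 => ω q) ε m 0 b} with hS
  have hlow : ∀ b ∈ S, ∀ b' ≤ b, b' ∈ S := fun b ⟨m, hm⟩ b' hb => ⟨m, fun h => hm (h.mono le_rfl hb)⟩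
  have h0 : (0 : ℝ≥0) ∈ S := by
    refine ⟨1, ?_⟩
    rintro ⟨p, q, -, h2, h3, -, -⟩
    have : q = 0 := nonpos_iff_eq_zero.1 (by exact_mod_cast h3)
    simp [this] at h2
  change N ∈ S
  by_contra hN
  have hbdd : BddAbove S := ⟨N, fun b hb => le_of_not_ge fun h => hN (hlow b hb N h)⟩
  set t := sSup S with ht
  have hts : t ∈ S := by
    rcases eq_or_ne t 0 with h | h
    · rwa [h]
    · obtain ⟨l, hl⟩ := ω.leftLim t
      have h1 : ∀ᶠ s in 𝓝[<] t, dist (ω s) l < ε / 2 :=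
        hl.eventually (Metric.ball_mem_nhds l (half_pos hε))
      obtain ⟨a, ha, h2⟩ := (mem_nhdsLT_iff_exists_Ioo_subset' (pos_iff_ne_zero.2 h)).1 h1
      obtain ⟨c, hac, hct⟩ := exists_between (mem_Iio.1 ha)
      obtain ⟨d, hdS, hcd⟩ := exists_lt_of_lt_csSup ⟨0, h0⟩ hct
      obtain ⟨m, hm⟩ := hlow d hdS c hcd.le
      -- Two oscillations are excluded rather than one: a single one could end at `t` itself, where
      -- the path may jump, while the first of two ends strictly before `t`.
      refine ⟨m + 2 + 1, not_osc_add hm ?_⟩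
      rintro ⟨p, q, h3, h4, -, h6, p', q', h7, h8, h9, -⟩
      have hpq : (p : ℝ≥0) < q := by exact_mod_cast h4
      have hqt : (q : ℝ≥0) < t := lt_of_le_of_lt h7 (lt_of_lt_of_le (by exact_mod_cast h8) h9)
      have h10 : dist (ω p) l < ε / 2 := h2 ⟨hac.trans_le h3, hpq.trans hqt⟩
      have h11 : dist (ω q) l < ε / 2 := h2 ⟨hac.trans_le (h3.trans hpq.le), hqt⟩
      exact h6.not_ge ((dist_triangle_right _ _ l).trans (by linarith))
  have h1 : ∀ᶠ s in 𝓝[≥] t, dist (ω s) (ω t) < ε / 2 :=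
    (ω.rightCts t).eventually (Metric.ball_mem_nhds _ (half_pos hε))
  obtain ⟨b, hb, h2⟩ := mem_nhdsGE_iff_exists_Ico_subset.1 h1
  obtain ⟨b', hb', hbb⟩ := exists_between (mem_Ioi.1 hb)
  obtain ⟨m, hm⟩ := hts
  have hbS : b' ∈ S := by
    refine ⟨m + 1 + 1, not_osc_add hm ?_⟩
    rintro ⟨p, q, h3, h4, h5, h6, -⟩
    have hpq : (p : ℝ≥0) < q := by exact_mod_cast h4
    have h10 : dist (ω p) (ω t) < ε / 2 := h2 ⟨h3, hpq.trans_le (h5.trans hbb.le)⟩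
    have h11 : dist (ω q) (ω t) < ε / 2 := h2 ⟨h3.trans hpq.le, h5.trans_lt hbb⟩
    exact h6.not_ge ((dist_triangle_right _ _ (ω t)).trans (by linarith))
  exact (le_csSup hbdd hbS).not_gt hb'

theorem exists_nnrat_btwn {a b : ℝ≥0} (h : a < b) : ∃ q : ℚ≥0, a < q ∧ (q : ℝ≥0) < b := by
  obtain ⟨q, h1, h2⟩ := exists_rat_btwn (NNReal.coe_lt_coe.2 h)
  have hq : 0 ≤ q := by exact_mod_cast (a.2.trans h1.le)
  lift q to ℚ≥0 using hq
  exact ⟨q, by exact_mod_cast h1, by exact_mod_cast h2⟩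

theorem isCadlagRat_restrict (ω : CadlagPath E) : IsCadlagRat fun q : ℚ≥0 => ω q := by
  refine ⟨fun k N => exists_not_osc ω (by positivity) N, fun k r => ?_⟩
  have h1 : ∀ᶠ s in 𝓝[≥] (r : ℝ≥0), dist (ω s) (ω r) < 1 / (k + 1) :=
    (ω.rightCts r).eventually (Metric.ball_mem_nhds _ (by positivity))
  obtain ⟨b, hb, h2⟩ := mem_nhdsGE_iff_exists_Ico_subset.1 h1
  obtain ⟨s, hs, hsb⟩ := exists_nnrat_btwn (mem_Ioi.1 hb)
  refine ⟨s, by exact_mod_cast hs, fun q hq hqs => h2 ⟨by exact_mod_cast hq, lt_trans ?_ hsb⟩⟩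
  exact_mod_cast hqs

/-- Otherwise pairs of rationals with oscillation above `ε` exist arbitrarily close to `t`. Choosing
each new pair between `t` and the previous one gives any number of oscillations on `[0, N]`. -/
theorem IsCadlagRat.right (h : IsCadlagRat f) (t : ℝ≥0) (hε : 0 < ε) :
    ∃ b, t < b ∧ ∀ p q : ℚ≥0, t < p → t < q → p < b → q < b → dist (f p) (f q) ≤ ε := by
  obtain ⟨k, hk⟩ := exists_nat_one_div_lt hε
  obtain ⟨N, hN⟩ := exists_nat_gt t
  obtain ⟨m, hm⟩ := h.1 k N
  by_contra! hcon
  have hcon' : ∀ b, t < b → ∃ p q : ℚ≥0, t < p ∧ p < q ∧ q < b ∧ ε < dist (f p) (f q) := by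
    intro b hb
    obtain ⟨p, q, h1, h2, h3, h4, h5⟩ := hcon b hb
    rcases lt_trichotomy p q with h6 | h6 | h6
    · exact ⟨p, q, h1, h6, h4, h5⟩
    · rw [h6, dist_self] at h5
      linarith
    · exact ⟨q, p, h2, h6, h3, by rwa [dist_comm]⟩
  have key : ∀ m, ∃ a, t < a ∧ a ≤ N ∧ Osc f (1 / (k + 1)) m a N := by
    intro m
    induction m with
    | zero => exact ⟨N, hN, le_rfl, trivial⟩
    | succ m ih =>
      obtain ⟨a, h1, h2, h3⟩ := ih
      obtain ⟨p, q, h4, h5, h6, h7⟩ := hcon' a h1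
      have hpq : (p : ℝ≥0) < q := by exact_mod_cast h5
      exact ⟨p, h4, (hpq.trans h6).le.trans h2, p, q, le_rfl, h5, h6.le.trans h2, hk.trans h7,
        h3.mono h6.le le_rfl⟩
  obtain ⟨a, -, -, h3⟩ := key m
  exact hm (h3.mono zero_le le_rfl)

theorem IsCadlagRat.left (h : IsCadlagRat f) {t : ℝ≥0} (ht : 0 < t) (hε : 0 < ε) :
    ∃ a, a < t ∧ ∀ p q : ℚ≥0, a < p → a < q → p < t → q < t → dist (f p) (f q) ≤ ε := by
  obtain ⟨k, hk⟩ := exists_nat_one_div_lt hε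
  obtain ⟨N, hN⟩ := exists_nat_gt t
  obtain ⟨m, hm⟩ := h.1 k N
  by_contra! hcon
  have hcon' : ∀ a, a < t → ∃ p q : ℚ≥0, a < p ∧ p < q ∧ q < t ∧ ε < dist (f p) (f q) := by
    intro a ha
    obtain ⟨p, q, h1, h2, h3, h4, h5⟩ := hcon a ha
    rcases lt_trichotomy p q with h6 | h6 | h6
    · exact ⟨p, q, h1, h6, h4, h5⟩
    · rw [h6, dist_self] at h5
      linarith
    · exact ⟨q, p, h2, h6, h3, by rwa [dist_comm]⟩
  have key : ∀ m, ∀ a, a < t → Osc f (1 / (k + 1)) m a N := by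
    intro m
    induction m with
    | zero => exact fun _ _ => trivial
    | succ m ih =>
      intro a ha
      obtain ⟨p, q, h4, h5, h6, h7⟩ := hcon' a ha
      exact ⟨p, q, h4.le, h5, (h6.trans hN).le, hk.trans h7, ih q h6⟩
  exact hm (key m 0 ht)

/-- A sequence of rationals decreasing to `t` from the right. -/
theorem exists_seq_nnrat_right (t : ℝ≥0) : ∃ r : ℕ → ℚ≥0, (∀ n, t < r n) ∧
    Tendsto (fun n => (r n : ℝ≥0)) atTop (𝓝 t) := by
  choose r hr hr' using fun n => exists_nnrat_btwn (lt_gridUp n t)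
  exact ⟨r, hr, tendsto_of_tendsto_of_tendsto_of_le_of_le tendsto_const_nhds (tendsto_gridUp t)
    (fun n => (hr n).le) fun n => (hr' n).le⟩

variable [CompleteSpace E]

theorem IsCadlagRat.exists_limit (h : IsCadlagRat f) (t : ℝ≥0) :
    ∃ y, ∀ ε > 0, ∃ b, t < b ∧ ∀ p : ℚ≥0, t < p → p < b → dist (f p) y ≤ ε := by
  obtain ⟨r, hr, hrt⟩ := exists_seq_nnrat_right t
  have hc : CauchySeq fun n => f (r n) := by
    refine Metric.cauchySeq_iff'.2 fun ε hε => ?_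
    obtain ⟨b, hb, h1⟩ := h.right t (half_pos hε)
    obtain ⟨n, hn⟩ := eventually_atTop.1 (hrt.eventually (gt_mem_nhds hb))
    exact ⟨n, fun k hk => (h1 _ _ (hr k) (hr n) (hn k hk) (hn n le_rfl)).trans_lt (by linarith)⟩
  obtain ⟨y, hy⟩ := cauchySeq_tendsto_of_complete hc
  refine ⟨y, fun ε hε => ?_⟩
  obtain ⟨b, hb, h1⟩ := h.right t hε
  refine ⟨b, hb, fun p hp hpb => ?_⟩
  refine le_of_tendsto (tendsto_const_nhds.dist hy) ?_
  filter_upwards [hrt.eventually (gt_mem_nhds hb)] with n hn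
  exact h1 _ _ hp (hr n) hpb hn

/-- The right-continuous extension of `f` to all times. -/
noncomputable def IsCadlagRat.ext (h : IsCadlagRat f) (t : ℝ≥0) : E := (h.exists_limit t).choose

theorem IsCadlagRat.ext_spec (h : IsCadlagRat f) (t : ℝ≥0) (hε : 0 < ε) :
    ∃ b, t < b ∧ ∀ p : ℚ≥0, t < p → p < b → dist (f p) (h.ext t) ≤ ε :=
  (h.exists_limit t).choose_spec ε hε

theorem IsCadlagRat.tendsto_ext (h : IsCadlagRat f) {t : ℝ≥0} {r : ℕ → ℚ≥0} (hr : ∀ n, t < r n)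
    (hrt : Tendsto (fun n => (r n : ℝ≥0)) atTop (𝓝 t)) :
    Tendsto (fun n => f (r n)) atTop (𝓝 (h.ext t)) := by
  refine Metric.tendsto_nhds.2 fun ε hε => ?_
  obtain ⟨b, hb, h1⟩ := h.ext_spec t (half_pos hε)
  filter_upwards [hrt.eventually (gt_mem_nhds hb)] with n hn
  exact (h1 _ (hr n) hn).trans_lt (by linarith)

theorem IsCadlagRat.ext_nnrat (h : IsCadlagRat f) (r : ℚ≥0) : h.ext r = f r := by
  obtain ⟨u, hu, hut⟩ := exists_seq_nnrat_right (r : ℝ≥0)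
  refine tendsto_nhds_unique (h.tendsto_ext hu hut) (Metric.tendsto_nhds.2 fun ε hε => ?_)
  obtain ⟨k, hk⟩ := exists_nat_one_div_lt hε
  obtain ⟨s, hs, h1⟩ := h.2 k r
  have hs' : (r : ℝ≥0) < s := by exact_mod_cast hs
  filter_upwards [hut.eventually (gt_mem_nhds hs')] with n hn
  have h2 : r < u n := by exact_mod_cast hu n
  exact (h1 _ h2.le (by exact_mod_cast hn)).trans hk

/-- The càdlàg path with given values at the rational times. -/
noncomputable def ofRat (f : ℚ≥0 → E) (h : IsCadlagRat f) : CadlagPath E where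
  toFun := h.ext
  rightCts t := by
    refine Metric.tendsto_nhds.2 fun ε hε => ?_
    obtain ⟨b, hb, h1⟩ := h.ext_spec t (half_pos hε)
    filter_upwards [Ico_mem_nhdsGE hb] with s hs
    obtain ⟨r, hr, hrs⟩ := exists_seq_nnrat_right s
    have h2 : dist (h.ext s) (h.ext t) ≤ ε / 2 := by
      refine le_of_tendsto ((h.tendsto_ext hr hrs).dist tendsto_const_nhds) ?_
      filter_upwards [hrs.eventually (gt_mem_nhds hs.2)] with n hn
      exact h1 _ (hs.1.trans_lt (hr n)) hn
    linarith
  leftLim t := by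
    rcases eq_or_ne t 0 with rfl | ht
    · refine ⟨h.ext 0, ?_⟩
      have : Iio (0 : ℝ≥0) = ∅ := by ext; simp
      rw [this, nhdsWithin_empty]
      exact tendsto_bot
    · have ht' : 0 < t := pos_iff_ne_zero.2 ht
      have : (𝓝[<] t).NeBot := nhdsLT_neBot_of_exists_lt ⟨0, ht'⟩
      have hc : Cauchy (map h.ext (𝓝[<] t)) := by
        refine Metric.cauchy_iff.2 ⟨inferInstance, fun ε hε => ?_⟩
        obtain ⟨a, ha, h1⟩ := h.left ht' (half_pos hε)
        refine ⟨_, image_mem_map (Ioo_mem_nhdsLT ha), ?_⟩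
        rintro _ ⟨s, hs, rfl⟩ _ ⟨s', hs', rfl⟩
        obtain ⟨r, hr, hrs⟩ := exists_seq_nnrat_right s
        obtain ⟨r', hr', hrs'⟩ := exists_seq_nnrat_right s'
        have h2 : dist (h.ext s) (h.ext s') ≤ ε / 2 := by
          refine le_of_tendsto ((h.tendsto_ext hr hrs).dist (h.tendsto_ext hr' hrs')) ?_
          filter_upwards [hrs.eventually (gt_mem_nhds hs.2),
            hrs'.eventually (gt_mem_nhds hs'.2)] with n hn hn'
          exact h1 _ _ (hs.1.trans (hr n)) (hs'.1.trans (hr' n)) hn hn'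
        linarith
      exact CompleteSpace.complete hc

theorem ofRat_nnrat (h : IsCadlagRat f) (r : ℚ≥0) : ofRat f h r = f r := h.ext_nnrat r

theorem ofRat_restrict (ω : CadlagPath E) :
    ofRat (fun q : ℚ≥0 => ω q) (isCadlagRat_restrict ω) = ω := by
  ext t
  obtain ⟨r, hr, hrt⟩ := exists_seq_nnrat_right t
  exact tendsto_nhds_unique ((isCadlagRat_restrict ω).tendsto_ext hr hrt)
    (ω.tendsto_right (fun n => (hr n).le) hrt)

variable [TopologicalSpace.SeparableSpace E] [MeasurableSpace E] [BorelSpace E]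

theorem measurableSet_osc (ε : ℝ) (m : ℕ) (a b : ℝ≥0) :
    MeasurableSet {f : ℚ≥0 → E | Osc f ε m a b} := by
  have := UniformSpace.secondCountable_of_separable E
  induction m generalizing a with
  | zero => simp [Osc]
  | succ m ih =>
    refine measurableSet_setOfPred.2 ?_
    simp only [Osc]
    refine Measurable.exists fun p => Measurable.exists fun q => ?_
    refine measurable_const.and (measurable_const.and (measurable_const.and (Measurable.and ?_ ?_)))
    · exact measurableSet_setOfPred.1 (measurableSet_lt measurable_const
        ((measurable_pi_apply p).dist (measurable_pi_apply q)))
    · exact measurableSet_setOfPred.1 (ih q)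

theorem measurableSet_isCadlagRat : MeasurableSet {f : ℚ≥0 → E | IsCadlagRat f} := by
  have := UniformSpace.secondCountable_of_separable E
  refine measurableSet_setOfPred.2 (Measurable.and ?_ ?_)
  · exact Measurable.forall fun k => Measurable.forall fun N => Measurable.exists fun m =>
      (measurableSet_setOfPred.1 (measurableSet_osc _ m 0 N)).not
  · refine Measurable.forall fun k => Measurable.forall fun r => Measurable.exists fun s =>
      measurable_const.and (Measurable.forall fun q => measurable_const.imp
        (measurable_const.imp ?_))
    exact measurableSet_setOfPred.1 (measurableSet_lt
      ((measurable_pi_apply q).dist (measurable_pi_apply r)) measurable_const)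

theorem standardBorelSpace_of_completeSpace : StandardBorelSpace (CadlagPath E) := by
  have := UniformSpace.secondCountable_of_separable E
  have : StandardBorelSpace {f : ℚ≥0 → E // IsCadlagRat f} :=
    (measurableSet_isCadlagRat (E := E)).standardBorel
  -- A path is determined by its rational values, and the admissible families of values form a Borel
  -- subset of a countable product.
  refine StandardBorelSpace.of_measurableEquiv
    (β := {f : ℚ≥0 → E // IsCadlagRat f}) ⟨⟨fun ω => ⟨fun q => ω q, isCadlagRat_restrict ω⟩,
      fun f => ofRat f.1 f.2, ofRat_restrict, fun f => Subtype.ext (funext (ofRat_nnrat f.2))⟩,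
      ?_, ?_⟩
  · exact Measurable.subtype_mk (measurable_pi_lambda (fun (ω : CadlagPath E) (q : ℚ≥0) => ω q)
      fun q => measurable_eval (q : ℝ≥0))
  · refine measurable_of_eval fun t => ?_
    obtain ⟨r, hr, hrt⟩ := exists_seq_nnrat_right t
    refine measurable_of_tendsto_metrizable
      (f := fun n (f : {f : ℚ≥0 → E // IsCadlagRat f}) => f.1 (r n))
      (fun n => (measurable_pi_apply (r n)).comp measurable_subtype_coe) ?_
    exact tendsto_pi_nhds.2 fun f => f.2.tendsto_ext hr hrt

end Oscillation

theorem standardBorelSpace (E : Type*) [TopologicalSpace E] [PolishSpace E] [MeasurableSpace E]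
    [BorelSpace E] : StandardBorelSpace (CadlagPath E) := by
  let := TopologicalSpace.upgradeIsCompletelyMetrizable E
  exact standardBorelSpace_of_completeSpace

end CadlagPath

/-! ### Decomposing and coupling path laws -/

namespace CadlagStrongMarkov

open CadlagPath

section Regeneration

variable {E : Type*} [MetricSpace E] [MeasurableSpace E] [BorelSpace E] (X : CadlagStrongMarkov E)

theorem measurable_lintegral_glue (t : ℝ≥0) {F : CadlagPath E → ℝ≥0∞} (hF : Measurable F) :
    Measurable fun p : E × CadlagPath E => ∫⁻ ω', F (glue t p.2 ω') ∂X.law p.1 := by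
  have h : Measurable (Function.uncurry fun (p : E × CadlagPath E) ω' => F (glue t p.2 ω')) :=
    hF.comp ((measurable_glue t).comp
      ((measurable_snd.comp measurable_fst).prodMk measurable_snd))
  exact h.lintegral_kernel_prod_right (κ := X.law.comap Prod.fst measurable_fst)

theorem measurable_lintegral_glue_eval (t : ℝ≥0) {F : CadlagPath E → ℝ≥0∞} (hF : Measurable F) :
    Measurable fun ω : CadlagPath E => ∫⁻ ω', F (glue t ω ω') ∂X.law (ω t) :=
  (X.measurable_lintegral_glue t hF).comp ((measurable_eval t).prodMk measurable_id)

/-- Replacing the path after time `t` by a path of `X` started afresh from the state at time `t`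
does not change the measure `M`. -/
def Regenerates (t : ℝ≥0) (M : Measure (CadlagPath E)) : Prop :=
  ∀ F : CadlagPath E → ℝ≥0∞, Measurable F →
    ∫⁻ ω, F ω ∂M = ∫⁻ ω, ∫⁻ ω', F (glue t ω ω') ∂X.law (ω t) ∂M

theorem regenerates_law (t : ℝ≥0) (x : E) : X.Regenerates t (X.law x) := by
  set k : CadlagPath E → Measure (CadlagPath E) := fun ω => (X.law (ω t)).map (glue t ω) with hk
  have hglue : ∀ ω : CadlagPath E, Measurable (glue t ω) := fun ω =>
    (measurable_glue t).comp measurable_prodMk_left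
  have hkm : Measurable k := by
    refine Measure.measurable_of_measurable_coe _ fun C hC => ?_
    have h1 : (fun ω => k ω C) =
        fun ω : CadlagPath E => ∫⁻ ω', C.indicator 1 (glue t ω ω') ∂X.law (ω t) := by
      ext ω
      rw [hk]
      dsimp only
      rw [Measure.map_apply (hglue ω) hC, ← lintegral_indicator_one (hglue ω hC)]
      rfl
    rw [h1]
    exact X.measurable_lintegral_glue_eval t (measurable_one.indicator hC)
  have hlaw : X.law x = (X.law x).bind k := by
    refine measure_ext_cyl fun I A hA => ?_
    have hC := measurableSet_cyl' I hA
    -- The cylinder splits into constraints before `t`, which gluing leaves to the old path, and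
    -- constraints from `t` on, which it hands to the new one.
    set B : Set (CadlagPath E) := {ω | ∀ i ∈ I, i < t → ω i ∈ A i} with hB
    set D : Set (CadlagPath E) := {ω | ∀ i ∈ I, t ≤ i → ω (i - t) ∈ A i} with hD
    have hBm : MeasurableSet[natFiltration E t] B := by
      have : B = ⋂ i ∈ I, ⋂ (_ : i < t), (fun ω : CadlagPath E => ω i) ⁻¹' A i := by
        ext; simp [hB]
      rw [this]
      exact Finset.measurableSet_biInter _ fun i _ => MeasurableSet.iInter fun hi =>
        measurable_eval_natFiltration hi.le (hA i)
    have hDm : MeasurableSet D := by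
      have : D = ⋂ i ∈ I, ⋂ (_ : t ≤ i), (fun ω : CadlagPath E => ω (i - t)) ⁻¹' A i := by
        ext; simp [hD]
      rw [this]
      exact Finset.measurableSet_biInter _ fun i _ => MeasurableSet.iInter fun hi =>
        measurable_eval (i - t) (hA i)
    have hBm' : MeasurableSet B := (natFiltration E).le _ _ hBm
    have e1 : cyl I A = shift t ⁻¹' D ∩ B := by
      ext ω
      constructor
      · intro h
        refine ⟨fun i hi hti => ?_, fun i hi _ => h i hi⟩
        rw [shift_apply, add_tsub_cancel_of_le hti]
        exact h i hi
      · rintro ⟨h1, h2⟩ i hi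
        rcases lt_or_ge i t with hit | hit
        · exact h2 i hi hit
        · have := h1 i hi hit
          rwa [shift_apply, add_tsub_cancel_of_le hit] at this
    have e2 : ∀ ω, k ω (cyl I A) = B.indicator (fun ω => X.law (ω t) D) ω := by
      intro ω
      rw [hk]
      dsimp only
      rw [Measure.map_apply (hglue ω) hC]
      by_cases hω : ω ∈ B
      · rw [indicator_of_mem hω]
        congr 1
        ext ω'
        constructor
        · intro h i hi hti
          have := h i hi
          rwa [glue_of_le hti] at this
        · intro h i hi
          rcases lt_or_ge i t with hit | hit
          · rw [glue_of_lt hit]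
            exact hω i hi hit
          · rw [glue_of_le hit]
            exact h i hi hit
      · rw [indicator_of_notMem hω]
        have : glue t ω ⁻¹' cyl I A = ∅ := by
          refine eq_empty_of_forall_notMem fun ω' h => hω fun i hi hit => ?_
          have := h i hi
          rwa [glue_of_lt hit] at this
        rw [this, measure_empty]
    rw [Measure.bind_apply hC hkm.aemeasurable, lintegral_congr e2, lintegral_indicator hBm', e1,
      ← Measure.restrict_apply (measurable_shift t hDm), ← Measure.map_apply (measurable_shift t) hDm,
      X.map_shift_restrict x t hBm, Measure.bind_apply hDm X.law.aemeasurable,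
      lintegral_map (X.law.measurable_coe hDm) (measurable_eval t)]
  intro F hF
  conv_lhs => rw [hlaw]
  rw [Measure.lintegral_bind hkm.aemeasurable hF.aemeasurable]
  exact lintegral_congr fun ω => lintegral_map hF (hglue ω)

theorem regenerates_lawFrom (t : ℝ≥0) (μ : Measure E) : X.Regenerates t (X.lawFrom μ) := by
  intro F hF
  rw [lawFrom, Measure.lintegral_bind X.law.aemeasurable hF.aemeasurable,
    Measure.lintegral_bind X.law.aemeasurable
      (X.measurable_lintegral_glue_eval t hF).aemeasurable]
  exact lintegral_congr fun x => X.regenerates_law t x F hF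

variable {X}

/-- Gluing at `t` does not change the state at `s`, so the density factors out. At `s = t` this
holds almost surely, because the new path starts where the old one stands. -/
theorem Regenerates.withDensity {s t : ℝ≥0} (hst : s ≤ t) {M : Measure (CadlagPath E)}
    (h : X.Regenerates t M) {g : E → ℝ≥0∞} (hg : Measurable g) :
    X.Regenerates t (M.withDensity fun ω => g (ω s)) := by
  intro F hF
  have hgs : Measurable fun ω : CadlagPath E => g (ω s) := hg.comp (measurable_eval s)
  have hm := X.measurable_lintegral_glue_eval t hF
  rw [lintegral_withDensity_eq_lintegral_mul _ hgs hF,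
    lintegral_withDensity_eq_lintegral_mul _ hgs hm, h _ (hgs.mul hF)]
  refine lintegral_congr fun ω => ?_
  simp only [Pi.mul_apply]
  have hFg : Measurable fun ω' => F (glue t ω ω') :=
    hF.comp ((measurable_glue t).comp measurable_prodMk_left)
  rw [← lintegral_const_mul _ hFg]
  refine lintegral_congr_ae ?_
  filter_upwards [X.ae_eval_zero (ω t)] with ω' hω'
  rcases hst.lt_or_eq with hlt | rfl
  · rw [glue_of_lt hlt]
  · rw [glue_of_le le_rfl, tsub_self, hω']

theorem Regenerates.map_eval {t : ℝ≥0} {M : Measure (CadlagPath E)} (h : X.Regenerates t M)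
    (s : ℝ≥0) : M.map (fun ω => ω (t + s)) = (M.map fun ω => ω t).bind (X.trans s) := by
  ext A hA
  have hf : Measurable (A.indicator (1 : E → ℝ≥0∞)) := measurable_one.indicator hA
  rw [Measure.bind_apply hA (X.trans s).aemeasurable, lintegral_map ((X.trans s).measurable_coe hA)
    (measurable_eval t), ← lintegral_indicator_one hA, lintegral_map hf (measurable_eval _)]
  refine (h (fun ω => A.indicator 1 (ω (t + s))) (hf.comp (measurable_eval _))).trans
    (lintegral_congr fun ω => ?_)
  rw [← lintegral_indicator_one hA, X.lintegral_trans s _ hf]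
  refine lintegral_congr fun ω' => ?_
  rw [glue_of_le le_self_add, add_tsub_cancel_left]

end Regeneration

section Decomposition

variable {E : Type*} [MetricSpace E] [MeasurableSpace E] [BorelSpace E] (X : CadlagStrongMarkov E)

theorem map_eval_withDensity (M : Measure (CadlagPath E)) (t : ℝ≥0) {g : E → ℝ≥0∞}
    (hg : Measurable g) : (M.withDensity fun ω => g (ω t)).map (fun ω => ω t) =
      (M.map fun ω => ω t).withDensity g := by
  ext A hA
  rw [Measure.map_apply (measurable_eval t) hA, withDensity_apply _ (measurable_eval t hA),
    withDensity_apply _ hA, Measure.restrict_map (measurable_eval t) hA,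
    lintegral_map hg (measurable_eval t)]

/-- Uniqueness of densities gives `g + g' = 1` almost everywhere for the law of the state at `t`,
and this pulls back to paths. -/
theorem withDensity_eval_add (M : Measure (CadlagPath E)) [IsFiniteMeasure M] (t : ℝ≥0)
    {g g' : E → ℝ≥0∞} (hg : Measurable g) (hg' : Measurable g')
    (h : (M.map fun ω => ω t).withDensity g + (M.map fun ω => ω t).withDensity g' =
      M.map fun ω => ω t) :
    M.withDensity (fun ω => g (ω t)) + M.withDensity (fun ω => g' (ω t)) = M := by
  set μ := M.map fun ω => ω t with hμ
  have h1 : g + g' =ᵐ[μ] 1 := by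
    rw [← withDensity_add_left hg] at h
    refine (withDensity_eq_iff_of_sigmaFinite (hg.add hg').aemeasurable
      aemeasurable_one).1 ?_
    exact h.trans withDensity_one.symm
  have h2 : ∀ᵐ ω ∂M, g (ω t) + g' (ω t) = 1 := ae_of_ae_map (measurable_eval t).aemeasurable h1
  have hgt : Measurable fun ω : CadlagPath E => g (ω t) := hg.comp (measurable_eval t)
  rw [← withDensity_add_left hgt]
  refine (withDensity_congr_ae (g := 1) ?_).trans withDensity_one
  exact h2

/-- If at the times `(n + 1) h` the part `lam n` of the distribution of the process is removed,
this corresponds to a decomposition of the law of the process on the path space. -/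
theorem exists_path_decomposition (h : ℝ≥0) (η lam : ℕ → Measure E) [∀ n, IsFiniteMeasure (η n)]
    (hη : ∀ n, η (n + 1) + lam n = (η n).bind (X.trans h)) :
    ∃ U M : ℕ → Measure (CadlagPath E), U 0 = X.lawFrom (η 0) ∧ (∀ n, U (n + 1) + M n = U n) ∧
      (∀ n : ℕ, (U n).map (fun ω => ω (n * h)) = η n) ∧
      (∀ n : ℕ, (M n).map (fun ω => ω ((n + 1 : ℕ) * h)) = lam n) ∧
      (∀ n : ℕ, X.Regenerates (n * h) (U n)) ∧
      ∀ n : ℕ, X.Regenerates ((n + 1 : ℕ) * h) (M n) := by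
  have hle1 : ∀ n, η (n + 1) ≤ (η n).bind (X.trans h) := fun n => by
    rw [← hη n]; exact Measure.le_add_right le_rfl
  have hle2 : ∀ n, lam n ≤ (η n).bind (X.trans h) := fun n => by
    rw [← hη n]; exact Measure.le_add_left le_rfl
  have hlamf : ∀ n, IsFiniteMeasure (lam n) := fun n => isFiniteMeasure_of_le _ (hle2 n)
  set q : ℕ → E → ℝ≥0∞ := fun n => (η (n + 1)).rnDeriv ((η n).bind (X.trans h)) with hq
  set r : ℕ → E → ℝ≥0∞ := fun n => (lam n).rnDeriv ((η n).bind (X.trans h)) with hr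
  have hqm : ∀ n, Measurable (q n) := fun n => Measure.measurable_rnDeriv _ _
  have hrm : ∀ n, Measurable (r n) := fun n => Measure.measurable_rnDeriv _ _
  have hqd : ∀ n, ((η n).bind (X.trans h)).withDensity (q n) = η (n + 1) := fun n =>
    Measure.withDensity_rnDeriv_eq _ _ (hle1 n).absolutelyContinuous
  have hrd : ∀ n, ((η n).bind (X.trans h)).withDensity (r n) = lam n := fun n =>
    Measure.withDensity_rnDeriv_eq _ _ (hle2 n).absolutelyContinuous
  -- Keeping the part `η (n + 1)` of the state law at time `(n + 1) h` is weighting paths by its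
  -- density evaluated at that time.
  let U : ℕ → Measure (CadlagPath E) := fun n => n.rec (X.lawFrom (η 0))
    fun n V => V.withDensity fun ω => q n (ω ((n + 1 : ℕ) * h))
  have hU0 : U 0 = X.lawFrom (η 0) := rfl
  have hUs : ∀ n, U (n + 1) = (U n).withDensity fun ω => q n (ω ((n + 1 : ℕ) * h)) := fun n => rfl
  have hreg : ∀ n : ℕ, ∀ t : ℝ≥0, n * h ≤ t → X.Regenerates t (U n) := by
    intro n
    induction n with
    | zero => exact fun t _ => X.regenerates_lawFrom t _
    | succ n ih =>
      intro t ht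
      rw [hUs]
      refine Regenerates.withDensity ht (ih t (le_trans ?_ ht)) (hqm n)
      gcongr
      simp
  have hmap1 : ∀ n : ℕ, (U n).map (fun ω => ω (n * h)) = η n →
      (U n).map (fun ω => ω ((n + 1 : ℕ) * h)) = (η n).bind (X.trans h) := fun n hn => by
    have := (hreg n _ le_rfl).map_eval h
    rw [hn] at this
    rw [← this]
    congr 1
    ext ω
    congr 1
    push_cast
    ring
  have hmap : ∀ n : ℕ, (U n).map (fun ω => ω (n * h)) = η n := by
    intro n
    induction n with
    | zero =>
      rw [hU0, lawFrom]
      have : (fun ω : CadlagPath E => ω ((0 : ℕ) * h)) = fun ω => ω 0 := by ext ω; simp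
      rw [this]
      ext A hA
      rw [Measure.map_apply (measurable_eval 0) hA, Measure.bind_apply (measurable_eval 0 hA)
        X.law.aemeasurable]
      calc ∫⁻ x, X.law x ((fun ω => ω 0) ⁻¹' A) ∂η 0 = ∫⁻ x, A.indicator 1 x ∂η 0 := by
            refine lintegral_congr fun x => ?_
            rw [← Measure.map_apply (measurable_eval 0) hA, X.law_zero, Measure.dirac_apply' _ hA]
        _ = η 0 A := lintegral_indicator_one hA
    | succ n ih =>
      rw [hUs, map_eval_withDensity _ _ (hqm n), hmap1 n ih, hqd]
  have hfin : ∀ n, IsFiniteMeasure (U n) := fun n => by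
    refine ⟨?_⟩
    have := congrArg (fun μ : Measure E => μ univ) (hmap n)
    rw [Measure.map_apply (measurable_eval _) MeasurableSet.univ, preimage_univ] at this
    rw [this]
    exact measure_lt_top _ _
  refine ⟨U, fun n => (U n).withDensity fun ω => r n (ω ((n + 1 : ℕ) * h)), hU0, fun n => ?_, hmap,
    fun n => ?_, fun n => hreg n _ le_rfl, fun n => ?_⟩
  · have := hfin n
    rw [hUs]
    refine @withDensity_eval_add E _ _ _ (U n) this ((n + 1 : ℕ) * h) _ _ (hqm n) (hrm n) ?_
    rw [hmap1 n (hmap n), hqd, hrd, hη]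
  · rw [map_eval_withDensity _ _ (hrm n), hmap1 n (hmap n), hrd]
  · refine Regenerates.withDensity le_rfl (hreg n _ ?_) (hrm n)
    gcongr
    simp

/-- Telescoping: what is left after `k` removals has vanishing mass. -/
theorem eq_sum_of_decomposition {α : Type*} [MeasurableSpace α] {U M : ℕ → Measure α}
    (hUM : ∀ n, U (n + 1) + M n = U n) (hU : Tendsto (fun n => U n univ) atTop (𝓝 0)) (m : ℕ) :
    U m = Measure.sum fun i => M (i + m) := by
  have hpart : ∀ k, U (k + m) + ∑ i ∈ Finset.range k, M (i + m) = U m := by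
    intro k
    induction k with
    | zero => simp
    | succ k ih =>
      rw [Finset.sum_range_succ, ← ih, ← hUM (k + m), show k + 1 + m = k + m + 1 by ring]
      abel
  have hpart' : ∀ k A, U (k + m) A + ∑ i ∈ Finset.range k, M (i + m) A = U m A := fun k A => by
    have := congrArg (fun μ : Measure α => μ A) (hpart k)
    simpa using this
  ext A hA
  rw [Measure.sum_apply _ hA]
  refine le_antisymm ?_ (ENNReal.tsum_le_of_sum_range_le fun k => ?_)
  · have h1 : Tendsto (fun k => U (k + m) univ + ∑' i, M (i + m) A) atTop
        (𝓝 (0 + ∑' i, M (i + m) A)) :=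
      ((tendsto_add_atTop_iff_nat m).2 hU).add tendsto_const_nhds
    rw [zero_add] at h1
    refine ge_of_tendsto' h1 fun k => ?_
    rw [← hpart' k A]
    gcongr
    · exact subset_univ A
    · exact ENNReal.sum_le_tsum _
  · rw [← hpart' k A]
    exact le_add_self

end Decomposition

section Coupling

variable {E : Type*} [MetricSpace E] [LocallyCompactSpace E] [TopologicalSpace.SeparableSpace E]
  [MeasurableSpace E] [BorelSpace E] (X : CadlagStrongMarkov E)

/-- Two measures on the path space with the same distribution of the state at time `t` can be
coupled in such a way that the paths agree from time `t` on. -/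
theorem exists_coupling_after [Nonempty E] {t : ℝ≥0} {M M' : Measure (CadlagPath E)}
    [IsFiniteMeasure M] [IsFiniteMeasure M'] {lam : Measure E}
    (hM : M.map (fun ω => ω t) = lam) (hM' : M'.map (fun ω => ω t) = lam)
    (hreg : X.Regenerates t M) (hreg' : X.Regenerates t M') :
    ∃ Q : Measure (CadlagPath E × CadlagPath E), Q.map Prod.fst = M ∧ Q.map Prod.snd = M' ∧
      ∀ s, t ≤ s → ∀ᵐ p ∂Q, p.1 s = p.2 s := by
  have hE := polishSpace_of_locallyCompactSpace E
  have := CadlagPath.standardBorelSpace E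
  have : Nonempty (CadlagPath E) :=
    nonempty_of_isProbabilityMeasure (X.law (Classical.arbitrary E))
  have hlam : IsFiniteMeasure lam := hM ▸ inferInstance
  have hpair : Measurable fun ω : CadlagPath E => (ω t, ω) := (measurable_eval t).prodMk measurable_id
  set ρ := M.map fun ω => (ω t, ω) with hρ
  set ρ' := M'.map fun ω => (ω t, ω) with hρ'
  have hfst : ρ.fst = lam := by
    rw [hρ, Measure.fst, Measure.map_map measurable_fst hpair]; exact hM
  have hfst' : ρ'.fst = lam := by
    rw [hρ', Measure.fst, Measure.map_map measurable_fst hpair]; exact hM'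
  set κ := ρ.condKernel
  set κ' := ρ'.condKernel
  have hdis : lam ⊗ₘ κ = ρ := by rw [← hfst]; exact ρ.disintegrate κ
  have hdis' : lam ⊗ₘ κ' = ρ' := by rw [← hfst']; exact ρ'.disintegrate κ'
  set G : E × (CadlagPath E × (CadlagPath E × CadlagPath E)) → CadlagPath E × CadlagPath E :=
    fun p => (glue t p.2.1 p.2.2.2, glue t p.2.2.1 p.2.2.2) with hG
  have hG1 : Measurable fun p : E × (CadlagPath E × (CadlagPath E × CadlagPath E)) =>
      glue t p.2.1 p.2.2.2 :=
    (measurable_glue t).comp (by fun_prop : Measurable fun p : E × (CadlagPath E ×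
      (CadlagPath E × CadlagPath E)) => (p.2.1, p.2.2.2))
  have hG2 : Measurable fun p : E × (CadlagPath E × (CadlagPath E × CadlagPath E)) =>
      glue t p.2.2.1 p.2.2.2 :=
    (measurable_glue t).comp (by fun_prop : Measurable fun p : E × (CadlagPath E ×
      (CadlagPath E × CadlagPath E)) => (p.2.2.1, p.2.2.2))
  have hGm : Measurable G := hG1.prodMk hG2
  -- Draw the state at `t` from `lam`, then independently the two pasts given that state and a
  -- single future started there, shared by both paths. The marginals are correct because `M` and
  -- `M'` regenerate at `t`.
  refine ⟨(lam ⊗ₘ (κ ×ₖ (κ' ×ₖ X.law))).map G, ?_, ?_, fun s hs => ?_⟩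
  · refine Measure.ext_of_lintegral _ fun F hF => ?_
    have hFG : Measurable fun p : CadlagPath E × CadlagPath E => F (glue t p.1 p.2) :=
      hF.comp (measurable_glue t)
    rw [lintegral_map hF measurable_fst,
      lintegral_map (f := fun p : CadlagPath E × CadlagPath E => F p.1)
        (hF.comp measurable_fst) hGm,
      Measure.lintegral_compProd (f := fun p => F (G p).1) (hF.comp hG1), hreg F hF]
    have h1 : ∀ z, ∫⁻ p, F (glue t p.1 p.2.2) ∂(κ ×ₖ (κ' ×ₖ X.law)) z =
        ∫⁻ ω, ∫⁻ ω', F (glue t ω ω') ∂X.law z ∂κ z := fun z => by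
      rw [Kernel.lintegral_prod _ _ _
        (g := fun p : CadlagPath E × (CadlagPath E × CadlagPath E) => F (glue t p.1 p.2.2))
        (hFG.comp (by fun_prop :
        Measurable fun p : CadlagPath E × (CadlagPath E × CadlagPath E) => (p.1, p.2.2)))]
      refine lintegral_congr fun ω => ?_
      rw [Kernel.lintegral_prod _ _ _
        (g := fun p : CadlagPath E × CadlagPath E => F (glue t ω p.2))
        (hFG.comp (by fun_prop :
        Measurable fun p : CadlagPath E × CadlagPath E => (ω, p.2)))]
      simp
    refine (lintegral_congr h1).trans ?_
    have h2 := X.measurable_lintegral_glue t hF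
    rw [← Measure.lintegral_compProd h2, hdis, hρ, lintegral_map h2 hpair]
  · refine Measure.ext_of_lintegral _ fun F hF => ?_
    have hFG : Measurable fun p : CadlagPath E × CadlagPath E => F (glue t p.1 p.2) :=
      hF.comp (measurable_glue t)
    rw [lintegral_map hF measurable_snd,
      lintegral_map (f := fun p : CadlagPath E × CadlagPath E => F p.2)
        (hF.comp measurable_snd) hGm,
      Measure.lintegral_compProd (f := fun p => F (G p).2) (hF.comp hG2), hreg' F hF]
    have h1 : ∀ z, ∫⁻ p, F (glue t p.2.1 p.2.2) ∂(κ ×ₖ (κ' ×ₖ X.law)) z =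
        ∫⁻ ω, ∫⁻ ω', F (glue t ω ω') ∂X.law z ∂κ' z := fun z => by
      rw [Kernel.lintegral_prod _ _ _
        (g := fun p : CadlagPath E × (CadlagPath E × CadlagPath E) => F (glue t p.2.1 p.2.2))
        (hFG.comp (by fun_prop :
        Measurable fun p : CadlagPath E × (CadlagPath E × CadlagPath E) => (p.2.1, p.2.2)))]
      simp only [lintegral_const, measure_univ, mul_one]
      exact Kernel.lintegral_prod _ _ _ hFG
    refine (lintegral_congr h1).trans ?_
    have h2 := X.measurable_lintegral_glue t hF
    rw [← Measure.lintegral_compProd h2, hdis', hρ', lintegral_map h2 hpair]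
  · have hms : MeasurableSet {p : CadlagPath E × CadlagPath E | p.1 s = p.2 s} :=
      measurableSet_eq_fun ((measurable_eval s).comp measurable_fst)
        ((measurable_eval s).comp measurable_snd)
    refine (ae_map_iff hGm.aemeasurable hms).2 (Eventually.of_forall fun p => ?_)
    simp only [hG, glue_of_le hs]

end Coupling

end CadlagStrongMarkov

/-! ### From the skeleton to the exponential coupling -/

namespace CadlagStrongMarkov

open CadlagPath

variable {E : Type*} [MetricSpace E] [LocallyCompactSpace E] [TopologicalSpace.SeparableSpace E]
  [MeasurableSpace E] [BorelSpace E] (X : CadlagStrongMarkov E)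

/-- If the uncoupled parts of the `h`-skeleton of `X` decay, there is a coupling of `X` with the
same rate of decay. -/
theorem exists_coupling_of_decay [Nonempty E] {φ : E → ℝ≥0∞} (hφ : UnivMeasurable φ)
    (hφ1 : ∀ x, 1 ≤ φ x) {B : ℝ≥0∞} (hB : ∀ t x, ∫⁻ y, φ y ∂X.trans t x ≤ B * φ x)
    {h : ℝ≥0} (hh : 0 < h) {μ ν : Measure E} [IsProbabilityMeasure μ] [IsProbabilityMeasure ν]
    {d : ℕ → ℝ≥0∞} (hd : Tendsto d atTop (𝓝 0))
    (hdec : ∀ n, ∫⁻ x, φ x ∂(uncoupled (X.trans h) μ ν n).1 +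
      ∫⁻ x, φ x ∂(uncoupled (X.trans h) μ ν n).2 ≤ d n) :
    ∃ Q : Measure (CadlagPath E × CadlagPath E), X.IsCoupling μ ν Q Prod.fst Prod.snd ∧
      ∀ t : ℝ≥0, ∫⁻ p, {p : CadlagPath E × CadlagPath E | p.1 t ≠ p.2 t}.indicator
        (fun p => φ (p.1 t) + φ (p.2 t)) p ∂Q ≤ B * d ⌊t / h⌋₊ := by
  obtain ⟨U, M, hU0, hUM, hUη, hMlam, hUreg, hMreg⟩ := X.exists_path_decomposition h
    (fun n => (uncoupled (X.trans h) μ ν n).1) (newlyCoupled (X.trans h) μ ν)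
    (uncoupled_succ_fst_add _ _ _)
  obtain ⟨U', M', hU0', hUM', hUη', hMlam', hUreg', hMreg'⟩ := X.exists_path_decomposition h
    (fun n => (uncoupled (X.trans h) μ ν n).2) (newlyCoupled (X.trans h) μ ν)
    (uncoupled_succ_snd_add _ _ _)
  have huniv : ∀ {V : Measure (CadlagPath E)} {η : Measure E} {t : ℝ≥0},
      V.map (fun ω => ω t) = η → V univ = η univ := fun {V η t} hV => by
    rw [← hV, Measure.map_apply (measurable_eval t) MeasurableSet.univ, preimage_univ]
  have hle : ∀ η : Measure E, η univ ≤ ∫⁻ x, φ x ∂η := fun η => by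
    rw [← lintegral_one]
    exact lintegral_mono hφ1
  have hUlim : Tendsto (fun n => U n univ) atTop (𝓝 0) :=
    tendsto_of_tendsto_of_tendsto_of_le_of_le tendsto_const_nhds hd (fun _ => zero_le) fun n => by
      rw [huniv (hUη n)]
      exact (hle _).trans (le_self_add.trans (hdec n))
  have hUlim' : Tendsto (fun n => U' n univ) atTop (𝓝 0) :=
    tendsto_of_tendsto_of_tendsto_of_le_of_le tendsto_const_nhds hd (fun _ => zero_le) fun n => by
      rw [huniv (hUη' n)]
      exact (hle _).trans (le_add_self.trans (hdec n))
  have hUsum := eq_sum_of_decomposition hUM hUlim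
  have hUsum' := eq_sum_of_decomposition hUM' hUlim'
  have hMfin : ∀ n, IsFiniteMeasure (M n) := fun n =>
    ⟨by rw [huniv (hMlam n)]; exact measure_lt_top _ _⟩
  have hMfin' : ∀ n, IsFiniteMeasure (M' n) := fun n =>
    ⟨by rw [huniv (hMlam' n)]; exact measure_lt_top _ _⟩
  choose Q hQ1 hQ2 hQ using fun n =>
    X.exists_coupling_after (hMlam n) (hMlam' n) (hMreg n) (hMreg' n)
  have hlaw1 : (Measure.sum Q).map Prod.fst = X.lawFrom μ := by
    rw [Measure.map_sum measurable_fst.aemeasurable]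
    simp only [hQ1]
    exact (hUsum 0).symm.trans hU0
  have hlaw2 : (Measure.sum Q).map Prod.snd = X.lawFrom ν := by
    rw [Measure.map_sum measurable_snd.aemeasurable]
    simp only [hQ2]
    exact (hUsum' 0).symm.trans hU0'
  have hprob : IsProbabilityMeasure (Measure.sum Q) := by
    have h1 : IsProbabilityMeasure (X.lawFrom μ) :=
      inferInstanceAs (IsProbabilityMeasure (μ.bind X.law))
    refine ⟨?_⟩
    rw [← preimage_univ (f := Prod.fst), ← Measure.map_apply measurable_fst MeasurableSet.univ,
      hlaw1, measure_univ]
  refine ⟨Measure.sum Q, ⟨hprob, measurable_fst, measurable_snd, hlaw1, hlaw2⟩, fun t => ?_⟩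
  set m := ⌊t / h⌋₊ with hm
  have hmt : m * h ≤ t := (le_div_iff₀ hh).1 (Nat.floor_le zero_le)
  set f : CadlagPath E × CadlagPath E → ℝ≥0∞ :=
    {p : CadlagPath E × CadlagPath E | p.1 t ≠ p.2 t}.indicator
      (fun p => φ (p.1 t) + φ (p.2 t)) with hf
  -- The `n`-th pieces agree from time `(n + 1) h` on, and this is at most `t` when `n < m`. The
  -- remaining pieces add up to `U m` and `U' m`, the path laws not yet coupled at time `m h`.
  have hzero : ∀ n ∈ Finset.range m, ∫⁻ p, f p ∂Q n = 0 := fun n hn => by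
    have hn1 : ((n + 1 : ℕ) : ℝ≥0) * h ≤ t := by
      refine le_trans ?_ hmt
      gcongr
      exact Finset.mem_range.1 hn
    refine (lintegral_congr_ae ((hQ n t hn1).mono fun p hp => ?_)).trans lintegral_zero
    exact indicator_of_notMem (fun hne : p.1 t ≠ p.2 t => hne hp) _
  have hQn : ∀ n, ∫⁻ p, f p ∂Q n ≤ ∫⁻ ω, φ (ω t) ∂M n + ∫⁻ ω, φ (ω t) ∂M' n := fun n => by
    have hev := measurable_eval (E := E) t
    have hm1 : AEMeasurable (fun ω : CadlagPath E => φ (ω t)) ((Q n).map Prod.fst) := by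
      rw [hQ1]
      exact (hφ _ inferInstance).comp_measurable hev
    have hm2 : AEMeasurable (fun ω : CadlagPath E => φ (ω t)) ((Q n).map Prod.snd) := by
      rw [hQ2]
      exact (hφ _ inferInstance).comp_measurable hev
    calc ∫⁻ p, f p ∂Q n ≤ ∫⁻ p, (φ (p.1 t) + φ (p.2 t)) ∂Q n :=
          lintegral_mono fun p => indicator_le_self _ _ p
      _ = ∫⁻ p, φ (p.1 t) ∂Q n + ∫⁻ p, φ (p.2 t) ∂Q n :=
          lintegral_add_left' (hm1.comp_measurable measurable_fst) _
      _ = _ := by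
          rw [← hQ1 n, ← hQ2 n, lintegral_map' hm1 measurable_fst.aemeasurable,
            lintegral_map' hm2 measurable_snd.aemeasurable]
  have hstep : ∀ {V : Measure (CadlagPath E)} {η : Measure E} [IsFiniteMeasure η],
      V.map (fun ω => ω (m * h)) = η → X.Regenerates (m * h) V →
      ∫⁻ ω, φ (ω t) ∂V ≤ B * ∫⁻ x, φ x ∂η := fun {V η} _ hV hreg => by
    have hmap := hreg.map_eval (t - m * h)
    rw [add_tsub_cancel_of_le hmt, hV] at hmap
    have hint : ∫⁻ ω, φ (ω t) ∂V = ∫⁻ x, φ x ∂η.bind (X.trans (t - m * h)) := by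
      rw [← hmap, lintegral_map' _ (measurable_eval t).aemeasurable]
      rw [hmap]
      exact hφ _ inferInstance
    rw [hint, Measure.lintegral_bind (X.trans _).aemeasurable (hφ _ inferInstance),
      ← lintegral_const_mul'' _ (hφ η inferInstance)]
    exact lintegral_mono fun x => hB _ x
  calc ∫⁻ p, f p ∂Measure.sum Q = ∑' n, ∫⁻ p, f p ∂Q n := lintegral_sum_measure _ _
    _ = ∑' n, ∫⁻ p, f p ∂Q (n + m) := by
        rw [← Summable.sum_add_tsum_nat_add' (k := m) ENNReal.summable, Finset.sum_eq_zero hzero,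
          zero_add]
    _ ≤ ∑' n, (∫⁻ ω, φ (ω t) ∂M (n + m) + ∫⁻ ω, φ (ω t) ∂M' (n + m)) :=
        ENNReal.tsum_le_tsum fun n => hQn _
    _ = ∫⁻ ω, φ (ω t) ∂U m + ∫⁻ ω, φ (ω t) ∂U' m := by
        rw [ENNReal.tsum_add, ← lintegral_sum_measure, ← lintegral_sum_measure, ← hUsum, ← hUsum']
    _ ≤ B * ∫⁻ x, φ x ∂(uncoupled (X.trans h) μ ν m).1 +
        B * ∫⁻ x, φ x ∂(uncoupled (X.trans h) μ ν m).2 :=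
        add_le_add (hstep (hUη m) (hUreg m)) (hstep (hUη' m) (hUreg' m))
    _ ≤ B * d m := by
        rw [← mul_add]
        gcongr
        exact hdec m

theorem pow_floor_le_exp {ρ : ℝ} (hρ : 0 < ρ) (hρ1 : ρ < 1) (h t : ℝ≥0) :
    ρ ^ ⌊t / h⌋₊ ≤ ρ⁻¹ * Real.exp (-(-Real.log ρ / h) * t) := by
  have hlog := Real.log_neg hρ hρ1
  have hfl : (t : ℝ) / h ≤ ⌊t / h⌋₊ + 1 := by
    exact_mod_cast (Nat.lt_floor_add_one (t / h)).le
  calc ρ ^ ⌊t / h⌋₊ = ρ⁻¹ * Real.exp (Real.log ρ * (⌊t / h⌋₊ + 1)) := by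
        rw [mul_add, mul_one, Real.exp_add, Real.exp_log hρ, mul_comm (Real.log ρ), Real.exp_nat_mul,
          Real.exp_log hρ]
        field_simp
    _ ≤ ρ⁻¹ * Real.exp (Real.log ρ * (t / h)) := by
        gcongr ?_ * Real.exp ?_
        exact mul_le_mul_of_nonpos_left hfl hlog.le
    _ = _ := by
        congr 2
        ring

/-- A Lyapunov function whose sublevel sets are small gives rise to an exponential coupling. -/
theorem admitsExpCoupling_of_lyapunov [Nonempty E] {φ : E → ℝ≥0∞} (hφ : UnivMeasurable φ)
    (hφ1 : ∀ x, 1 ≤ φ x) (hφtop : ∀ x, φ x < ∞) {a : ℝ} (ha : 0 < a) {L : ℝ≥0∞} (hL : L ≠ ∞)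
    (hlyap : ∀ t x, ∫⁻ y, φ y ∂X.trans t x ≤ ENNReal.ofReal (Real.exp (-a * t)) * φ x + L)
    (hov : ∀ R : ℝ≥0∞, R ≠ ∞ → ∃ T : ℝ≥0, ∃ ε : ℝ≥0∞, 0 < ε ∧ ∀ t, T ≤ t → ∀ x y, φ x ≤ R →
      φ y ≤ R → Overlap (X.trans t x) (X.trans t y) ε) :
    X.AdmitsExpCoupling φ := by
  have hB : ∀ t x, ∫⁻ y, φ y ∂X.trans t x ≤ (1 + L) * φ x := fun t x => by
    refine (hlyap t x).trans ?_
    rw [add_mul]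
    gcongr
    · rw [ENNReal.ofReal_le_one, Real.exp_le_one_iff]
      have : (0 : ℝ) ≤ t := t.2
      nlinarith
    · exact le_mul_of_one_le_right' (hφ1 x)
  set C : ℝ := L.toReal + 1 with hC
  have hC0 : 0 < C := by positivity
  obtain ⟨T, ε', hε', hT⟩ := hov (ENNReal.ofReal (8 * C)) ENNReal.ofReal_ne_top
  have hmin : min ε' 1 ≠ ∞ := ne_top_of_le_ne_top ENNReal.one_ne_top (min_le_right _ _)
  -- One step length serves both ingredients of Harris' theorem: `exp(-a h) < 1/2` for the drift,
  -- and `T ≤ h` for the overlap on the sublevel set at height `8 * C`.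
  obtain ⟨h, hh2, hhT, hh⟩ := ((eventually_exp_mul_lt ha ENNReal.one_ne_top
    (show (0 : ℝ≥0∞) < 2⁻¹ by simp)).and ((eventually_ge_atTop T).and (eventually_gt_atTop 0))).exists
  obtain ⟨D, ρ, hD, hρ, hρ1, hdec⟩ := exists_uncoupled_decay (κ := X.trans h) hφ hφ1 hC0
    (ε := (min ε' 1).toReal) (ENNReal.toReal_pos (lt_min hε' one_pos).ne' hmin)
    (ENNReal.toReal_le_of_le_ofReal zero_le_one (by simp))
    (fun x => (hlyap h x).trans (by
      rw [mul_one] at hh2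
      gcongr
      rw [← ENNReal.ofReal_toReal hL]
      exact ENNReal.ofReal_le_ofReal (by linarith)))
    (fun x y hx hy A hA => by
      rw [ENNReal.ofReal_toReal hmin]
      exact (min_le_left _ _).trans (hT h hhT x y hx hy A hA))
  obtain ⟨π, hπ, hinv, hπφ⟩ := exists_invariant_of_decay hφ1 (fun x => (hφtop x).ne)
    (fun x => ne_top_of_le_ne_top (ENNReal.mul_ne_top (by simp [hL]) (hφtop x).ne) (hB h x))
    hD hρ hρ1 hdec
  -- The transition operators commute, so the image of `π` under any of them is again invariant for
  -- the skeleton; it integrates `φ`, and uniqueness identifies it with `π`.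
  have hinv' : ∀ t, π.bind (X.trans t) = π := fun t => by
    refine (eq_of_invariant_of_decay hφ1 hD hρ hρ1 hdec (by simp) hπφ ?_ hinv ?_).symm
    · rw [Measure.lintegral_bind (X.trans t).aemeasurable (hφ _ inferInstance)]
      refine ne_top_of_le_ne_top ?_ (lintegral_mono fun x => hB t x)
      rw [lintegral_const_mul'' _ (hφ π inferInstance)]
      exact ENNReal.mul_ne_top (by simp [hL]) hπφ
    · rw [X.trans_bind_add, add_comm, ← X.trans_bind_add, hinv]
  set I := ∫⁻ x, φ x ∂π with hI
  refine ⟨fun x => ⟨hφ1 x, hφtop x⟩, fun μ _ => hφ μ inferInstance, π, hπ, hinv',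
    (1 + L).toReal * (1 + I).toReal * D * ρ⁻¹, -Real.log ρ / h, ?_, ?_, fun x => ?_⟩
  · have h1 : 0 < (1 + L).toReal := ENNReal.toReal_pos (by simp) (by simp [hL])
    have h2 : 0 < (1 + I).toReal := ENNReal.toReal_pos (by simp) (by simp [hπφ])
    positivity
  · exact div_pos (neg_pos.2 (Real.log_neg hρ hρ1)) hh
  have hδ : ∫⁻ y, φ y ∂Measure.dirac x = φ x := lintegral_dirac _ _
  have hdx : ∀ n, _ := hdec (Measure.dirac x) π (by simp) (by rw [hδ]; exact (hφtop x).ne) hπφ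
  obtain ⟨Q, hQ, hQt⟩ := X.exists_coupling_of_decay hφ hφ1 hB hh
    (ENNReal.tendsto_atTop_zero_of_tsum_ne_top (tsum_geometric_mul_ne_top hD hρ hρ1
      (ENNReal.add_ne_top.2 ⟨by rw [hδ]; exact (hφtop x).ne, hπφ⟩))) hdx
  refine ⟨_, inferInstance, Q, Prod.fst, Prod.snd, hQ, fun t => (hQt t).trans ?_⟩
  rw [hδ]
  have h1 : φ x + I ≤ (1 + I) * φ x := by
    rw [add_mul, one_mul]
    gcongr
    exact le_mul_of_one_le_right' (hφ1 x)
  calc (1 + L) * (ENNReal.ofReal (D * ρ ^ ⌊t / h⌋₊) * (φ x + I))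
      ≤ (1 + L) * (ENNReal.ofReal (D * (ρ⁻¹ * Real.exp (-(-Real.log ρ / h) * t))) *
        ((1 + I) * φ x)) := by
        gcongr
        exact pow_floor_le_exp hρ hρ1 h t
    _ = ENNReal.ofReal (1 + L).toReal * ENNReal.ofReal (1 + I).toReal *
        ENNReal.ofReal (D * (ρ⁻¹ * Real.exp (-(-Real.log ρ / h) * t))) * φ x := by
        rw [ENNReal.ofReal_toReal (by simp [hL]), ENNReal.ofReal_toReal (by simp [hπφ])]
        ring
    _ = _ := by
        rw [← ENNReal.ofReal_mul ENNReal.toReal_nonneg, ← ENNReal.ofReal_mul (by positivity)]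
        congr 2
        ring

end CadlagStrongMarkov

theorem proposition2p2 {E : Type*} [MetricSpace E] [LocallyCompactSpace E]
    [TopologicalSpace.SeparableSpace E] [Nonempty E] [MeasurableSpace E] [BorelSpace E]
    (X : CadlagStrongMarkov E) (hD : X.LocalDoeblin)
    (K : Set E) (hK : IsCompact K) (S : ℝ≥0) (hS : 0 < S) (α : ℝ) (hα : 0 < α)
    (h1 : (∃ ℓ : ℝ≥0∞, 0 < ℓ ∧
        Tendsto (fun c : ℝ≥0 => liminf (fun x => X.law x {ω | (c : ℝ≥0∞) < CadlagPath.hit K ω})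
          (cocompact E)) atTop (𝓝 ℓ)) ∨ X.ExtendedDoeblinOn K)
    (h2 : ∀ x, X.expHit K α x < ∞)
    (h3 : (⨆ x ∈ K, ⨆ t ∈ Icc 0 S, X.expHitAfter K α t x) < ∞)
    (α' : ℝ) (hα' : α' ∈ Ioo 0 α) :
    X.AdmitsExpCoupling (X.expHit K α') := by
  have hKc := hK.isClosed
  have ha := hα'.1
  have hle := hα'.2.le
  obtain ⟨L, hL, hlyap⟩ := X.exists_lyapunov hKc ha hS h3.ne fun u hu y hy => by
    rw [← X.expHitAfter_eq hKc]
    refine le_trans ?_ (le_iSup₂_of_le y hy (le_iSup₂_of_le u ⟨zero_le, hu⟩ le_rfl))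
    rw [X.expHitAfter_eq hKc, X.expHitAfter_eq hKc]
    exact lintegral_mono fun z => X.expHit_mono K ha hle z
  refine X.admitsExpCoupling_of_lyapunov (X.univMeasurable_expHit hKc α')
    (fun x => X.one_le_expHit K ha x) (fun x => (X.expHit_mono K ha hle x).trans_lt (h2 x)) ha hL
    hlyap fun R hR => ?_
  rcases h1 with ⟨ℓ, hℓ, hlim⟩ | hE
  · exact X.exists_overlap_of_localDoeblin hD hKc hℓ hlim ha hR
  -- On `K` the Lyapunov function equals 1, so its expectation is at most `1 + L` uniformly in time.
  · refine X.exists_overlap_of_extendedDoeblin hKc hE ha (L := 1 + L) (by simp [hL])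
      (fun t x hx => (hlyap t x).trans ?_) hR
    rw [X.expHit_of_mem α' hx, mul_one]
    gcongr
    rw [ENNReal.ofReal_le_one, Real.exp_le_one_iff]
    have : (0 : ℝ) ≤ t := t.2
    nlinarith
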